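/- Let $\ell\ge 1$, $m\ge 1$, $0\le n\le m-1$ and let $\zeta\in\mathbb C$ be a primitive $m$th root of unity. Let $\widehat{\mathfrak{sl}}_{\ell+1}=(\mathfrak{sl}_{\ell+1}\otimes\mathbb C[z,z^{-1}])\oplus\mathbb CK\oplus\mathbb CD$ be the affine Lie algebra ($K$ central, $D=z\frac{d}{dz}$), with simple roots $\alpha_i$ and simple coroots $\alpha_i^\vee$, $i\in I=\mathbb Z/(\ell+1)\mathbb Z$, $\delta=\sum_i\alpha_i$, and weight lattice $P=\bigoplus_{i\in I}\mathbb Z\Lambda_i\oplus\mathbb Z\delta$, where $\alpha_i^\vee(\Lambda_j)=\delta_{i,j}$ and $\Lambda_j(D)=0$, $\delta(D)=1$. *The crystal.* Let $B_\ell=\{b_i\}_{i\in I}$ be the crystal with $e_ib_j=\delta_{i,j}b_{j-1}$, $f_ib_j=\delta_{i-1,j}b_i$, $\varepsilon_i(b_j)=\delta_{i,j}$, $\operatorname{wt}b_j=\Lambda_{j+1}-\Lambda_j$. On $B_\ell^{\otimes m}$, put $r^i_k(b_1\otimes\cdots\otimes b_m)=\varepsilon_i(b_k)-\sum_{j<k}\alpha_i^\vee(\operatorname{wt}b_j)$;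 $\varepsilon_i$ is the maximum of the $r^i_k$, $e_i$ (resp. $f_i$) acts in the leftmost (resp. rightmost) place where the maximum is attained, and weights add. Let $\widehat B_{\ell,m}=B_\ell^{\otimes m}\times\mathbb Z=\{b\otimes z^k\}$ with $\operatorname{wt}(b\otimes z^k)=\operatorname{wt}b+k\delta$, $e_i(b\otimes z^k)=e_ib\otimes z^{k+\delta_{i,0}}$, $f_i(b\otimes z^k)=f_ib\otimes z^{k-\delta_{i,0}}$, $\varepsilon_i(b\otimes z^k)=\varepsilon_i(b)$, and let $\widehat B^n_{\ell,m}$ be its subcrystal generated by $b_0^{\otimes m}\otimes z^n$ under all $e_i,f_i$. *The module.* Let $V=\mathbb C^{\ell+1}$ be the natural representation of $\mathfrak{sl}_{\ell+1}$ with highest weight vector $v$. Let $\widehat{\mathfrak{sl}}_{\ell+1}$ act on $V^{\otimes m}\otimes\mathbb C[z,z^{-1}]$ by $(x\otimes z^k)(w\otimes z^s)=\sum_{j=1}^m\zeta^{jk}x^{(j)}w\otimes z^{k+s}$, where $x^{(j)}$ is $x$ acting on the $j$th tensor factor, $K\mapsto 0$, $D(w\otimes z^s)=s\,w\otimes z^s$,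 and let $L(\ell,m;n)$ be the submodule generated by $v^{\otimes m}\otimes z^n$. **Theorem.** The crystal $\widehat B^n_{\ell,m}$ is indecomposable (it has no non-empty subcrystal other than itself), the module $L(\ell,m;n)$ is simple, integrable (the direct sum of its weight spaces for weights in $P$, with the Chevalley generators acting locally nilpotently) and of level zero, for each $\mu\in P$ the set $(\widehat B^n_{\ell,m})_\mu$ of elements of weight $\mu$ is finite and the weight space $L(\ell,m;n)_\mu$ is finite-dimensional, and the formal characters coincide: $$\#(\widehat B^n_{\ell,m})_\mu=\dim L(\ell,m;n)_\mu\qquad\text{for all }\mu\in P .$$ Moreover, for $k_0,\dots,k_\ell\in\mathbb N$ with $\sum_ik_i=m$, $\nu=\sum_{i\in I}k_i(\Lambda_{i+1}-\Lambda_i)$ and $r\in\mathbb Z$, this common value at $\mu=\nu+r\delta$ is $$\frac1m\sum_{d\mid\gcd(k_0,\dots,k_\ell)}\varphi_{r-n}(d)\binom{m/d}{k_0/d,\dots,k_\ell/d},\qquad \varphi_s(d)=\varphi(d)\,\frac{\mu(d/\gcd(d,s))}{\varphi(d/\gcd(d,s))},$$ where $\varphi$ is Euler's function and $\mu$ the Möbius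 function, and it is $0$ at every weight not of the form $\nu+r\delta$ with such a $\nu$. -/

import Mathlib

open scoped TensorProduct

namespace LevelZero

noncomputable section

/-- A realisation of a generalised Cartan matrix `A`, recorded through its weight lattice `P`,
the simple roots `α_i ∈ P` and the simple coroots `α_i^∨ : P → ℤ`.  The simple roots are not
assumed to be linearly independent. -/
structure Realisation {I : Type} (A : Matrix I I ℤ) (P : Type) [AddCommGroup P] where
  /-- The simple root `α_i`. -/
  root : I → P
  /-- The simple coroot `α_i^∨`. -/
  coroot : I → P →+ ℤ
  coroot_root : ∀ i j, coroot i (root j) = A i j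
  diag : ∀ i, A i i = 2

theorem Realisation.coroot_root_self {I : Type} {A : Matrix I I ℤ} {P : Type} [AddCommGroup P]
    (R : Realisation A P) (i : I) : R.coroot i (R.root i) = 2 := by
  rw [R.coroot_root, R.diag]

/-- A crystal with weights in `P`.  The value `none` of `e_i`, `f_i` stands for `0`, and
`⊥ : WithBot ℤ` for `-∞`.  The function `φ_i` is determined by `φ_i = ε_i + α_i^∨ ∘ wt` and is
defined below; the rules for `f_i` follow from those for `e_i` by `e_eq_iff`. -/
structure Crystal {I : Type} {A : Matrix I I ℤ} {P : Type} [AddCommGroup P]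
    (R : Realisation A P) (B : Type) where
  /-- The raising operator `e_i`. -/
  e : I → B → Option B
  /-- The lowering operator `f_i`. -/
  f : I → B → Option B
  /-- The function `ε_i`. -/
  ε : I → B → WithBot ℤ
  /-- The weight. -/
  wt : B → P
  wt_e : ∀ i b b', e i b = some b' → wt b' = wt b + R.root i
  ε_e : ∀ i b b', e i b = some b' → ε i b = ε i b' + 1
  e_eq_iff : ∀ i b b', e i b = some b' ↔ f i b' = some b
  e_bot : ∀ i b, ε i b = ⊥ → e i b = none
  f_bot : ∀ i b, ε i b = ⊥ → f i b = none

namespace Crystal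

variable {I : Type} {A : Matrix I I ℤ} {P : Type} [AddCommGroup P] {R : Realisation A P} {B : Type}

/-- The function `φ_i = ε_i + α_i^∨ ∘ wt`. -/
def φ (C : Crystal R B) (i : I) (b : B) : WithBot ℤ := C.ε i b + (R.coroot i (C.wt b) : ℤ)

theorem wt_f (C : Crystal R B) (i : I) (b b' : B) (h : C.f i b = some b') :
    C.wt b' = C.wt b - R.root i := by
  rw [C.wt_e i b' b ((C.e_eq_iff i b' b).2 h), add_sub_cancel_right]

theorem ε_f (C : Crystal R B) (i : I) (b b' : B) (h : C.f i b = some b') :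
    C.ε i b' = C.ε i b + 1 :=
  C.ε_e i b' b ((C.e_eq_iff i b' b).2 h)

/-- A subset stable under all `e_i`, `f_i`, i.e. a subcrystal. -/
def IsSubcrystal (C : Crystal R B) (S : Set B) : Prop :=
  ∀ i, ∀ b ∈ S, (∀ b', C.e i b = some b' → b' ∈ S) ∧ (∀ b', C.f i b = some b' → b' ∈ S)

/-- The crystal structure on a subcrystal. -/
def restrict (C : Crystal R B) (S : Set B) (hS : C.IsSubcrystal S) : Crystal R S where
  e i b := (C.e i b.1).pmap (fun x hx => ⟨x, hx⟩) (fun x hx => (hS i b.1 b.2).1 x hx)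
  f i b := (C.f i b.1).pmap (fun x hx => ⟨x, hx⟩) (fun x hx => (hS i b.1 b.2).2 x hx)
  ε i b := C.ε i b.1
  wt b := C.wt b.1
  wt_e i b b' h := by
    rw [Option.pmap_eq_some_iff] at h
    obtain ⟨x, hx, hx', rfl⟩ := h
    exact C.wt_e i b.1 x hx'
  ε_e i b b' h := by
    rw [Option.pmap_eq_some_iff] at h
    obtain ⟨x, hx, hx', rfl⟩ := h
    exact C.ε_e i b.1 x hx'
  e_eq_iff i b b' := by
    have h1 : (C.e i b.1).pmap (fun x hx => (⟨x, hx⟩ : S)) (fun x hx => (hS i b.1 b.2).1 x hx) = some b'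
        ↔ C.e i b.1 = some b'.1 := by
      rw [Option.pmap_eq_some_iff]
      constructor
      · rintro ⟨x, hx, hx', rfl⟩; exact hx'
      · intro h; exact ⟨b'.1, b'.2, h, rfl⟩
    have h2 : (C.f i b'.1).pmap (fun x hx => (⟨x, hx⟩ : S)) (fun x hx => (hS i b'.1 b'.2).2 x hx) = some b
        ↔ C.f i b'.1 = some b.1 := by
      rw [Option.pmap_eq_some_iff]
      constructor
      · rintro ⟨x, hx, hx', rfl⟩; exact hx'
      · intro h; exact ⟨b.1, b.2, h, rfl⟩
    rw [h1, h2]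
    exact C.e_eq_iff i b.1 b'.1
  e_bot i b h := by
    rw [Option.pmap_eq_none_iff]
    exact C.e_bot i b.1 h
  f_bot i b h := by
    rw [Option.pmap_eq_none_iff]
    exact C.f_bot i b.1 h

/-- A crystal is indecomposable if it has no non-empty subcrystal other than itself. -/
def IsIndecomposable (C : Crystal R B) : Prop :=
  ∀ S : Set B, S.Nonempty → C.IsSubcrystal S → S = Set.univ

/-- `x` lies in `𝒜 b`, where `𝒜` is the monoid generated by the `e_i` and `f_i`. -/
inductive Reaches (C : Crystal R B) (b : B) : B → Prop
  | refl : Reaches C b b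
  | e_step (i : I) (x y : B) : Reaches C b x → C.e i x = some y → Reaches C b y
  | f_step (i : I) (x y : B) : Reaches C b x → C.f i x = some y → Reaches C b y

/-- The set `𝒜 b = {f b : f ∈ 𝒜} \ {0}`. -/
def generatedSet (C : Crystal R B) (b : B) : Set B := {x | C.Reaches b x}

theorem isSubcrystal_generatedSet (C : Crystal R B) (b : B) :
    C.IsSubcrystal (C.generatedSet b) := fun i x hx =>
  ⟨fun y hy => Reaches.e_step i x y hx hy, fun y hy => Reaches.f_step i x y hx hy⟩

/-- The subcrystal generated by `b`. -/
def generated (C : Crystal R B) (b : B) : Crystal R (C.generatedSet b) :=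
  C.restrict (C.generatedSet b) (C.isSubcrystal_generatedSet b)

/-- The elements of weight `μ`. -/
def weightSet (C : Crystal R B) (μ : P) : Set B := {b | C.wt b = μ}

/-- All the sets of elements of a given weight are finite. -/
def IsAdmissible (C : Crystal R B) : Prop := ∀ μ, (C.weightSet μ).Finite

/-- The formal character `∑_μ #B_μ e^μ`, as the function `μ ↦ #B_μ`. -/
def ch (C : Crystal R B) (μ : P) : ℕ := (C.weightSet μ).ncard

section Tensor

variable {m : ℕ}

/-- The Kashiwara function `r_k^i(b) = ε_i(b_k) - ∑_{j<k} α_i^∨(wt b_j)`. -/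
def kashiwara (C : Crystal R B) (i : I) (b : Fin m → B) (k : Fin m) : WithBot ℤ :=
  C.ε i (b k) + ((-∑ j ∈ Finset.univ.filter (· < k), R.coroot i (C.wt (b j)) : ℤ) : WithBot ℤ)

/-- `ε_i(b) = max_k r_k^i(b)`. -/
def tensorε [NeZero m] (C : Crystal R B) (i : I) (b : Fin m → B) : WithBot ℤ :=
  Finset.univ.sup' Finset.univ_nonempty (C.kashiwara i b)

/-- The set of places where the maximal value of `r_k^i(b)` is attained. -/
def maxPlaces [NeZero m] (C : Crystal R B) (i : I) (b : Fin m → B) : Finset (Fin m) :=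
  Finset.univ.filter fun k => C.kashiwara i b k = C.tensorε i b

theorem maxPlaces_nonempty [NeZero m] (C : Crystal R B) (i : I) (b : Fin m → B) :
    (C.maxPlaces i b).Nonempty := by
  obtain ⟨k, -, hk⟩ := Finset.exists_mem_eq_sup' Finset.univ_nonempty (C.kashiwara i b)
  exact ⟨k, Finset.mem_filter.2 ⟨Finset.mem_univ _, hk.symm⟩⟩

/-- The leftmost place where the maximum is attained. -/
def leftPlace [NeZero m] (C : Crystal R B) (i : I) (b : Fin m → B) : Fin m :=
  (C.maxPlaces i b).min' (C.maxPlaces_nonempty i b)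

/-- The rightmost place where the maximum is attained. -/
def rightPlace [NeZero m] (C : Crystal R B) (i : I) (b : Fin m → B) : Fin m :=
  (C.maxPlaces i b).max' (C.maxPlaces_nonempty i b)

theorem kashiwara_le [NeZero m] (C : Crystal R B) (i : I) (b : Fin m → B) (k : Fin m) :
    C.kashiwara i b k ≤ C.tensorε i b :=
  Finset.le_sup' (C.kashiwara i b) (Finset.mem_univ k)

theorem leftPlace_eq_iff [NeZero m] (C : Crystal R B) (i : I) (b : Fin m → B) (k : Fin m) :
    C.leftPlace i b = k ↔ C.kashiwara i b k = C.tensorε i b ∧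
      ∀ j < k, C.kashiwara i b j < C.tensorε i b := by
  rw [leftPlace, Finset.min'_eq_iff]
  simp only [maxPlaces, Finset.mem_filter, Finset.mem_univ, true_and]
  refine and_congr_right fun _ => ⟨fun h j hj => ?_, fun h j hj => ?_⟩
  · exact lt_of_le_of_ne (C.kashiwara_le i b j) fun e => absurd (h j e) (not_le.2 hj)
  · by_contra hlt
    exact (h j (not_le.1 hlt)).ne hj

theorem rightPlace_eq_iff [NeZero m] (C : Crystal R B) (i : I) (b : Fin m → B) (k : Fin m) :
    C.rightPlace i b = k ↔ C.kashiwara i b k = C.tensorε i b ∧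
      ∀ j, k < j → C.kashiwara i b j < C.tensorε i b := by
  rw [rightPlace, Finset.max'_eq_iff]
  simp only [maxPlaces, Finset.mem_filter, Finset.mem_univ, true_and]
  refine and_congr_right fun _ => ⟨fun h j hj => ?_, fun h j hj => ?_⟩
  · exact lt_of_le_of_ne (C.kashiwara_le i b j) fun e => absurd (h j e) (not_le.2 hj)
  · by_contra hlt
    exact (h j (not_le.1 hlt)).ne hj

theorem tensorε_eq [NeZero m] (C : Crystal R B) (i : I) (b : Fin m → B) (k : Fin m) (M : WithBot ℤ)
    (h : C.kashiwara i b k = M) (hle : ∀ j, C.kashiwara i b j ≤ M) : C.tensorε i b = M :=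
  le_antisymm (Finset.sup'_le _ _ fun j _ => hle j) (h ▸ C.kashiwara_le i b k)

/-- How the Kashiwara functions change when `e_i` is applied in the `k`-th place. -/
theorem kashiwara_update (C : Crystal R B) (i : I) (b : Fin m → B) (k : Fin m) (y : B)
    (hy : C.e i (b k) = some y) (j : Fin m) :
    (j < k → C.kashiwara i (Function.update b k y) j = C.kashiwara i b j) ∧
    (C.kashiwara i b k = C.kashiwara i (Function.update b k y) k + 1) ∧
    (k < j → C.kashiwara i b j = C.kashiwara i (Function.update b k y) j + 2) := by
  have hs : ∀ j, j ≤ k → ∑ x ∈ Finset.univ.filter (· < j),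
      R.coroot i (C.wt (Function.update b k y x)) =
      ∑ x ∈ Finset.univ.filter (· < j), R.coroot i (C.wt (b x)) := fun j hj =>
    Finset.sum_congr rfl fun x hx => by
      rw [Function.update_of_ne (((Finset.mem_filter.1 hx).2.trans_le hj).ne)]
  refine ⟨fun hj => ?_, ?_, fun hj => ?_⟩
  · rw [kashiwara, kashiwara, hs j hj.le, Function.update_of_ne hj.ne]
  · rw [kashiwara, kashiwara, hs k le_rfl, Function.update_self, C.ε_e i _ _ hy, add_right_comm]
  · have hk : k ∈ Finset.univ.filter (· < j) := by simpa using hj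
    rw [kashiwara, kashiwara, Function.update_of_ne hj.ne', add_assoc]
    congr 1
    rw [← Finset.add_sum_erase _ _ hk, ← Finset.add_sum_erase _ _ hk, Function.update_self,
      C.wt_e i _ _ hy, map_add, R.coroot_root_self]
    have : ∑ x ∈ (Finset.univ.filter (· < j)).erase k,
      R.coroot i (C.wt (Function.update b k y x)) =
      ∑ x ∈ (Finset.univ.filter (· < j)).erase k, R.coroot i (C.wt (b x)) :=
      Finset.sum_congr rfl fun x hx => by
        rw [Function.update_of_ne (Finset.ne_of_mem_erase hx)]
    rw [this]
    have h2 : (2 : WithBot ℤ) = ((2 : ℤ) : WithBot ℤ) := rfl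
    rw [h2, ← WithBot.coe_add]
    congr 1
    ring

theorem kashiwara_eq_bot_iff (C : Crystal R B) (i : I) (b : Fin m → B) (k : Fin m) :
    C.kashiwara i b k = ⊥ ↔ C.ε i (b k) = ⊥ := by
  simp [kashiwara]

/-- Applying `e_i` in the leftmost maximal place produces an element whose rightmost maximal
place is the same, and conversely; `ε_i` drops by one. -/
theorem place_iff [NeZero m] (C : Crystal R B) (i : I) (b : Fin m → B) (k : Fin m) (y : B)
    (hy : C.e i (b k) = some y) :
    (C.leftPlace i b = k ↔ C.rightPlace i (Function.update b k y) = k) ∧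
    (C.leftPlace i b = k → C.tensorε i b = C.tensorε i (Function.update b k y) + 1) := by
  set b' := Function.update b k y with hb'
  have hK := fun j => C.kashiwara_update i b k y hy j
  rw [← hb'] at hK
  have hne : C.kashiwara i b k ≠ ⊥ := by
    rw [Ne, kashiwara_eq_bot_iff]
    intro h
    rw [C.e_bot i _ h] at hy
    exact absurd hy (by simp)
  obtain ⟨M, hM⟩ : ∃ M : ℤ, C.kashiwara i b' k = (M : WithBot ℤ) := by
    cases h : C.kashiwara i b' k with
    | bot => rw [(hK k).2.1, h] at hne; exact absurd rfl hne
    | coe M => exact ⟨M, rfl⟩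
  have hM1 : C.kashiwara i b k = ((M + 1 : ℤ) : WithBot ℤ) := by rw [(hK k).2.1, hM]; rfl
  have lt_succ : ∀ x : WithBot ℤ, x < ((M + 1 : ℤ) : WithBot ℤ) ↔ x ≤ (M : WithBot ℤ) := by
    intro x
    cases x with
    | bot => simp
    | coe x => rw [WithBot.coe_lt_coe, WithBot.coe_le_coe]; omega
  have add_two : ∀ x : WithBot ℤ, x + 2 ≤ ((M + 1 : ℤ) : WithBot ℤ) ↔ x < (M : WithBot ℤ) := by
    intro x
    cases x with
    | bot => simp
    | coe x =>
      have : ((x : WithBot ℤ) + 2) = ((x + 2 : ℤ) : WithBot ℤ) := rfl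
      rw [this, WithBot.coe_lt_coe, WithBot.coe_le_coe]; omega
  have key1 : C.leftPlace i b = k ↔ (∀ j < k, C.kashiwara i b' j ≤ (M : WithBot ℤ)) ∧
      (∀ j, k < j → C.kashiwara i b' j < (M : WithBot ℤ)) := by
    rw [leftPlace_eq_iff]
    constructor
    · rintro ⟨h1, h2⟩
      rw [hM1] at h1
      refine ⟨fun j hj => ?_, fun j hj => ?_⟩
      · rw [(hK j).1 hj, ← lt_succ, h1]
        exact h2 j hj
      · rw [← add_two, ← (hK j).2.2 hj, h1]
        exact C.kashiwara_le i b j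
    · rintro ⟨h1, h2⟩
      have : C.tensorε i b = ((M + 1 : ℤ) : WithBot ℤ) := by
        refine C.tensorε_eq i b k _ hM1 fun j => ?_
        rcases lt_trichotomy j k with hj | rfl | hj
        · exact ((lt_succ _).2 ((hK j).1 hj ▸ h1 j hj)).le
        · exact hM1.le
        · rw [(hK j).2.2 hj, add_two]
          exact h2 j hj
      rw [this]
      exact ⟨hM1, fun j hj => (lt_succ _).2 ((hK j).1 hj ▸ h1 j hj)⟩
  have key2 : C.rightPlace i b' = k ↔ (∀ j < k, C.kashiwara i b' j ≤ (M : WithBot ℤ)) ∧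
      (∀ j, k < j → C.kashiwara i b' j < (M : WithBot ℤ)) := by
    rw [rightPlace_eq_iff]
    constructor
    · rintro ⟨h1, h2⟩
      rw [hM] at h1
      rw [← h1] at h2
      exact ⟨fun j _ => h1 ▸ C.kashiwara_le i b' j, h2⟩
    · rintro ⟨h1, h2⟩
      have : C.tensorε i b' = (M : WithBot ℤ) := by
        refine C.tensorε_eq i b' k _ hM fun j => ?_
        rcases lt_trichotomy j k with hj | rfl | hj
        · exact h1 j hj
        · exact hM.le
        · exact (h2 j hj).le
      rw [this]
      exact ⟨hM, h2⟩
  refine ⟨key1.trans key2.symm, fun h => ?_⟩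
  have h' := key2.2 (key1.1 h)
  rw [← ((C.leftPlace_eq_iff i b k).1 h).1, ← ((C.rightPlace_eq_iff i b' k).1 h').1]
  exact (hK k).2.1

/-- The tensor power `B^{⊗m}`, `m ≥ 1`; the element `b_1 ⊗ ⋯ ⊗ b_m` is the tuple `b`.
The operator `e_i` acts in the leftmost and `f_i` in the rightmost place where the maximum of the
Kashiwara functions `r_k^i(b)` is attained. -/
def tensorPower (C : Crystal R B) (m : ℕ) [NeZero m] : Crystal R (Fin m → B) where
  e i b := (C.e i (b (C.leftPlace i b))).map (Function.update b (C.leftPlace i b))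
  f i b := (C.f i (b (C.rightPlace i b))).map (Function.update b (C.rightPlace i b))
  ε := C.tensorε
  wt b := ∑ k, C.wt (b k)
  wt_e i b b' h := by
    obtain ⟨y, hy, rfl⟩ := Option.map_eq_some_iff.1 h
    rw [← Finset.add_sum_erase _ _ (Finset.mem_univ (C.leftPlace i b)),
      ← Finset.add_sum_erase _ _ (Finset.mem_univ (C.leftPlace i b)), Function.update_self,
      C.wt_e i _ _ hy, add_right_comm]
    congr 2
    exact Finset.sum_congr rfl fun x hx => by
      rw [Function.update_of_ne (Finset.ne_of_mem_erase hx)]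
  ε_e i b b' h := by
    obtain ⟨y, hy, rfl⟩ := Option.map_eq_some_iff.1 h
    exact (C.place_iff i b _ y hy).2 rfl
  e_eq_iff i b b' := by
    rw [Option.map_eq_some_iff, Option.map_eq_some_iff]
    constructor
    · rintro ⟨y, hy, rfl⟩
      have := (C.place_iff i b _ y hy).1.1 rfl
      rw [this, Function.update_self]
      exact ⟨_, (C.e_eq_iff i _ _).1 hy, by simp⟩
    · rintro ⟨x, hx, rfl⟩
      set k := C.rightPlace i b' with hk
      have hy : C.e i (Function.update b' k x k) = some (b' k) := by
        rw [Function.update_self]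
        exact (C.e_eq_iff i _ _).2 hx
      have hu : Function.update (Function.update b' k x) k (b' k) = b' := by simp
      have := (C.place_iff i (Function.update b' k x) k (b' k) hy).1
      rw [hu] at this
      rw [this.2 hk.symm]
      exact ⟨b' k, hy, hu⟩
  e_bot i b h := by
    have h1 := ((C.leftPlace_eq_iff i b _).1 rfl).1
    rw [h, kashiwara_eq_bot_iff] at h1
    rw [C.e_bot i _ h1, Option.map_none]
  f_bot i b h := by
    have h1 := ((C.rightPlace_eq_iff i b _).1 rfl).1
    rw [h, kashiwara_eq_bot_iff] at h1
    rw [C.f_bot i _ h1, Option.map_none]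

end Tensor

end Crystal

/-- The Cartan matrix of type `A_ℓ^{(1)}`: `a_ij = 2 δ_{i,j} - δ_{i,j-1} - δ_{i-1,j}`, with indices
modulo `ℓ + 1`. -/
def affineCartan (ℓ : ℕ) : Matrix (Fin (ℓ + 1)) (Fin (ℓ + 1)) ℤ := fun i j =>
  2 * (if i = j then 1 else 0) - (if i = j - 1 then 1 else 0) - (if i - 1 = j then 1 else 0)

theorem sub_one_ne (ℓ : ℕ) [NeZero ℓ] (i : Fin (ℓ + 1)) : i - 1 ≠ i := by
  intro h
  rw [sub_eq_self] at h
  exact NeZero.ne ℓ (Nat.succ.inj (Fin.one_eq_zero_iff.1 h))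

theorem affineCartan_diag (ℓ : ℕ) [NeZero ℓ] (i : Fin (ℓ + 1)) : affineCartan ℓ i i = 2 := by
  have := sub_one_ne ℓ i
  simp [affineCartan, this, this.symm]

/-- The lattice `P_0(π) = ⨁ ℤ Λ_i`; the tuple `c` stands for `∑ c_i Λ_i`. -/
abbrev FiniteWeight (ℓ : ℕ) : Type := Fin (ℓ + 1) → ℤ

/-- The lattice `P(π) = P_0(π) ⊕ ℤ δ`; the pair `(c, k)` stands for `∑ c_i Λ_i + k δ`. -/
abbrev AffineWeight (ℓ : ℕ) : Type := (Fin (ℓ + 1) → ℤ) × ℤ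

/-- The fundamental weight `Λ_i`. -/
def fundWeight (ℓ : ℕ) (i : Fin (ℓ + 1)) : FiniteWeight ℓ := Pi.single i 1

/-- The realisation with weights modulo `δ`. -/
def finiteRealisation (ℓ : ℕ) [NeZero ℓ] : Realisation (affineCartan ℓ) (FiniteWeight ℓ) where
  root j := fun i => affineCartan ℓ i j
  coroot i := Pi.evalAddMonoidHom _ i
  coroot_root _ _ := rfl
  diag := affineCartan_diag ℓ

/-- The realisation in the sense of Kac, in which `δ = α_0 + ⋯ + α_ℓ`. -/
def affineRealisation (ℓ : ℕ) [NeZero ℓ] : Realisation (affineCartan ℓ) (AffineWeight ℓ) where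
  root j := (fun i => affineCartan ℓ i j, if j = 0 then 1 else 0)
  coroot i := (Pi.evalAddMonoidHom _ i).comp (AddMonoidHom.fst _ _)
  coroot_root _ _ := rfl
  diag := affineCartan_diag ℓ

/-- The finite crystal `B_ℓ = {b_0, …, b_ℓ}`: `e_i b_j = δ_{i,j} b_{j-1}`,
`f_i b_j = δ_{i-1,j} b_i`, `ε_i(b_j) = δ_{i,j}`, `wt b_j = Λ_{j+1} - Λ_j`. -/
def basicCrystal (ℓ : ℕ) [NeZero ℓ] : Crystal (finiteRealisation ℓ) (Fin (ℓ + 1)) where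
  e i j := if i = j then some (j - 1) else none
  f i j := if i - 1 = j then some i else none
  ε i j := if i = j then 1 else 0
  wt j := fundWeight ℓ (j + 1) - fundWeight ℓ j
  wt_e i j j' h := by
    split_ifs at h with hij
    subst hij
    obtain rfl := Option.some.inj h
    funext k
    have h1 : i = k + 1 ↔ k = i - 1 := eq_comm.trans eq_sub_iff_add_eq.symm
    simp only [finiteRealisation, fundWeight, affineCartan, Pi.add_apply, Pi.sub_apply,
      Pi.single_apply, sub_add_cancel]
    have h2 : k - 1 = i ↔ k = i + 1 := sub_eq_iff_eq_add
    simp only [h2]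
    ring
  ε_e i j j' h := by
    split_ifs at h with hij
    subst hij
    obtain rfl := Option.some.inj h
    simp [(sub_one_ne ℓ i).symm]
  e_eq_iff i j j' := by
    by_cases h : i = j
    · subst h
      simp
    · by_cases h' : i - 1 = j'
      · simp [h, h']
      · simp [h, h']
  e_bot i j h := by split_ifs at h <;> exact absurd h (by decide)
  f_bot i j h := by split_ifs at h <;> exact absurd h (by decide)

/-- The crystal `B_ℓ(m) = B_ℓ^{⊗m}`. -/
def wordCrystal (ℓ m : ℕ) [NeZero ℓ] [NeZero m] :
    Crystal (finiteRealisation ℓ) (Fin m → Fin (ℓ + 1)) :=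
  (basicCrystal ℓ).tensorPower m

/-- The affinisation of a finite crystal `B`, with underlying set `B × ℤ`; the pair `(b, k)` is
denoted `b ⊗ z^k`. One has `wt (b ⊗ z^k) = wt b + k δ`, the operator `e_0` raises and `f_0` lowers
the exponent by one. -/
def affinisation {ℓ : ℕ} [NeZero ℓ] {B : Type} (C : Crystal (finiteRealisation ℓ) B) :
    Crystal (affineRealisation ℓ) (B × ℤ) where
  e i b := (C.e i b.1).map fun x => (x, b.2 + if i = 0 then 1 else 0)
  f i b := (C.f i b.1).map fun x => (x, b.2 - if i = 0 then 1 else 0)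
  ε i b := C.ε i b.1
  wt b := (C.wt b.1, b.2)
  wt_e i b b' h := by
    obtain ⟨y, hy, rfl⟩ := Option.map_eq_some_iff.1 h
    simp only [C.wt_e i _ _ hy]
    rfl
  ε_e i b b' h := by
    obtain ⟨y, hy, rfl⟩ := Option.map_eq_some_iff.1 h
    exact C.ε_e i _ _ hy
  e_eq_iff i b b' := by
    obtain ⟨b, k⟩ := b
    obtain ⟨b', k'⟩ := b'
    simp only [Option.map_eq_some_iff, Prod.mk.injEq]
    constructor
    · rintro ⟨y, hy, rfl, rfl⟩
      exact ⟨b, (C.e_eq_iff i _ _).1 hy, rfl, by ring⟩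
    · rintro ⟨y, hy, rfl, rfl⟩
      exact ⟨b', (C.e_eq_iff i _ _).2 hy, rfl, by ring⟩
  e_bot i b h := by simp only [C.e_bot i _ h, Option.map_none]
  f_bot i b h := by simp only [C.f_bot i _ h, Option.map_none]

/-- The affine crystal `B̂_{ℓ,m}`. -/
def affineCrystal (ℓ m : ℕ) [NeZero ℓ] [NeZero m] :
    Crystal (affineRealisation ℓ) ((Fin m → Fin (ℓ + 1)) × ℤ) :=
  affinisation (wordCrystal ℓ m)

/-- The element `b_0^{⊗m} ⊗ z^n`. -/
def crystalGen (ℓ m : ℕ) (n : ℤ) : (Fin m → Fin (ℓ + 1)) × ℤ := (fun _ => 0, n)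

/-- The crystal `B̂^n_{ℓ,m}`: the subcrystal of `B̂_{ℓ,m}` generated by `b_0^{⊗m} ⊗ z^n`. -/
def affineCrystalComponent (ℓ m : ℕ) [NeZero ℓ] [NeZero m] (n : ℤ) :
    Crystal (affineRealisation ℓ) ((affineCrystal ℓ m).generatedSet (crystalGen ℓ m n)) :=
  (affineCrystal ℓ m).generated (crystalGen ℓ m n)

/-- The Laurent monomial `z^k`. -/
def zPow (k : ℤ) : AddMonoidAlgebra ℂ ℤ := AddMonoidAlgebra.single k 1

theorem zPow_mul (k l : ℤ) : zPow k * zPow l = zPow (k + l) := by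
  rw [zPow, zPow, AddMonoidAlgebra.single_mul_single, one_mul, zPow]

theorem basis_zPow (k : ℤ) : AddMonoidAlgebra.basis ℤ ℂ k = zPow k := by
  simp [zPow]

/-- The Euler operator `z d/dz` on `ℂ[z, z⁻¹]`. -/
def zddz : AddMonoidAlgebra ℂ ℤ →ₗ[ℂ] AddMonoidAlgebra ℂ ℤ :=
  (AddMonoidAlgebra.basis ℤ ℂ).constr ℂ (fun k => (k : ℂ) • zPow k)

theorem zddz_zPow (k : ℤ) : zddz (zPow k) = (k : ℂ) • zPow k := by
  rw [zddz, ← basis_zPow, Module.Basis.constr_basis, basis_zPow]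

/-- The loop space `L(V) = V ⊗ ℂ[z, z⁻¹]` of a complex vector space `V`. -/
def LoopSpace (V : Type) [AddCommGroup V] [Module ℂ V] : Type := AddMonoidAlgebra ℂ ℤ ⊗[ℂ] V

namespace LoopSpace

variable (V : Type) [AddCommGroup V] [Module ℂ V]

instance : AddCommGroup (LoopSpace V) := inferInstanceAs (AddCommGroup (AddMonoidAlgebra ℂ ℤ ⊗[ℂ] V))
instance : Module ℂ (LoopSpace V) := inferInstanceAs (Module ℂ (AddMonoidAlgebra ℂ ℤ ⊗[ℂ] V))

/-- The loop space is, by definition, a tensor product. -/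
def toTensor : LoopSpace V ≃ₗ[ℂ] AddMonoidAlgebra ℂ ℤ ⊗[ℂ] V := LinearEquiv.refl ℂ _

variable {V}

/-- The element `v ⊗ z^k` of `L(V)`. -/
def mono (k : ℤ) : V →ₗ[ℂ] LoopSpace V :=
  (toTensor V).symm.toLinearMap ∘ₗ TensorProduct.mk ℂ (AddMonoidAlgebra ℂ ℤ) V (zPow k)

theorem hom_ext {M : Type*} [AddCommMonoid M] [Module ℂ M] {f g : LoopSpace V →ₗ[ℂ] M}
    (h : ∀ k v, f (mono k v) = g (mono k v)) : f = g := by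
  have : f ∘ₗ (toTensor V).symm.toLinearMap = g ∘ₗ (toTensor V).symm.toLinearMap := by
    apply TensorProduct.ext
    apply (AddMonoidAlgebra.basis ℤ ℂ).ext
    intro k
    ext v
    rw [basis_zPow]
    exact h k v
  ext x
  exact LinearMap.congr_fun this (toTensor V x)

variable (V) in
/-- The Euler operator `z d/dz` on `L(V)`. -/
def euler : LoopSpace V →ₗ[ℂ] LoopSpace V :=
  (toTensor V).symm.toLinearMap ∘ₗ LinearMap.rTensor V zddz ∘ₗ (toTensor V).toLinearMap

theorem euler_mono (k : ℤ) (v : V) : euler V (mono k v) = (k : ℂ) • mono k v := by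
  simp [euler, mono, zddz_zPow, ← TensorProduct.smul_tmul', - TensorProduct.tmul_smul]

/-- The linear map `L(V) → M` with `v ⊗ z^k ↦ F k v`. -/
def lift {M : Type} [AddCommGroup M] [Module ℂ M] (F : ℤ → V →ₗ[ℂ] M) : LoopSpace V →ₗ[ℂ] M :=
  TensorProduct.lift ((AddMonoidAlgebra.basis ℤ ℂ).constr ℂ F) ∘ₗ (toTensor V).toLinearMap

theorem lift_mono {M : Type} [AddCommGroup M] [Module ℂ M] (F : ℤ → V →ₗ[ℂ] M) (k : ℤ) (v : V) :
    lift F (mono k v) = F k v := by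
  simp [lift, mono, ← basis_zPow, - AddMonoidAlgebra.basis_apply]

/-- The bilinear map with `(v ⊗ z^k, w ⊗ z^l) ↦ F k l v w`. -/
def lift₂ {W : Type} [AddCommGroup W] [Module ℂ W] {M : Type} [AddCommGroup M] [Module ℂ M]
    (F : ℤ → ℤ → V →ₗ[ℂ] W →ₗ[ℂ] M) : LoopSpace V →ₗ[ℂ] LoopSpace W →ₗ[ℂ] M :=
  lift fun k => (lift fun l => (F k l).flip).flip

theorem lift₂_mono {W : Type} [AddCommGroup W] [Module ℂ W] {M : Type} [AddCommGroup M]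
    [Module ℂ M] (F : ℤ → ℤ → V →ₗ[ℂ] W →ₗ[ℂ] M) (k l : ℤ) (v : V) (w : W) :
    lift₂ F (mono k v) (mono l w) = F k l v w := by
  rw [lift₂, lift_mono, LinearMap.flip_apply, lift_mono, LinearMap.flip_apply]

end LoopSpace

open LevelZero.LoopSpace (mono euler hom_ext euler_mono)

/-- The simple Lie algebra `sl_{ℓ+1}` over `ℂ`. -/
abbrev SlAlg (ℓ : ℕ) : Type := LieAlgebra.SpecialLinear.sl (Fin (ℓ + 1)) ℂ

/-- The loop algebra `L(sl_{ℓ+1}) = sl_{ℓ+1} ⊗ ℂ[z, z⁻¹]`. -/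
abbrev LoopSl (ℓ : ℕ) : Type := LoopSpace (SlAlg ℓ)

/-- The bracket of `sl_{ℓ+1}` as a bilinear map. -/
def slBracket (ℓ : ℕ) : SlAlg ℓ →ₗ[ℂ] SlAlg ℓ →ₗ[ℂ] SlAlg ℓ :=
  LinearMap.mk₂ ℂ (fun x y => ⁅x, y⁆) add_lie smul_lie lie_add (fun c x y => lie_smul c x y)

/-- The bracket of the loop algebra: `[x ⊗ z^k, y ⊗ z^l] = [x, y] ⊗ z^(k+l)`. -/
def loopBracket (ℓ : ℕ) : LoopSl ℓ →ₗ[ℂ] LoopSl ℓ →ₗ[ℂ] LoopSl ℓ :=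
  LoopSpace.lift₂ fun k l => (slBracket ℓ).compr₂ (mono (k + l))

theorem loopBracket_mono (ℓ : ℕ) (k l : ℤ) (x y : SlAlg ℓ) :
    loopBracket ℓ (mono k x) (mono l y) = mono (k + l) ⁅x, y⁆ := by
  rw [loopBracket, LoopSpace.lift₂_mono]
  rfl

theorem loopBracket_skew (ℓ : ℕ) (x y : LoopSl ℓ) : loopBracket ℓ x y = - loopBracket ℓ y x := by
  have : loopBracket ℓ = - (loopBracket ℓ).flip := by
    apply hom_ext; intro k v
    apply hom_ext; intro l w
    rw [LinearMap.neg_apply, LinearMap.neg_apply, LinearMap.flip_apply, loopBracket_mono,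
      loopBracket_mono, ← lie_skew, add_comm l k, map_neg]
  exact LinearMap.congr_fun₂ this x y

theorem loopBracket_jacobi (ℓ : ℕ) (x y z : LoopSl ℓ) :
    loopBracket ℓ x (loopBracket ℓ y z) =
      loopBracket ℓ (loopBracket ℓ x y) z + loopBracket ℓ y (loopBracket ℓ x z) := by
  let A : LoopSl ℓ →ₗ[ℂ] LoopSl ℓ →ₗ[ℂ] LoopSl ℓ →ₗ[ℂ] LoopSl ℓ :=
    LinearMap.mk₂ ℂ (fun x y => (loopBracket ℓ x).comp (loopBracket ℓ y)
      - (loopBracket ℓ (loopBracket ℓ x y)) - (loopBracket ℓ y).comp (loopBracket ℓ x))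
      (by intros; ext; simp; abel) (by intros; ext; simp; module)
      (by intros; ext; simp; abel) (by intros; ext; simp; module)
  have hA : A = 0 := by
    apply hom_ext; intro a u
    apply hom_ext; intro b v
    apply hom_ext; intro c w
    simp only [A, LinearMap.mk₂_apply, LinearMap.sub_apply, LinearMap.comp_apply,
      loopBracket_mono, LinearMap.zero_apply]
    rw [show a + (b + c) = a + b + c by ring, show b + (a + c) = a + b + c by ring,
      leibniz_lie u v w, map_add]
    abel
  have := LinearMap.congr_fun (LinearMap.congr_fun₂ hA x y) z
  simp only [A, LinearMap.mk₂_apply, LinearMap.sub_apply, LinearMap.comp_apply,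
    LinearMap.zero_apply] at this
  rw [sub_sub, sub_eq_zero] at this
  exact this

instance (ℓ : ℕ) : LieRing (LoopSl ℓ) where
  bracket x y := loopBracket ℓ x y
  add_lie x y z := by rw [map_add, LinearMap.add_apply]
  lie_add x y z := by rw [map_add]
  lie_self x := by
    have := loopBracket_skew ℓ x x
    have h2 : (2 : ℂ) • loopBracket ℓ x x = 0 := by
      rw [two_smul]
      nth_rewrite 1 [this]
      exact neg_add_cancel _
    exact (smul_eq_zero.mp h2).resolve_left two_ne_zero
  leibniz_lie x y z := loopBracket_jacobi ℓ x y z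

instance (ℓ : ℕ) : LieAlgebra ℂ (LoopSl ℓ) where
  lie_smul c x y := map_smul (loopBracket ℓ x) c y

theorem loopBracket_apply (ℓ : ℕ) (x y : LoopSl ℓ) : loopBracket ℓ x y = ⁅x, y⁆ := rfl

theorem lie_mono (ℓ : ℕ) (k l : ℤ) (x y : SlAlg ℓ) :
    ⁅(mono k x : LoopSl ℓ), (mono l y : LoopSl ℓ)⁆ = mono (k + l) ⁅x, y⁆ :=
  loopBracket_mono ℓ k l x y

theorem euler_lie (ℓ : ℕ) (x y : LoopSl ℓ) :
    euler (SlAlg ℓ) ⁅x, y⁆ = ⁅euler (SlAlg ℓ) x, y⁆ + ⁅x, euler (SlAlg ℓ) y⁆ := by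
  have : (loopBracket ℓ).compr₂ (euler _) =
      (loopBracket ℓ).comp (euler _) + (loopBracket ℓ).compl₂ (euler _) := by
    apply hom_ext; intro k v
    apply hom_ext; intro l w
    simp only [LinearMap.add_apply, LinearMap.comp_apply, LinearMap.compl₂_apply, euler_mono,
      LinearMap.compr₂_apply, loopBracket_apply, lie_mono, smul_lie, lie_smul, Int.cast_add,
      add_smul]
  exact LinearMap.congr_fun₂ this x y

/-- The invariant form `(x, y) = tr(x y)` on `sl_{ℓ+1}`. -/
def slForm (ℓ : ℕ) : SlAlg ℓ →ₗ[ℂ] SlAlg ℓ →ₗ[ℂ] ℂ :=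
  LinearMap.mk₂ ℂ (fun x y => Matrix.trace (x.1 * y.1))
    (by intro x x' y; simp [add_mul]) (by intro c x y; simp)
    (by intro x y y'; simp [mul_add]) (by intro c x y; simp)

theorem slForm_apply (ℓ : ℕ) (x y : SlAlg ℓ) : slForm ℓ x y = Matrix.trace (x.1 * y.1) := rfl

/-- The cocycle `(f, g) ↦ Res (df, g)`, i.e. `(x ⊗ z^k, y ⊗ z^l) ↦ k δ_{k+l,0} tr(x y)`. -/
def loopCocycle (ℓ : ℕ) : LoopSl ℓ →ₗ[ℂ] LoopSl ℓ →ₗ[ℂ] ℂ :=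
  LoopSpace.lift₂ fun k l => if k + l = 0 then (k : ℂ) • slForm ℓ else 0

theorem loopCocycle_mono (ℓ : ℕ) (k l : ℤ) (x y : SlAlg ℓ) :
    loopCocycle ℓ (mono k x) (mono l y) =
      if k + l = 0 then (k : ℂ) * Matrix.trace (x.1 * y.1) else 0 := by
  rw [loopCocycle, LoopSpace.lift₂_mono]
  split_ifs <;> simp [slForm_apply]

theorem loopCocycle_skew (ℓ : ℕ) (x y : LoopSl ℓ) : loopCocycle ℓ x y = - loopCocycle ℓ y x := by
  have : loopCocycle ℓ = - (loopCocycle ℓ).flip := by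
    apply hom_ext; intro k v
    apply hom_ext; intro l w
    simp only [LinearMap.neg_apply, LinearMap.flip_apply, loopCocycle_mono, add_comm l k]
    split_ifs with h
    · have : (k : ℂ) + l = 0 := by exact_mod_cast h
      rw [Matrix.trace_mul_comm w.1]
      linear_combination ((v.1 * w.1).trace) * this
    · simp
  exact LinearMap.congr_fun₂ this x y

theorem loopCocycle_self (ℓ : ℕ) (x : LoopSl ℓ) : loopCocycle ℓ x x = 0 := by
  have := loopCocycle_skew ℓ x x
  linear_combination this / 2

theorem loopCocycle_jacobi (ℓ : ℕ) (x y z : LoopSl ℓ) :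
    loopCocycle ℓ x ⁅y, z⁆ = loopCocycle ℓ ⁅x, y⁆ z + loopCocycle ℓ y ⁅x, z⁆ := by
  let A : LoopSl ℓ →ₗ[ℂ] LoopSl ℓ →ₗ[ℂ] LoopSl ℓ →ₗ[ℂ] ℂ :=
    LinearMap.mk₂ ℂ (fun x y => (loopCocycle ℓ x).comp (loopBracket ℓ y)
      - (loopCocycle ℓ (loopBracket ℓ x y)) - (loopCocycle ℓ y).comp (loopBracket ℓ x))
      (by intros; ext; simp; ring) (by intros; ext; simp; ring)
      (by intros; ext; simp; ring) (by intros; ext; simp; ring)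
  have hA : A = 0 := by
    apply hom_ext; intro a u
    apply hom_ext; intro b v
    apply hom_ext; intro c w
    simp only [A, LinearMap.mk₂_apply, LinearMap.sub_apply, LinearMap.comp_apply, loopBracket_apply,
      lie_mono, loopCocycle_mono, LinearMap.zero_apply,
      LieAlgebra.SpecialLinear.sl_bracket]
    have h1 : a + (b + c) = a + b + c := by ring
    have h2 : b + (a + c) = a + b + c := by ring
    rw [h1, h2]
    split_ifs with h
    · simp only [mul_sub, sub_mul, Matrix.trace_sub, ← mul_assoc]
      rw [Matrix.trace_mul_cycle v.1 u.1 w.1, Matrix.trace_mul_cycle w.1 v.1 u.1,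
        Matrix.trace_mul_cycle v.1 w.1 u.1]
      push_cast
      ring
    · simp
  have := LinearMap.congr_fun (LinearMap.congr_fun₂ hA x y) z
  simp only [A, LinearMap.mk₂_apply, LinearMap.sub_apply, LinearMap.comp_apply, loopBracket_apply,
    LinearMap.zero_apply] at this
  linear_combination this

theorem loopCocycle_euler (ℓ : ℕ) (x y : LoopSl ℓ) :
    loopCocycle ℓ (euler _ x) y + loopCocycle ℓ x (euler _ y) = 0 := by
  have : ((loopCocycle ℓ).comp (euler (SlAlg ℓ)) : LoopSl ℓ →ₗ[ℂ] LoopSl ℓ →ₗ[ℂ] ℂ) +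
      (loopCocycle ℓ).compl₂ (euler (SlAlg ℓ)) = 0 := by
    apply hom_ext; intro k v
    apply hom_ext; intro l w
    simp only [LinearMap.add_apply, LinearMap.comp_apply, LinearMap.compl₂_apply, euler_mono,
      map_smul, LinearMap.smul_apply, loopCocycle_mono, LinearMap.zero_apply, smul_eq_mul]
    split_ifs with h
    · have : (k : ℂ) + l = 0 := by exact_mod_cast h
      linear_combination (k * (v.1 * w.1).trace) * this
    · simp
  exact LinearMap.congr_fun₂ this x y

/-- The affine Lie algebra of `sl_{ℓ+1}`: an element is `f + c K + d D` with `f` in the loop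
algebra and `c, d ∈ ℂ`. -/
@[ext]
structure AffineSl (ℓ : ℕ) : Type where
  /-- The component in the loop algebra. -/
  loop : LoopSl ℓ
  /-- The coefficient of the central element `K`. -/
  c : ℂ
  /-- The coefficient of the Euler operator `D = z d/dz`. -/
  d : ℂ

namespace AffineSl

variable {ℓ : ℕ}

/-- As a vector space, the affine Lie algebra is `L(sl_{ℓ+1}) × ℂ × ℂ`. -/
def toProd (ℓ : ℕ) : AffineSl ℓ ≃ LoopSl ℓ × ℂ × ℂ where
  toFun x := (x.loop, x.c, x.d)
  invFun p := ⟨p.1, p.2.1, p.2.2⟩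
  left_inv _ := rfl
  right_inv _ := rfl

instance : AddCommGroup (AffineSl ℓ) := (toProd ℓ).addCommGroup

instance : Module ℂ (AffineSl ℓ) := (toProd ℓ).module ℂ

@[simp] theorem add_loop (x y : AffineSl ℓ) : (x + y).loop = x.loop + y.loop := rfl
@[simp] theorem add_c (x y : AffineSl ℓ) : (x + y).c = x.c + y.c := rfl
@[simp] theorem add_d (x y : AffineSl ℓ) : (x + y).d = x.d + y.d := rfl
@[simp] theorem smul_loop (t : ℂ) (x : AffineSl ℓ) : (t • x).loop = t • x.loop := rfl
@[simp] theorem smul_c (t : ℂ) (x : AffineSl ℓ) : (t • x).c = t * x.c := rfl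
@[simp] theorem smul_d (t : ℂ) (x : AffineSl ℓ) : (t • x).d = t * x.d := rfl
@[simp] theorem zero_loop : (0 : AffineSl ℓ).loop = 0 := rfl
@[simp] theorem zero_c : (0 : AffineSl ℓ).c = 0 := rfl
@[simp] theorem zero_d : (0 : AffineSl ℓ).d = 0 := rfl

/-- The bracket is `[f + c K + d D, g + c₁ K + d₁ D] = [f, g] + d D(g) - d₁ D(f) + Res (df, g) K`,
with `D(g) = z dg/dz`. -/
instance : Bracket (AffineSl ℓ) (AffineSl ℓ) where
  bracket x y := ⟨⁅x.loop, y.loop⁆ + x.d • euler (SlAlg ℓ) y.loop - y.d • euler (SlAlg ℓ) x.loop,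
    loopCocycle ℓ x.loop y.loop, 0⟩

@[simp] theorem lie_loop (x y : AffineSl ℓ) : ⁅x, y⁆.loop =
    ⁅x.loop, y.loop⁆ + x.d • euler (SlAlg ℓ) y.loop - y.d • euler (SlAlg ℓ) x.loop := rfl
@[simp] theorem lie_c (x y : AffineSl ℓ) : ⁅x, y⁆.c = loopCocycle ℓ x.loop y.loop := rfl
@[simp] theorem lie_d (x y : AffineSl ℓ) : ⁅x, y⁆.d = 0 := rfl

instance : LieRing (AffineSl ℓ) where
  add_lie x y z := by
    ext1
    · simp only [lie_loop, add_loop, add_d, add_lie, map_add, smul_add, add_smul]; abel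
    · simp
    · simp
  lie_add x y z := by
    ext1
    · simp only [lie_loop, add_loop, add_d, lie_add, map_add, smul_add, add_smul]; abel
    · simp
    · simp
  lie_self x := by
    ext1
    · simp
    · simp [loopCocycle_self]
    · simp
  leibniz_lie x y z := by
    ext1
    · simp only [lie_loop, add_loop, lie_d, lie_add, lie_sub, add_lie, sub_lie, map_add, map_sub,
        map_smul, lie_smul, smul_lie, zero_smul, euler_lie, smul_add, smul_sub]
      rw [leibniz_lie x.loop y.loop z.loop, smul_comm x.d y.d, smul_comm x.d z.d]
      rw [← lie_skew (euler (SlAlg ℓ) x.loop) y.loop]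
      module
    · simp only [lie_c, lie_loop, add_c, map_add, map_sub, map_smul, LinearMap.add_apply,
        LinearMap.sub_apply, LinearMap.smul_apply, smul_eq_mul, loopCocycle_jacobi ℓ x.loop]
      have h1 := loopCocycle_euler ℓ x.loop z.loop
      have h2 := loopCocycle_euler ℓ y.loop z.loop
      have h3 := loopCocycle_euler ℓ y.loop x.loop
      have h4 := loopCocycle_euler ℓ x.loop y.loop
      have h5 := loopCocycle_skew ℓ (euler _ x.loop) y.loop
      have h6 := loopCocycle_skew ℓ (euler _ y.loop) x.loop
      linear_combination (y.d) * h1 - x.d * h2 - z.d * h4 + z.d * h5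
    · simp

instance : LieAlgebra ℂ (AffineSl ℓ) where
  lie_smul t x y := by
    ext1
    · simp only [lie_loop, smul_loop, smul_d, lie_smul, map_smul, smul_add, smul_sub, smul_smul,
        mul_comm]
    · simp
    · simp

end AffineSl
/-- The tensor power `V^{⊗m}` of the natural representation `V = ℂ^{ℓ+1}`. -/
abbrev TensorNat (ℓ m : ℕ) : Type := ⨂[ℂ] _ : Fin m, (Fin (ℓ + 1) → ℂ)

/-- The operator `1 ⊗ ⋯ ⊗ u ⊗ ⋯ ⊗ 1` on `V^{⊗m}`, with `u ∈ End V` in the `j`-th place. -/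
def slotEnd (ℓ m : ℕ) (j : Fin m) :
    Module.End ℂ (Fin (ℓ + 1) → ℂ) →ₗ[ℂ] Module.End ℂ (TensorNat ℓ m) :=
  (PiTensorProduct.mapMultilinear ℂ (fun _ : Fin m => Fin (ℓ + 1) → ℂ)
    (fun _ => Fin (ℓ + 1) → ℂ)).toLinearMap (fun _ => LinearMap.id) j

theorem slotEnd_apply (ℓ m : ℕ) (j : Fin m) (u : Module.End ℂ (Fin (ℓ + 1) → ℂ)) :
    slotEnd ℓ m j u = PiTensorProduct.map (Function.update (fun _ => LinearMap.id) j u) := rfl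

theorem slotEnd_mul (ℓ m : ℕ) (j : Fin m) (u v : Module.End ℂ (Fin (ℓ + 1) → ℂ)) :
    slotEnd ℓ m j (u * v) = slotEnd ℓ m j u * slotEnd ℓ m j v := by
  rw [slotEnd_apply, slotEnd_apply, slotEnd_apply, ← PiTensorProduct.map_mul]
  congr 1
  funext k
  by_cases hj : k = j
  · subst hj
    simp only [Function.update_self]
  · simp only [Function.update_of_ne hj]
    rfl

theorem slotEnd_comm (ℓ m : ℕ) {i j : Fin m} (h : i ≠ j) (u v : Module.End ℂ (Fin (ℓ + 1) → ℂ)) :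
    slotEnd ℓ m i u * slotEnd ℓ m j v = slotEnd ℓ m j v * slotEnd ℓ m i u := by
  rw [slotEnd_apply, slotEnd_apply, ← PiTensorProduct.map_mul, ← PiTensorProduct.map_mul]
  congr 1
  funext k
  by_cases hi : k = i
  · subst hi
    rw [Function.update_self, Function.update_of_ne h]
    rfl
  · rw [Function.update_of_ne hi]
    rfl

/-- The natural representation of `sl_{ℓ+1}` on `V = ℂ^{ℓ+1}`. -/
def natRep (ℓ : ℕ) : SlAlg ℓ →ₗ[ℂ] Module.End ℂ (Fin (ℓ + 1) → ℂ) where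
  toFun x := Matrix.toLin' x.1
  map_add' _ _ := map_add _ _ _
  map_smul' _ _ := map_smul _ _ _

theorem natRep_lie (ℓ : ℕ) (x y : SlAlg ℓ) :
    natRep ℓ ⁅x, y⁆ + natRep ℓ y * natRep ℓ x = natRep ℓ x * natRep ℓ y := by
  have h : ∀ x y : SlAlg ℓ, natRep ℓ x * natRep ℓ y = Matrix.toLin' (x.1 * y.1) := fun x y =>
    (Matrix.toLin'_mul x.1 y.1).symm
  rw [h, h]
  change Matrix.toLin' (x.1 * y.1 - y.1 * x.1) + _ = _
  rw [map_sub, sub_add_cancel]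

/-- The action of `x ∈ sl_{ℓ+1}` on the `j`-th factor of `V^{⊗m}`. -/
def slot (ℓ m : ℕ) (j : Fin m) : SlAlg ℓ →ₗ[ℂ] Module.End ℂ (TensorNat ℓ m) :=
  slotEnd ℓ m j ∘ₗ natRep ℓ

theorem slot_mul_of_ne (ℓ m : ℕ) {i j : Fin m} (h : i ≠ j) (x y : SlAlg ℓ) :
    slot ℓ m i x * slot ℓ m j y = slot ℓ m j y * slot ℓ m i x :=
  slotEnd_comm ℓ m h _ _

theorem slot_lie (ℓ m : ℕ) (j : Fin m) (x y : SlAlg ℓ) :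
    slot ℓ m j ⁅x, y⁆ + slot ℓ m j y * slot ℓ m j x = slot ℓ m j x * slot ℓ m j y := by
  simp only [slot, LinearMap.comp_apply]
  rw [← slotEnd_mul, ← slotEnd_mul, ← map_add, natRep_lie]

/-- For `a = (a_1, …, a_m)`, the action of `ev_a(x ⊗ z^k) = (a_1^k x, …, a_m^k x)`
on `V^{⊗m}`. -/
def evOp {ℓ m : ℕ} (a : Fin m → ℂˣ) (k : ℤ) : SlAlg ℓ →ₗ[ℂ] Module.End ℂ (TensorNat ℓ m) :=
  ∑ j, ((a j ^ k : ℂˣ) : ℂ) • slot ℓ m j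

theorem evOp_lie {ℓ m : ℕ} (a : Fin m → ℂˣ) (k l : ℤ) (x y : SlAlg ℓ) :
    evOp a (k + l) ⁅x, y⁆ + evOp a l y * evOp a k x = evOp a k x * evOp a l y := by
  simp only [evOp, LinearMap.sum_apply, LinearMap.smul_apply, Finset.sum_mul_sum]
  rw [Finset.sum_comm (f := fun i j => ((a i ^ l : ℂˣ) : ℂ) • slot ℓ m i y *
    ((a j ^ k : ℂˣ) : ℂ) • slot ℓ m j x), ← Finset.sum_add_distrib]
  refine Finset.sum_congr rfl fun j _ => ?_
  have h1 : ∀ i : Fin m, ((a i ^ l : ℂˣ) : ℂ) • slot ℓ m i y * ((a j ^ k : ℂˣ) : ℂ) • slot ℓ m j x =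
      (((a j ^ k : ℂˣ) : ℂ) * ((a i ^ l : ℂˣ) : ℂ)) • (slot ℓ m i y * slot ℓ m j x) := fun i => by
    rw [smul_mul_smul_comm, mul_comm]
  have h2 : ∀ i : Fin m, ((a j ^ k : ℂˣ) : ℂ) • slot ℓ m j x * ((a i ^ l : ℂˣ) : ℂ) • slot ℓ m i y =
      (((a j ^ k : ℂˣ) : ℂ) * ((a i ^ l : ℂˣ) : ℂ)) • (slot ℓ m j x * slot ℓ m i y) := fun i => by
    rw [smul_mul_smul_comm]
  simp only [h1, h2]
  rw [← Finset.add_sum_erase _ _ (Finset.mem_univ j), ← Finset.add_sum_erase _ _ (Finset.mem_univ j),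
    ← add_assoc, zpow_add, Units.val_mul, ← smul_add, slot_lie]
  congr 1
  refine Finset.sum_congr rfl fun i hi => ?_
  rw [slot_mul_of_ne ℓ m (Finset.ne_of_mem_erase hi)]

/-- The bilinear map `((x ⊗ z^k), (v ⊗ z^l)) ↦ ev_a(x ⊗ z^k)(v) ⊗ z^(k+l)`. -/
def loopAct {ℓ m : ℕ} (a : Fin m → ℂˣ) :
    LoopSl ℓ →ₗ[ℂ] LoopSpace (TensorNat ℓ m) →ₗ[ℂ] LoopSpace (TensorNat ℓ m) :=
  LoopSpace.lift₂ fun k l => LinearMap.compr₂ (evOp a k) (mono (k + l))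

theorem loopAct_mono {ℓ m : ℕ} (a : Fin m → ℂˣ) (k l : ℤ) (x : SlAlg ℓ) (v : TensorNat ℓ m) :
    loopAct a (mono k x) (mono l v) = mono (k + l) (evOp a k x v) := by
  rw [loopAct, LoopSpace.lift₂_mono]
  rfl

theorem loopAct_lie {ℓ m : ℕ} (a : Fin m → ℂˣ) (x y : LoopSl ℓ) (v : LoopSpace (TensorNat ℓ m)) :
    loopAct a ⁅x, y⁆ v = loopAct a x (loopAct a y v) - loopAct a y (loopAct a x v) := by
  let A : LoopSl ℓ →ₗ[ℂ] LoopSl ℓ →ₗ[ℂ] LoopSpace (TensorNat ℓ m) →ₗ[ℂ] LoopSpace (TensorNat ℓ m) :=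
    LinearMap.mk₂ ℂ (fun x y => loopAct a (loopBracket ℓ x y) - (loopAct a x).comp (loopAct a y)
      + (loopAct a y).comp (loopAct a x))
      (by intros; ext; simp; abel) (by intros; ext; simp; module)
      (by intros; ext; simp; abel) (by intros; ext; simp; module)
  have hA : A = 0 := by
    apply hom_ext; intro k x
    apply hom_ext; intro l y
    apply hom_ext; intro n v
    simp only [A, LinearMap.mk₂_apply, LinearMap.sub_apply, LinearMap.add_apply,
      LinearMap.comp_apply, loopBracket_mono, loopAct_mono, LinearMap.zero_apply]
    rw [show k + (l + n) = k + l + n by ring, show l + (k + n) = k + l + n by ring,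
      ← Module.End.mul_apply (evOp a k x), ← evOp_lie, LinearMap.add_apply, map_add,
      Module.End.mul_apply]
    abel
  have := LinearMap.congr_fun (LinearMap.congr_fun₂ hA x y) v
  simp only [A, LinearMap.mk₂_apply, LinearMap.sub_apply, LinearMap.add_apply,
    LinearMap.comp_apply, LinearMap.zero_apply, loopBracket_apply] at this
  rw [← sub_eq_zero, ← this]
  abel

theorem euler_loopAct {ℓ m : ℕ} (a : Fin m → ℂˣ) (x : LoopSl ℓ) (v : LoopSpace (TensorNat ℓ m)) :
    euler _ (loopAct a x v) = loopAct a (euler _ x) v + loopAct a x (euler _ v) := by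
  have : (loopAct a : LoopSl ℓ →ₗ[ℂ] _).compr₂ (euler (TensorNat ℓ m)) =
      (loopAct a).comp (euler (SlAlg ℓ)) + (loopAct a).compl₂ (euler (TensorNat ℓ m)) := by
    apply hom_ext; intro k x
    apply hom_ext; intro l v
    simp only [LinearMap.add_apply, LinearMap.comp_apply, LinearMap.compl₂_apply, euler_mono,
      LinearMap.compr₂_apply, loopAct_mono, map_smul, LinearMap.smul_apply, Int.cast_add, add_smul]
  exact LinearMap.congr_fun₂ this x v

/-- The loop module `L(V^{⊗m}, a)` of level zero. -/
def LoopModule (ℓ : ℕ) {m : ℕ} (_a : Fin m → ℂˣ) : Type := LoopSpace (TensorNat ℓ m)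

namespace LoopModule

variable {ℓ m : ℕ} (a : Fin m → ℂˣ)

instance : AddCommGroup (LoopModule ℓ a) := inferInstanceAs (AddCommGroup (LoopSpace _))
instance : Module ℂ (LoopModule ℓ a) := inferInstanceAs (Module ℂ (LoopSpace _))

/-- The underlying vector space of `L(V^{⊗m}, a)` is `V^{⊗m} ⊗ ℂ[z, z⁻¹]`. -/
def toLoopSpace : LoopModule ℓ a ≃ₗ[ℂ] LoopSpace (TensorNat ℓ m) := LinearEquiv.refl ℂ _

/-- The action of `f + c K + d D`: `f` acts through evaluation, `K` by zero, `D` by `z d/dz`. -/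
instance : LieRingModule (AffineSl ℓ) (LoopModule ℓ a) where
  bracket x v := (toLoopSpace a).symm
    (loopAct a x.loop (toLoopSpace a v) + x.d • euler _ (toLoopSpace a v))
  add_lie x y v := by
    simp only [AffineSl.add_loop, AffineSl.add_d, map_add, LinearMap.add_apply, add_smul]; abel
  lie_add x v w := by simp only [map_add, smul_add]; abel
  leibniz_lie x y v := by
    simp only [AffineSl.lie_loop, AffineSl.lie_d, map_add, map_sub, map_smul, LinearMap.add_apply,
      LinearMap.sub_apply, LinearMap.smul_apply, LinearEquiv.apply_symm_apply, loopAct_lie,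
      euler_loopAct, smul_add, zero_smul, map_zero]
    module

theorem lie_def (x : AffineSl ℓ) (v : LoopModule ℓ a) : ⁅x, v⁆ = (toLoopSpace a).symm
    (loopAct a x.loop (toLoopSpace a v) + x.d • euler _ (toLoopSpace a v)) := rfl

instance : LieModule ℂ (AffineSl ℓ) (LoopModule ℓ a) where
  smul_lie c x v := by
    simp only [lie_def, AffineSl.smul_loop, AffineSl.smul_d, map_smul, LinearMap.smul_apply,
      mul_smul, smul_add, map_add]
  lie_smul c x v := by
    simp only [lie_def, map_smul, smul_add, map_add, smul_comm c]

end LoopModule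
/-! Chevalley generators, weight spaces, characters and the modules `L(ℓ, m; n)`. -/

/-- The element `f` of the loop algebra inside the affine Lie algebra. -/
def ofLoop {ℓ : ℕ} (f : LoopSl ℓ) : AffineSl ℓ := ⟨f, 0, 0⟩

/-- The central element `K`. -/
def elemK (ℓ : ℕ) : AffineSl ℓ := ⟨0, 1, 0⟩

/-- The Euler operator `D`. -/
def elemD (ℓ : ℕ) : AffineSl ℓ := ⟨0, 0, 1⟩

/-- The matrix unit `E_{ij}`, `i ≠ j`, in `sl_{ℓ+1}`. -/
def matUnit (ℓ : ℕ) (i j : Fin (ℓ + 1)) (h : i ≠ j) : SlAlg ℓ :=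
  LieAlgebra.SpecialLinear.single i j h 1

/-- The Chevalley generator `x_{α_i}`: it is `E_{i-1,i}` for `i ≠ 0` and `E_{ℓ,0} ⊗ z` for
`i = 0`. -/
def chevE (ℓ : ℕ) [NeZero ℓ] (i : Fin (ℓ + 1)) : AffineSl ℓ :=
  ofLoop (mono (if i = 0 then 1 else 0) (matUnit ℓ (i - 1) i (sub_one_ne ℓ i)))

/-- The Chevalley generator `x_{-α_i}`: it is `E_{i,i-1}` for `i ≠ 0` and `E_{0,ℓ} ⊗ z⁻¹` for
`i = 0`. -/
def chevF (ℓ : ℕ) [NeZero ℓ] (i : Fin (ℓ + 1)) : AffineSl ℓ :=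
  ofLoop (mono (if i = 0 then -1 else 0) (matUnit ℓ i (i - 1) (sub_one_ne ℓ i).symm))

/-- The simple coroot `α_i^∨`: it is `E_{i-1,i-1} - E_{i,i}` for `i ≠ 0` and
`K - (E_{0,0} - E_{ℓ,ℓ})` for `i = 0`. -/
def corootElem (ℓ : ℕ) (i : Fin (ℓ + 1)) : AffineSl ℓ :=
  ofLoop (mono 0 (LieAlgebra.SpecialLinear.singleSubSingle (i - 1) i (1 : ℂ)))
    + (if i = 0 then (1 : ℂ) else 0) • elemK ℓ

section Modules

variable (ℓ : ℕ) (M : Type) [AddCommGroup M] [Module ℂ M] [LieRingModule (AffineSl ℓ) M]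
  [LieModule ℂ (AffineSl ℓ) M]

/-- The weight space `M_μ` for `μ = ∑ c_i Λ_i + k δ`: the Cartan subalgebra is spanned by the
`α_i^∨` and `D`, with `α_i^∨(μ) = c_i` and `μ(D) = k`. -/
def weightSpace (μ : AffineWeight ℓ) : Submodule ℂ M where
  carrier := {v | (∀ i, ⁅corootElem ℓ i, v⁆ = (μ.1 i : ℂ) • v) ∧ ⁅elemD ℓ, v⁆ = (μ.2 : ℂ) • v}
  add_mem' := by
    rintro v w ⟨h1, h2⟩ ⟨h3, h4⟩
    exact ⟨fun i => by rw [lie_add, h1, h3, smul_add], by rw [lie_add, h2, h4, smul_add]⟩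
  zero_mem' := by simp
  smul_mem' := by
    rintro c v ⟨h1, h2⟩
    exact ⟨fun i => by rw [lie_smul, h1, smul_comm], by rw [lie_smul, h2, smul_comm]⟩

/-- `M` is integrable: it is the direct sum of its weight spaces `M_μ`, `μ ∈ P(π)`, and the
Chevalley generators act locally nilpotently. -/
structure IsIntegrable [NeZero ℓ] : Prop where
  isInternal : DirectSum.IsInternal (weightSpace ℓ M)
  locNilpotent_e : ∀ i (v : M), ∃ N : ℕ, ((LieModule.toEnd ℂ (AffineSl ℓ) M (chevE ℓ i)) ^ N) v = 0
  locNilpotent_f : ∀ i (v : M), ∃ N : ℕ, ((LieModule.toEnd ℂ (AffineSl ℓ) M (chevF ℓ i)) ^ N) v = 0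

/-- All weight spaces of `M` are finite-dimensional. -/
def IsAdmissible : Prop := ∀ μ, FiniteDimensional ℂ (weightSpace ℓ M μ)

/-- `M` is of level zero: `K` acts trivially. -/
def IsLevelZero : Prop := ∀ v : M, ⁅elemK ℓ, v⁆ = 0

/-- The formal character `∑_μ (dim M_μ) e^μ`, as the function `μ ↦ dim M_μ`. -/
def moduleCh (μ : AffineWeight ℓ) : ℕ := Module.finrank ℂ (weightSpace ℓ M μ)

end Modules

/-- The evaluation parameters `a_i = ζ^i`, `i = 1, …, m`. -/
def rootParams (m : ℕ) (ζ : ℂˣ) : Fin m → ℂˣ := fun j => ζ ^ ((j : ℕ) + 1)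

/-- The vector `v^{⊗m} ⊗ z^n`, with `v = v_0` the highest weight vector of `ℂ^{ℓ+1}`. -/
def moduleGen (ℓ m : ℕ) (ζ : ℂˣ) (n : ℤ) : LoopModule ℓ (rootParams m ζ) :=
  (LoopModule.toLoopSpace (rootParams m ζ)).symm
    (mono n (PiTensorProduct.tprod ℂ fun _ => Pi.single 0 1))

/-- The module `L(ℓ, m; n)`: the submodule of `L(V^{⊗m}, (ζ, ζ^2, …, ζ^m))` generated by
`v^{⊗m} ⊗ z^n`. -/
def levelZeroModule (ℓ m : ℕ) (ζ : ℂˣ) (n : ℤ) :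
    LieSubmodule ℂ (AffineSl ℓ) (LoopModule ℓ (rootParams m ζ)) :=
  LieSubmodule.lieSpan ℂ (AffineSl ℓ) {moduleGen ℓ m ζ n}

/-- `φ_r(d) = φ(d) μ(d / gcd(d, r)) / φ(d / gcd(d, r))`. -/
def ramanujan (r : ℤ) (d : ℕ) : ℚ :=
  (Nat.totient d : ℚ) * (ArithmeticFunction.moebius (d / Int.gcd d r) : ℚ) /
    (Nat.totient (d / Int.gcd d r) : ℚ)

/-- `(1/m) ∑_{d ∣ gcd(k_0, …, k_ℓ)} φ_r(d) (m/d)! / ((k_0/d)! ⋯ (k_ℓ/d)!)`, where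
`m = k_0 + ⋯ + k_ℓ`. -/
def weightMult {ℓ : ℕ} (k : Fin (ℓ + 1) → ℕ) (r : ℤ) : ℚ :=
  1 / ((∑ i, k i : ℕ) : ℚ) * ∑ d ∈ (Finset.univ.gcd k).divisors,
    ramanujan r d * (Nat.multinomial Finset.univ fun i => k i / d : ℚ)

/-- The weight `∑ k_i (Λ_{i+1} - Λ_i)` of `B_ℓ(m)` attached to the tuple `(k_0, …, k_ℓ)`. -/
def tupleWeight {ℓ : ℕ} (k : Fin (ℓ + 1) → ℕ) : FiniteWeight ℓ :=
  ∑ i, (k i : ℤ) • (fundWeight ℓ (i + 1) - fundWeight ℓ i)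

end

end LevelZero

/-!
The two sides are described separately and then compared by a count of words in the letters
`0, …, ℓ`.

*The crystal.* Let `cyclicMaj b` be the sum modulo `m` of the positions of the cyclic ascents of
the word `b`. The letters next to the place where `e_i` acts are constrained, so `e_i` preserves
`cyclicMaj` for `i ≠ 0` and `e_0` lowers it by one (`Raises.cyclicMaj_eq`); hence
`s + cyclicMaj b` is constant modulo `m` on each component of the affine crystal. Conversely every
word is connected to `0 ⋯ 0` by raising operators (`raisesTo_zero`, by induction on the length),
and `0 ⋯ 0 ⊗ z^s` is connected to `0 ⋯ 0 ⊗ z^(s + m)`. So the component of `b_0^{⊗m} ⊗ z^n`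
consists of the `b ⊗ z^s` with `s + cyclicMaj b = n` modulo `m` (`mem_generatedSet_iff`). It is
indecomposable since `f_i` undoes `e_i`.

*The module.* The evaluation parameters `ζ, …, ζ^m` form a geometric progression, so rotation of
the tensor factors commutes with the affine algebra up to a twist by powers of `ζ` (`rotT_evOp`),
and the vectors `w ⊗ z^s` with `w` in the eigenspace of the rotation determined by `s - n` span a
submodule, `rotIsotypic`, the image of a projection that commutes with the affine algebra. The
parameters being distinct `m`-th roots of unity, a discrete Fourier transform recovers the action
on a single tensor factor (`slot_eq_sum_evOp`). It follows that the sum of `m` consecutive graded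
components of a non-zero submodule is stable under `m` copies of `sl_{ℓ+1}` acting factor by
factor, hence is all of `V^{⊗m}`. As the components lie in distinct eigenspaces of the rotation, a
non-zero submodule of `rotIsotypic` is all of it (`rotIsotypic_le`). This gives both
`L(ℓ, m; n) = rotIsotypic` and simplicity. The dimension of a weight space is the trace of a
projection, a combination of the numbers of words fixed by the rotations
(`finrank_rotWeightSpace`).

*The comparison.* Words of a given content are counted by the value of `cyclicMaj` with the help
of the polynomials `∑ ω^(cyclicMaj b) x^(content b)`, `ω` a root of unity. If `ω` is primitive of
order `m`, rotating a word with `c` cyclic ascents multiplies its term by `ω^(-c)`, and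
`0 < c < m` unless the word is constant, so only constant words survive and the sum is `∑ x_i^m`;
for a root of unity of order `d`, with `m = d g`, one obtains `(∑ x_i^d)^g` (`sum_majWeight`).
This is also the generating function of the words fixed by a rotation of order `d`
(`sum_rotate_eq_self`), so the crystal and the module have the same character
(`card_componentWords`, an instance of cyclic sieving). Sorting the `m`-th roots of unity by their
order `d` turns the coefficients of `(∑ x_i^d)^g` into the stated formula, where `φ_s(d)` appears
as the Ramanujan sum, the sum of the `s`-th powers of the primitive `d`-th roots of unity
(`sum_primitiveRoots_zpow`).
-/

open scoped TensorProduct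

namespace LevelZero

/-! ### Indecomposability of generated crystals -/

section Generated

variable {I : Type} {A : Matrix I I ℤ} {P : Type} [AddCommGroup P] {R : Realisation A P} {B : Type}
  {C : Crystal R B}

theorem Crystal.Reaches.trans {x y z : B} (h : C.Reaches x y) (h' : C.Reaches y z) :
    C.Reaches x z := by
  induction h' with
  | refl => exact h
  | e_step i u v _ hv ih => exact ih.e_step i u v hv
  | f_step i u v _ hv ih => exact ih.f_step i u v hv

theorem Crystal.Reaches.symm {x y : B} (h : C.Reaches x y) : C.Reaches y x := by
  induction h with
  | refl => exact .refl
  | e_step i u v _ hv ih =>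
    exact (Crystal.Reaches.refl.f_step i v u ((C.e_eq_iff i u v).1 hv)).trans ih
  | f_step i u v _ hv ih =>
    exact (Crystal.Reaches.refl.e_step i v u ((C.e_eq_iff i v u).2 hv)).trans ih

/-- Since `f_i` undoes `e_i`, reachability is symmetric, so a generated crystal is a connected
component. -/
theorem Crystal.generated_isIndecomposable (C : Crystal R B) (b : B) :
    (C.generated b).IsIndecomposable := by
  rintro S ⟨x, hx⟩ hS
  have key : ∀ y, C.Reaches x.1 y → ∃ h : y ∈ C.generatedSet b, (⟨y, h⟩ : C.generatedSet b) ∈ S := by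
    intro y hy
    induction hy with
    | refl => exact ⟨x.2, hx⟩
    | e_step i u v _ hv ih =>
      obtain ⟨hu, huS⟩ := ih
      refine ⟨(C.isSubcrystal_generatedSet b i u hu).1 v hv, (hS i _ huS).1 _ ?_⟩
      exact Option.pmap_eq_some_iff.2 ⟨v, _, hv, rfl⟩
    | f_step i u v _ hv ih =>
      obtain ⟨hu, huS⟩ := ih
      refine ⟨(C.isSubcrystal_generatedSet b i u hu).2 v hv, (hS i _ huS).2 _ ?_⟩
      exact Option.pmap_eq_some_iff.2 ⟨v, _, hv, rfl⟩
  refine Set.eq_univ_of_forall fun y => ?_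
  have hxy : C.Reaches x.1 y.1 := (Crystal.Reaches.symm x.2).trans y.2
  exact (key y.1 hxy).2

end Generated

/-! ### The signature rule on words -/

section Words

variable {ℓ m : ℕ}

/-- The number of letters `i` minus the number of letters `i - 1` among the first `k` letters
of the word `b`. -/
def balance (i : Fin (ℓ + 1)) (b : Fin m → Fin (ℓ + 1)) (k : ℕ) : ℤ :=
  ∑ j : Fin m, if (j : ℕ) < k then
    ((if b j = i then 1 else 0) - (if b j = i - 1 then 1 else 0)) else 0

/-- The integer `r_k^i(b)`. -/
def height (i : Fin (ℓ + 1)) (b : Fin m → Fin (ℓ + 1)) (k : Fin m) : ℤ :=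
  balance i b k + if b k = i then 1 else 0

theorem balance_succ (i : Fin (ℓ + 1)) (b : Fin m → Fin (ℓ + 1)) (k : Fin m) :
    balance i b (k + 1) = balance i b k +
      ((if b k = i then 1 else 0) - (if b k = i - 1 then 1 else 0)) := by
  rw [balance, balance, ← sub_eq_iff_eq_add', ← Finset.sum_sub_distrib, Finset.sum_eq_single k]
  · rw [if_pos (Nat.lt_succ_self _), if_neg (lt_irrefl _), sub_zero]
  · intro j _ hj
    have : (j : ℕ) < k + 1 ↔ (j : ℕ) < k := by
      have : (j : ℕ) ≠ k := fun h => hj (Fin.ext h)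
      omega
    simp only [this, sub_self]
  · simp

theorem balance_snoc (i : Fin (ℓ + 1)) (b : Fin m → Fin (ℓ + 1)) (c : Fin (ℓ + 1)) (k : ℕ)
    (hk : k ≤ m) :
    balance i (Fin.snoc b c : Fin (m + 1) → Fin (ℓ + 1)) k = balance i b k := by
  simp [balance, Fin.sum_univ_castSucc, not_lt.2 hk]

theorem height_snoc_castSucc (i : Fin (ℓ + 1)) (b : Fin m → Fin (ℓ + 1)) (c : Fin (ℓ + 1))
    (k : Fin m) : height i (Fin.snoc b c : Fin (m + 1) → Fin (ℓ + 1)) k.castSucc = height i b k := by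
  rw [height, height, Fin.snoc_castSucc (α := fun _ => Fin (ℓ + 1)), Fin.val_castSucc,
    balance_snoc i b c _ k.2.le]

theorem height_snoc_last (i : Fin (ℓ + 1)) (b : Fin m → Fin (ℓ + 1)) (c : Fin (ℓ + 1)) :
    height i (Fin.snoc b c : Fin (m + 1) → Fin (ℓ + 1)) (Fin.last m) =
      balance i b m + if c = i then 1 else 0 := by
  rw [height, Fin.snoc_last (α := fun _ => Fin (ℓ + 1)), Fin.val_last, balance_snoc i b c _ le_rfl]

/-- The operator `e_i` acts on the word `b` in the place `k`: this is the leftmost place of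
maximal height and carries the letter `i`. -/
structure RaisesAt (i : Fin (ℓ + 1)) (b : Fin m → Fin (ℓ + 1)) (k : Fin m) : Prop where
  letter : b k = i
  left : ∀ j < k, height i b j < height i b k
  right : ∀ j, k < j → height i b j ≤ height i b k

/-- The relation `e_i b = b'` between words; unlike `wordCrystal`, it makes sense for the empty
word too. -/
def Raises (i : Fin (ℓ + 1)) (b b' : Fin m → Fin (ℓ + 1)) : Prop :=
  ∃ k, RaisesAt i b k ∧ b' = Function.update b k (i - 1)

variable [NeZero ℓ]

theorem kashiwara_basicCrystal (i : Fin (ℓ + 1)) (b : Fin m → Fin (ℓ + 1)) (k : Fin m) :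
    (basicCrystal ℓ).kashiwara i b k = (height i b k : WithBot ℤ) := by
  have hr : height i b k = (if b k = i then 1 else 0) + balance i b k := by
    rw [height, add_comm]
  rw [hr, WithBot.coe_add, Crystal.kashiwara]
  congr 1
  · by_cases h : b k = i
    · simp [basicCrystal, h]
    · simp [basicCrystal, h, Ne.symm h]
  · rw [balance, ← Finset.sum_filter, ← Finset.sum_neg_distrib]
    congr 1
    refine Finset.sum_congr rfl fun j _ => ?_
    have h1 : b j = i - 1 ↔ i = b j + 1 := eq_sub_iff_add_eq.trans eq_comm
    simp [basicCrystal, finiteRealisation, fundWeight, Pi.single_apply, h1, eq_comm (a := i)]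

/-- The crystal operators of `B_ℓ^{⊗m}` in terms of integer heights. -/
theorem wordCrystal_e_eq_some [NeZero m] (i : Fin (ℓ + 1)) (b b' : Fin m → Fin (ℓ + 1)) :
    (wordCrystal ℓ m).e i b = some b' ↔ Raises i b b' := by
  have hl : ∀ k, b k = i → ((basicCrystal ℓ).leftPlace i b = k ↔ RaisesAt i b k) := by
    intro k hk
    rw [Crystal.leftPlace_eq_iff]
    constructor
    · rintro ⟨h1, h2⟩
      rw [← h1] at h2
      refine ⟨hk, fun j hj => ?_, fun j _ => ?_⟩
      · have := h2 j hj
        rwa [kashiwara_basicCrystal, kashiwara_basicCrystal, WithBot.coe_lt_coe] at this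
      · have := (basicCrystal ℓ).kashiwara_le i b j
        rwa [← h1, kashiwara_basicCrystal, kashiwara_basicCrystal, WithBot.coe_le_coe] at this
    · rintro ⟨_, h1, h2⟩
      have := (basicCrystal ℓ).tensorε_eq i b k _ rfl fun j => by
        rw [kashiwara_basicCrystal, kashiwara_basicCrystal, WithBot.coe_le_coe]
        rcases lt_trichotomy j k with hj | rfl | hj
        · exact (h1 j hj).le
        · exact le_rfl
        · exact h2 j hj
      rw [this]
      refine ⟨rfl, fun j hj => ?_⟩
      rw [kashiwara_basicCrystal, kashiwara_basicCrystal, WithBot.coe_lt_coe]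
      exact h1 j hj
  change Option.map _ _ = _ ↔ _
  rw [Option.map_eq_some_iff]
  constructor
  · rintro ⟨y, hy, rfl⟩
    have hb : i = b ((basicCrystal ℓ).leftPlace i b) := by
      by_contra hne
      exact absurd ((if_neg hne).symm.trans hy) (by simp)
    refine ⟨_, (hl _ hb.symm).1 rfl, ?_⟩
    have hy' := Option.some.inj ((if_pos hb).symm.trans hy)
    rw [← hy', ← hb]
  · rintro ⟨k, hk, rfl⟩
    rw [(hl k hk.letter).2 hk]
    exact ⟨i - 1, by simp [basicCrystal, hk.letter], rfl⟩

theorem affineCrystal_e_eq_some [NeZero m] (i : Fin (ℓ + 1)) (x y : (Fin m → Fin (ℓ + 1)) × ℤ) :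
    (affineCrystal ℓ m).e i x = some y ↔
      Raises i x.1 y.1 ∧ y.2 = x.2 + if i = 0 then 1 else 0 := by
  change Option.map _ _ = _ ↔ _
  rw [Option.map_eq_some_iff]
  constructor
  · rintro ⟨z, hz, rfl⟩
    exact ⟨(wordCrystal_e_eq_some i _ _).1 hz, rfl⟩
  · rintro ⟨h1, h2⟩
    exact ⟨y.1, (wordCrystal_e_eq_some i _ _).2 h1, Prod.ext rfl h2.symm⟩

omit [NeZero ℓ] in
/-- The letter before the place where `e_i` acts is not `i - 1`, as the height would be the same
there. -/
theorem RaisesAt.prev_ne {i : Fin (ℓ + 1)} {b : Fin m → Fin (ℓ + 1)} {k : Fin m}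
    (h : RaisesAt i b k) (p : Fin m) (hp : (p : ℕ) + 1 = k) : b p ≠ i - 1 := by
  intro hb
  have h1 := h.left p (Fin.lt_def.2 (by omega))
  have h2 := balance_succ i b p
  rw [hp] at h2
  rw [height, height, h2, if_pos h.letter, if_pos hb] at h1
  linarith

/-- The letter after the place where `e_i` acts is not `i`, as the height would be larger there. -/
theorem RaisesAt.next_ne {i : Fin (ℓ + 1)} {b : Fin m → Fin (ℓ + 1)} {k : Fin m}
    (h : RaisesAt i b k) (p : Fin m) (hp : (k : ℕ) + 1 = p) : b p ≠ i := by
  intro hb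
  have h1 := h.right p (Fin.lt_def.2 (by omega))
  have h2 := balance_succ i b k
  rw [hp] at h2
  rw [height, height, h2, if_pos h.letter, if_pos hb, h.letter,
    if_neg (sub_one_ne ℓ i).symm] at h1
  linarith

/-! ### The cyclic major index -/

/-- The sum modulo `m` of the positions `k ∈ {1, …, m}` of the cyclic ascents
`b_k < b_{k+1}` of the word `b = b_1 ⋯ b_m`, where `b_{m+1} = b_1`; a cyclic ascent in the last
place contributes `m = 0`. -/
def cyclicMaj [NeZero m] (b : Fin m → Fin (ℓ + 1)) : ZMod m :=
  ∑ k : Fin m, if b k < b (k + 1) then (((k : ℕ) + 1 : ℕ) : ZMod m) else 0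

omit [NeZero ℓ] in
theorem cyclicMaj_const [NeZero m] (i : Fin (ℓ + 1)) : cyclicMaj (fun _ : Fin m => i) = 0 := by
  simp [cyclicMaj]

omit [NeZero ℓ] in
theorem val_sub_one_add_one_cast [NeZero m] (k : Fin m) :
    ((((k - 1 : Fin m) : ℕ) + 1 : ℕ) : ZMod m) = ((k : ℕ) : ZMod m) := by
  have h : ((k - 1 + 1 : Fin m) : ℕ) = (k : ℕ) := by rw [sub_add_cancel]
  rw [← h, Fin.val_add, ZMod.natCast_mod, Nat.cast_add, Nat.cast_add, Fin.val_one',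
    ZMod.natCast_mod]

omit [NeZero ℓ] in
theorem val_sub_one_of_ne_zero {i : Fin (ℓ + 1)} (h : i ≠ 0) :
    ((i - 1 : Fin (ℓ + 1)) : ℕ) + 1 = i := by
  have : (i : ℕ) ≠ 0 := fun h' => h (Fin.ext h')
  rw [Fin.val_sub_one_of_ne_zero h]
  omega

/-- The operator `e_i` preserves the cyclic major index, except that `e_0` lowers it by one: the
letters next to the place where `e_i` acts are constrained, so that for `i ≠ 0` no ascent changes,
and for `i = 0` one ascent moves one step to the left. -/
theorem Raises.cyclicMaj_eq [NeZero m] {i : Fin (ℓ + 1)} {b b' : Fin m → Fin (ℓ + 1)}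
    (h : Raises i b b') : cyclicMaj b' + (if i = 0 then 1 else 0) = cyclicMaj b := by
  obtain ⟨k, hk, rfl⟩ := h
  rcases Nat.lt_or_ge 1 m with hm | hm
  swap
  · obtain rfl : m = 1 := le_antisymm hm (Nat.one_le_iff_ne_zero.2 (NeZero.ne m))
    exact Subsingleton.elim _ _
  obtain ⟨m, rfl⟩ : ∃ m', m = m' + 1 + 1 := ⟨m - 2, by omega⟩
  have hk1 : k - 1 ≠ k := sub_one_ne _ k
  have hk2 : k + 1 ≠ k := by
    intro h
    exact sub_one_ne _ (k + 1) (by rw [add_sub_cancel_right]; exact h.symm)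
  have hlast : ((i : ℕ) = 0 → ((i - 1 : Fin (ℓ + 1)) : ℕ) = ℓ) ∧
      ((i : ℕ) ≠ 0 → ((i - 1 : Fin (ℓ + 1)) : ℕ) + 1 = i) := by
    refine ⟨fun h => ?_, fun h => val_sub_one_of_ne_zero fun h' => h (by rw [h']; rfl)⟩
    obtain rfl : i = 0 := Fin.ext h
    rw [zero_sub]
    exact Fin.coe_neg_one
  have hi0 : i = 0 ↔ (i : ℕ) = 0 := Fin.ext_iff
  have key : cyclicMaj (Function.update b k (i - 1)) - cyclicMaj b
      = (if i = 0 then (((k : ℕ) : ZMod (m + 1 + 1))) else 0)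
        - (if i = 0 then (((k : ℕ) + 1 : ℕ) : ZMod (m + 1 + 1)) else 0) := by
    rw [cyclicMaj, cyclicMaj, ← Finset.sum_sub_distrib,
      ← Finset.sum_subset (Finset.subset_univ {k - 1, k}), Finset.sum_pair hk1, ← sub_neg_eq_add]
    · congr 1
      · rw [sub_add_cancel, Function.update_self, Function.update_of_ne hk1, hk.letter,
          val_sub_one_add_one_cast]
        by_cases hk0 : (k : ℕ) = 0
        · simp [hk0]
        · have hp := hk.prev_ne (k - 1) (val_sub_one_of_ne_zero fun h => hk0 (by rw [h]; rfl))
          have hp' : (b (k - 1) : ℕ) ≠ (i - 1 : Fin (ℓ + 1)) := fun h => hp (Fin.ext h)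
          have := Fin.is_lt (b (k - 1))
          simp only [Fin.lt_def, hi0]
          split_ifs <;> first | (exfalso; omega) | simp
      · rw [Function.update_self, Function.update_of_ne hk2, hk.letter]
        by_cases hkl : (k : ℕ) + 1 = m + 1 + 1
        · rw [hkl]; simp
        · have hv : (k : ℕ) + 1 = (k + 1 : Fin (m + 1 + 1)) := by
            rw [Fin.val_add_one_of_lt']; omega
          have hp := hk.next_ne (k + 1) hv
          have hp' : (b (k + 1) : ℕ) ≠ i := fun h => hp (Fin.ext h)
          have := (b (k + 1)).2
          simp only [Fin.lt_def, hi0]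
          split_ifs <;> first | (exfalso; omega) | simp
    · intro p _ hp
      simp only [Finset.mem_insert, Finset.mem_singleton, not_or] at hp
      have : p + 1 ≠ k := fun h => hp.1 (by rw [← h, add_sub_cancel_right])
      rw [Function.update_of_ne hp.2, Function.update_of_ne this, sub_self]
  rw [sub_eq_iff_eq_add'.1 key]
  split_ifs
  · push_cast; ring
  · ring

/-! ### Connectivity of words -/

omit [NeZero ℓ] in
theorem RaisesAt.balance_le {i : Fin (ℓ + 1)} {b : Fin m → Fin (ℓ + 1)} {k : Fin m}
    (h : RaisesAt i b k) : balance i b m ≤ height i b k := by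
  have hm : 0 < m := k.pos
  set p : Fin m := ⟨m - 1, by omega⟩ with hp
  have h1 := balance_succ i b p
  have h2 : (p : ℕ) + 1 = m := by simp only [hp]; omega
  rw [h2] at h1
  have h3 : balance i b m ≤ height i b p := by
    rw [h1, height]
    split_ifs <;> simp
  rcases (show k ≤ p from Fin.le_def.2 (by simp only [hp]; omega)).eq_or_lt with hkp | hkp
  · rwa [hkp]
  · exact h3.trans (h.right p hkp)

omit [NeZero ℓ] in
theorem update_snoc_castSucc (b : Fin m → Fin (ℓ + 1)) (c x : Fin (ℓ + 1)) (k : Fin m) :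
    (Fin.snoc (Function.update b k x) c : Fin (m + 1) → Fin (ℓ + 1)) =
      Function.update (Fin.snoc b c) k.castSucc x := by
  rw [Fin.snoc_update]

omit [NeZero ℓ] in
theorem raises_snoc_of_le {i c : Fin (ℓ + 1)} {b : Fin m → Fin (ℓ + 1)} {k : Fin m}
    (h : RaisesAt i b k) (hc : balance i b m + (if c = i then 1 else 0) ≤ height i b k) :
    Raises i (Fin.snoc b c : Fin (m + 1) → Fin (ℓ + 1))
      (Fin.snoc (Function.update b k (i - 1)) c) := by
  refine ⟨k.castSucc, ⟨?_, fun j hj => ?_, fun j hj => ?_⟩, update_snoc_castSucc ..⟩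
  · rw [Fin.snoc_castSucc (α := fun _ => Fin (ℓ + 1)), h.letter]
  · induction j using Fin.lastCases with
    | last => exact absurd hj (not_lt.2 (Fin.le_last _))
    | cast j =>
      rw [height_snoc_castSucc, height_snoc_castSucc]
      exact h.left j hj
  · induction j using Fin.lastCases with
    | last => rwa [height_snoc_last, height_snoc_castSucc]
    | cast j =>
      rw [height_snoc_castSucc, height_snoc_castSucc]
      exact h.right j hj

omit [NeZero ℓ] in
/-- If the appended letter is not `i`, then `e_i` acts on the initial part. -/
theorem Raises.snoc_of_ne {i c : Fin (ℓ + 1)} {b b' : Fin m → Fin (ℓ + 1)}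
    (h : Raises i b b') (hc : c ≠ i) :
    Raises i (Fin.snoc b c : Fin (m + 1) → Fin (ℓ + 1)) (Fin.snoc b' c) := by
  obtain ⟨k, hk, rfl⟩ := h
  refine raises_snoc_of_le hk ?_
  rw [if_neg hc, add_zero]
  exact hk.balance_le

omit [NeZero ℓ] in
theorem raises_snoc_last {i : Fin (ℓ + 1)} {b : Fin m → Fin (ℓ + 1)}
    (h : ∀ j, height i b j < balance i b m + 1) :
    Raises i (Fin.snoc b i : Fin (m + 1) → Fin (ℓ + 1)) (Fin.snoc b (i - 1)) := by
  refine ⟨Fin.last m, ⟨?_, fun j hj => ?_, fun j hj => ?_⟩, ?_⟩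
  · rw [Fin.snoc_last (α := fun _ => Fin (ℓ + 1))]
  · induction j using Fin.lastCases with
    | last => exact absurd hj (lt_irrefl _)
    | cast j =>
      rw [height_snoc_castSucc, height_snoc_last, if_pos rfl]
      exact h j
  · exact absurd hj (not_lt.2 (Fin.le_last _))
  · rw [Fin.update_snoc_last]

/-- Words connected by raising operators. -/
abbrev RaisesTo (b b' : Fin m → Fin (ℓ + 1)) : Prop :=
  Relation.ReflTransGen (fun b b' => ∃ i, Raises i b b') b b'

/-- Raising the initial part of a word can be imitated in the whole word, at the price of changing
the last letter. -/
theorem Raises.exists_raisesTo_snoc {i : Fin (ℓ + 1)} {b b' : Fin m → Fin (ℓ + 1)}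
    (h : Raises i b b') (c : Fin (ℓ + 1)) :
    ∃ c', RaisesTo (Fin.snoc b c : Fin (m + 1) → Fin (ℓ + 1)) (Fin.snoc b' c') := by
  by_cases hc : c = i
  · subst hc
    obtain ⟨k, hk, rfl⟩ := h
    by_cases hle : balance c b m + 1 ≤ height c b k
    · exact ⟨c, .single ⟨c, raises_snoc_of_le hk (by rwa [if_pos rfl])⟩⟩
    · refine ⟨c - 1, .head ⟨c, raises_snoc_last fun j => ?_⟩
        (.single ⟨c, Raises.snoc_of_ne ⟨k, hk, rfl⟩ (sub_one_ne ℓ c)⟩)⟩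
      refine lt_of_le_of_lt ?_ (not_le.1 hle)
      rcases lt_trichotomy j k with hj | rfl | hj
      · exact (hk.left j hj).le
      · exact le_rfl
      · exact hk.right j hj
  · exact ⟨c, .single ⟨i, h.snoc_of_ne hc⟩⟩

theorem RaisesTo.exists_snoc {b b' : Fin m → Fin (ℓ + 1)}
    (h : RaisesTo b b') (c : Fin (ℓ + 1)) :
    ∃ c', RaisesTo (Fin.snoc b c : Fin (m + 1) → Fin (ℓ + 1)) (Fin.snoc b' c') := by
  induction h with
  | refl => exact ⟨c, .refl⟩
  | tail _ hs ih =>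
    obtain ⟨c', hc'⟩ := ih
    obtain ⟨i, hi⟩ := hs
    obtain ⟨c'', hc''⟩ := hi.exists_raisesTo_snoc c'
    exact ⟨c'', hc'.trans hc''⟩

omit [NeZero ℓ] in
theorem snoc_const (i : Fin (ℓ + 1)) :
    (Fin.snoc (fun _ : Fin m => i) i : Fin (m + 1) → Fin (ℓ + 1)) = fun _ => i := by
  funext j
  induction j using Fin.lastCases with
  | last => exact Fin.snoc_last (α := fun _ => Fin (ℓ + 1)) ..
  | cast j => exact Fin.snoc_castSucc (α := fun _ => Fin (ℓ + 1)) ..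

omit [NeZero ℓ] in
theorem reflTransGen_raises_snoc {i c : Fin (ℓ + 1)} {b b' : Fin m → Fin (ℓ + 1)}
    (h : Relation.ReflTransGen (Raises i) b b') (hc : c ≠ i) :
    Relation.ReflTransGen (Raises i) (Fin.snoc b c : Fin (m + 1) → Fin (ℓ + 1))
      (Fin.snoc b' c) :=
  Relation.ReflTransGen.lift (fun b => (Fin.snoc b c : Fin (m + 1) → Fin (ℓ + 1)))
    (fun _ _ h => Raises.snoc_of_ne h hc) _ _ h

/-- `e_i^m` maps the constant word `i ⋯ i` to the constant word `(i-1) ⋯ (i-1)`. -/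
theorem reflTransGen_raises_const (i : Fin (ℓ + 1)) :
    ∀ m : ℕ, Relation.ReflTransGen (Raises i) (fun _ : Fin m => i) (fun _ => i - 1)
  | 0 => by rw [Subsingleton.elim (fun _ : Fin 0 => i) fun _ => i - 1]
  | m + 1 => by
    rw [← snoc_const, ← snoc_const (i - 1)]
    refine .head (raises_snoc_last fun j => ?_)
      (reflTransGen_raises_snoc (reflTransGen_raises_const i m) (sub_one_ne ℓ i))
    rw [height, if_pos rfl, add_lt_add_iff_right, balance, balance]
    refine Finset.sum_lt_sum (fun p _ => ?_) ⟨j, Finset.mem_univ _, ?_⟩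
    · rw [if_pos rfl, if_neg (sub_one_ne ℓ i).symm, if_pos p.2]
      split_ifs <;> simp
    · rw [if_neg (lt_irrefl _), if_pos j.2, if_pos rfl, if_neg (sub_one_ne ℓ i).symm]
      norm_num

omit [NeZero ℓ] in
theorem raisesTo_of_reflTransGen {i : Fin (ℓ + 1)} {b b' : Fin m → Fin (ℓ + 1)}
    (h : Relation.ReflTransGen (Raises i) b b') : RaisesTo b b' :=
  Relation.ReflTransGen.mono (fun _ _ h => ⟨i, h⟩) _ _ h

theorem raisesTo_const_zero (i : Fin (ℓ + 1)) :
    RaisesTo (fun _ : Fin m => i) (fun _ => 0) := by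
  induction i using Fin.induction with
  | zero => exact .refl
  | succ i ih =>
    refine .trans (raisesTo_of_reflTransGen (reflTransGen_raises_const i.succ m)) ?_
    rwa [← Fin.coeSucc_eq_succ, add_sub_cancel_right]

/-- A constant block in front of the letter `c` can be rotated down, through
`e_0`, `e_ℓ`, … if necessary, until it meets `c`. -/
theorem raisesTo_snoc_const (c d : Fin (ℓ + 1)) :
    RaisesTo (Fin.snoc (fun _ : Fin m => c + d) c : Fin (m + 1) → Fin (ℓ + 1)) (fun _ => c) := by
  induction d using Fin.induction with
  | zero => rw [add_zero, snoc_const]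
  | succ d ih =>
    by_cases hc : c = c + d.succ
    · rw [← hc, snoc_const]
    · refine .trans (raisesTo_of_reflTransGen (reflTransGen_raises_snoc
        (reflTransGen_raises_const (c + d.succ) m) hc)) ?_
      rwa [← Fin.coeSucc_eq_succ, ← add_assoc, add_sub_cancel_right]

/-- Every word is connected to `0 ⋯ 0` by raising operators alone. -/
theorem raisesTo_zero : ∀ {m : ℕ} (b : Fin m → Fin (ℓ + 1)), RaisesTo b (fun _ => 0)
  | 0, b => by rw [Subsingleton.elim b fun _ => 0]
  | m + 1, b => by
    obtain ⟨c, hc⟩ := (raisesTo_zero (Fin.init b : Fin m → Fin (ℓ + 1))).exists_snoc (b (Fin.last m))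
    rw [Fin.snoc_init_self] at hc
    have h := raisesTo_snoc_const (m := m) c (-c)
    rw [add_neg_cancel] at h
    exact (hc.trans h).trans (raisesTo_const_zero c)

/-! ### The component of `b_0^{⊗m} ⊗ z^n` -/

variable [NeZero m]

theorem RaisesTo.exists_reaches {b b' : Fin m → Fin (ℓ + 1)} (h : RaisesTo b b') (s : ℤ) :
    ∃ s', (affineCrystal ℓ m).Reaches (b, s) (b', s') := by
  induction h with
  | refl => exact ⟨s, .refl⟩
  | tail _ hs ih =>
    obtain ⟨s', hs'⟩ := ih
    obtain ⟨i, hi⟩ := hs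
    exact ⟨_, hs'.e_step i _ _ ((affineCrystal_e_eq_some i _ (_, _)).2 ⟨hi, rfl⟩)⟩

omit [NeZero m] in
/-- The number of letters `i` of a word drops by one when `e_i` is applied. -/
theorem Raises.card_letter {i : Fin (ℓ + 1)} {b b' : Fin m → Fin (ℓ + 1)} (h : Raises i b b') :
    (Finset.univ.filter fun j => b' j = i).card + 1 =
      (Finset.univ.filter fun j => b j = i).card := by
  obtain ⟨k, hk, rfl⟩ := h
  rw [← Finset.card_erase_add_one (show k ∈ Finset.univ.filter fun j => b j = i by simp [hk.letter])]
  congr 2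
  ext j
  by_cases hj : j = k
  · subst hj
    simp [sub_one_ne ℓ i]
  · simp [hj]

theorem reaches_of_reflTransGen {i : Fin (ℓ + 1)} {b b' : Fin m → Fin (ℓ + 1)}
    (h : Relation.ReflTransGen (Raises i) b b') (s : ℤ) :
    (affineCrystal ℓ m).Reaches (b, s) (b', s + if i = 0 then
      ((Finset.univ.filter fun j => b j = i).card - (Finset.univ.filter fun j => b' j = i).card : ℤ)
      else 0) := by
  induction h with
  | refl => simpa using .refl
  | tail _ hs ih =>
    refine ih.e_step i _ _ ((affineCrystal_e_eq_some i _ (_, _)).2 ⟨hs, ?_⟩)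
    have := hs.card_letter
    dsimp only
    split_ifs
    · rw [← this]; push_cast; ring
    · ring

theorem reaches_const_sub_one (i : Fin (ℓ + 1)) (s : ℤ) :
    (affineCrystal ℓ m).Reaches (fun _ => i, s)
      (fun _ => i - 1, s + if i = 0 then (m : ℤ) else 0) := by
  have := reaches_of_reflTransGen (reflTransGen_raises_const i m) s
  simpa [sub_one_ne ℓ i] using this

theorem reaches_const_zero (i : Fin (ℓ + 1)) (s : ℤ) :
    (affineCrystal ℓ m).Reaches (fun _ => i, s) (fun _ => 0, s) := by
  induction i using Fin.induction with
  | zero => exact .refl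
  | succ i ih =>
    have := reaches_const_sub_one (m := m) i.succ s
    rw [if_neg (Fin.succ_ne_zero i), add_zero, ← Fin.coeSucc_eq_succ, add_sub_cancel_right] at this
    rw [← Fin.coeSucc_eq_succ]
    exact this.trans ih

/-- The constant word `0 ⋯ 0` returns to itself after `m (ℓ + 1)` raising operators, with the
exponent of `z` increased by `m`. -/
theorem reaches_zero_add (s : ℤ) :
    (affineCrystal ℓ m).Reaches (fun _ => 0, s) (fun _ => 0, s + m) := by
  have := reaches_const_sub_one (ℓ := ℓ) (m := m) 0 s
  rw [if_pos rfl] at this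
  exact this.trans (reaches_const_zero _ _)

theorem reaches_zero_of_dvd {s s' : ℤ} (h : (m : ℤ) ∣ s' - s) :
    (affineCrystal ℓ m).Reaches (fun _ => 0, s) (fun _ => 0, s') := by
  obtain ⟨q, hq⟩ := h
  obtain rfl : s' = s + m * q := by rw [← hq]; ring
  clear hq
  induction q using Int.induction_on with
  | zero => simpa using .refl
  | succ q ih =>
    have := ih.trans (reaches_zero_add _)
    rwa [add_assoc, ← mul_add_one] at this
  | pred q ih =>
    refine ih.trans (Crystal.Reaches.symm ?_)
    have := reaches_zero_add (ℓ := ℓ) (m := m) (s + m * (-(q : ℤ) - 1))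
    rwa [add_assoc, ← mul_add_one, sub_add_cancel] at this

/-- The component of `b_0^{⊗m} ⊗ z^n` is cut out by the cyclic major index. -/
theorem mem_generatedSet_iff (n : ℤ) (x : (Fin m → Fin (ℓ + 1)) × ℤ) :
    x ∈ (affineCrystal ℓ m).generatedSet (crystalGen ℓ m n) ↔
      ((x.2 : ZMod m) + cyclicMaj x.1 = n) := by
  have hinv : ∀ i (x y : (Fin m → Fin (ℓ + 1)) × ℤ), (affineCrystal ℓ m).e i x = some y →
      (y.2 : ZMod m) + cyclicMaj y.1 = (x.2 : ZMod m) + cyclicMaj x.1 := by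
    intro i x y h
    obtain ⟨h1, h2⟩ := (affineCrystal_e_eq_some i x y).1 h
    rw [h2, ← h1.cyclicMaj_eq]
    split_ifs <;> push_cast <;> ring
  have hreach : ∀ x y, (affineCrystal ℓ m).Reaches x y →
      (y.2 : ZMod m) + cyclicMaj y.1 = (x.2 : ZMod m) + cyclicMaj x.1 := by
    intro x y h
    induction h with
    | refl => rfl
    | e_step i u v _ hv ih => rw [hinv i u v hv, ih]
    | f_step i u v _ hv ih => rw [← hinv i v u ((Crystal.e_eq_iff _ i v u).2 hv), ih]
  constructor
  · intro h
    have := hreach _ _ h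
    rwa [crystalGen, cyclicMaj_const, add_zero] at this
  · intro h
    obtain ⟨s, hs⟩ := (raisesTo_zero x.1).exists_reaches x.2
    have h1 := hreach _ _ hs
    rw [cyclicMaj_const, add_zero, h] at h1
    refine (reaches_zero_of_dvd ?_).trans hs.symm
    exact (ZMod.intCast_zmod_eq_zero_iff_dvd _ m).1 (by push_cast; rw [h1]; simp)

end Words

/-! ### Generating functions of words -/

section GeneratingFunctions

variable {ℓ : ℕ} {R : Type*} [CommRing R]

/-- The power of `ω` whose exponent is the sum of the positions of the cyclic ascents of `b`. -/
def majWeight {m : ℕ} [NeZero m] (ω : R) (b : Fin m → Fin (ℓ + 1)) : R :=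
  ∏ k : Fin m, if b k < b (k + 1) then ω ^ ((k : ℕ) + 1) else 1

theorem majWeight_eq_pow_cyclicMaj {m : ℕ} [NeZero m] {ω : R} (hω : ω ^ m = 1)
    (b : Fin m → Fin (ℓ + 1)) : majWeight ω b = ω ^ (cyclicMaj b).val := by
  have h1 : majWeight ω b = ω ^ ∑ k : Fin m, if b k < b (k + 1) then (k : ℕ) + 1 else 0 := by
    rw [← Finset.prod_pow_eq_pow_sum, majWeight]
    exact Finset.prod_congr rfl fun k _ => by split_ifs <;> simp
  have h2 : cyclicMaj b =
      ((∑ k : Fin m, if b k < b (k + 1) then (k : ℕ) + 1 else 0 : ℕ) : ZMod m) := by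
    rw [cyclicMaj, Nat.cast_sum]
    exact Finset.sum_congr rfl fun k _ => by split_ifs <;> simp
  rw [h1, h2, ZMod.val_natCast, ← pow_mod_orderOf, ← pow_mod_orderOf _ (_ % m),
    Nat.mod_mod_of_dvd _ (orderOf_dvd_of_pow_eq_one hω)]

theorem pow_val_add {m : ℕ} [NeZero m] {M : Type*} [Monoid M] {ω : M} (hω : ω ^ m = 1)
    (s t : Fin m) : ω ^ ((s + t : Fin m) : ℕ) = ω ^ (s : ℕ) * ω ^ (t : ℕ) := by
  rw [← pow_add, Fin.val_add, ← pow_mod_orderOf, ← pow_mod_orderOf _ ((s : ℕ) + t),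
    Nat.mod_mod_of_dvd _ (orderOf_dvd_of_pow_eq_one hω)]

theorem pow_val_add_one {m : ℕ} [NeZero m] {M : Type*} [Monoid M] {ω : M} (hω : ω ^ m = 1)
    (k : Fin m) : ω ^ ((k + 1 : Fin m) : ℕ) = ω ^ ((k : ℕ) + 1) := by
  rw [pow_val_add hω, Fin.val_one', pow_succ, ← pow_mod_orderOf _ (1 % m),
    Nat.mod_mod_of_dvd _ (orderOf_dvd_of_pow_eq_one hω), pow_mod_orderOf, pow_one]

/-- Rotation of words by `t` places to the left. -/
def rotate {m : ℕ} [NeZero m] (t : Fin m) :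
    Equiv.Perm (Fin m → Fin (ℓ + 1)) where
  toFun b k := b (k + t)
  invFun b k := b (k - t)
  left_inv b := by funext k; simp
  right_inv b := by funext k; simp

@[simp] theorem rotate_apply {m : ℕ} [NeZero m] (t : Fin m) (b : Fin m → Fin (ℓ + 1)) (k : Fin m) :
    rotate t b k = b (k + t) := rfl

/-- The number of cyclic ascents. -/
def cyclicAsc {m : ℕ} [NeZero m] (b : Fin m → Fin (ℓ + 1)) : ℕ :=
  (Finset.univ.filter fun k => b k < b (k + 1)).card

theorem cyclicAsc_rotate_one {m : ℕ} [NeZero m] (b : Fin m → Fin (ℓ + 1)) :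
    cyclicAsc (rotate 1 b) = cyclicAsc b := by
  rw [cyclicAsc, cyclicAsc]
  refine Finset.card_equiv (Equiv.addRight 1) fun k => ?_
  rw [Finset.mem_filter, Finset.mem_filter]
  simp only [Finset.mem_univ, true_and, rotate_apply, Equiv.coe_addRight]

/-- Rotation shifts each of the cyclic ascents by one place. -/
theorem majWeight_rotate_one {m : ℕ} [NeZero m] {ω : R} (hω : ω ^ m = 1)
    (b : Fin m → Fin (ℓ + 1)) :
    majWeight ω (rotate 1 b) * ω ^ cyclicAsc b = majWeight ω b := by
  have h1 : majWeight ω (rotate 1 b) = ∏ k : Fin m, if b k < b (k + 1) then ω ^ (k : ℕ) else 1 := by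
    rw [majWeight]
    refine Fintype.prod_equiv (Equiv.addRight 1) _ _ fun k => ?_
    simp only [rotate_apply, Equiv.coe_addRight, pow_val_add_one hω]
    rfl
  have h2 : ω ^ cyclicAsc b = ∏ k : Fin m, if b k < b (k + 1) then ω else 1 := by
    rw [cyclicAsc, Finset.prod_ite, Finset.prod_const, Finset.prod_const_one, mul_one]
  rw [h1, h2, ← Finset.prod_mul_distrib, majWeight]
  refine Finset.prod_congr rfl fun k _ => ?_
  split_ifs
  · rw [pow_succ]
  · rw [one_mul]

theorem sum_val_succ {m : ℕ} [NeZero m] (b : Fin m → Fin (ℓ + 1)) :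
    ∑ k, (b (k + 1) : ℕ) = ∑ k, (b k : ℕ) :=
  Fintype.sum_equiv (Equiv.addRight 1) _ _ fun _ => rfl

theorem cyclicAsc_lt {m : ℕ} [NeZero m] (b : Fin m → Fin (ℓ + 1)) : cyclicAsc b < m := by
  rw [cyclicAsc]
  refine lt_of_le_of_ne ((Finset.card_le_univ _).trans_eq (Fintype.card_fin m)) fun h => ?_
  have h' : ∀ k, b k < b (k + 1) := by
    have := (Finset.card_eq_iff_eq_univ _).1 (h.trans (Fintype.card_fin m).symm)
    intro k
    have hk := Finset.mem_univ k
    rw [← this] at hk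
    exact (Finset.mem_filter.1 hk).2
  have := Finset.sum_lt_sum_of_nonempty (Finset.univ_nonempty (α := Fin m)) fun k _ =>
    Fin.lt_def.1 (h' k)
  rw [sum_val_succ] at this
  exact lt_irrefl _ this

theorem eq_const_of_forall_succ {m : ℕ} [NeZero m] {α : Type*} {b : Fin m → α}
    (h : ∀ k, b (k + 1) = b k) (k : Fin m) : b k = b 0 := by
  obtain ⟨m, rfl⟩ : ∃ n, m = n + 1 := ⟨m - 1, (Nat.succ_pred_eq_of_pos (NeZero.pos m)).symm⟩
  induction k using Fin.induction with
  | zero => rfl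
  | succ k ih => rw [← Fin.coeSucc_eq_succ, h, ih]

theorem cyclicAsc_eq_zero_iff {m : ℕ} [NeZero m] (b : Fin m → Fin (ℓ + 1)) :
    cyclicAsc b = 0 ↔ ∃ i, b = fun _ => i := by
  constructor
  · intro h
    rw [cyclicAsc, Finset.card_eq_zero, Finset.filter_eq_empty_iff] at h
    have h1 : ∀ k ∈ Finset.univ, (b (k + 1) : ℕ) ≤ b k := fun k hk => not_lt.1 (h hk)
    have h2 := (Finset.sum_eq_sum_iff_of_le h1).1 (sum_val_succ b)
    exact ⟨b 0, funext (eq_const_of_forall_succ fun k => Fin.ext (h2 k (Finset.mem_univ k)))⟩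
  · rintro ⟨i, rfl⟩
    simp [cyclicAsc]

/-- At a primitive `d`-th root of unity, only the constant words of length `d` survive: rotating a
word with `c` cyclic ascents multiplies its weight by `ω ^ (-c)`, and `0 < c < d` unless the word is
constant. -/
theorem sum_majWeight_of_isPrimitiveRoot [IsDomain R] {d : ℕ} [NeZero d] {ω : R}
    (hω : IsPrimitiveRoot ω d) (x : Fin (ℓ + 1) → R) :
    ∑ u : Fin d → Fin (ℓ + 1), (∏ j, x (u j)) * majWeight ω u = ∑ i, x i ^ d := by
  set f : (Fin d → Fin (ℓ + 1)) → R := fun u => (∏ j, x (u j)) * majWeight ω u with hf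
  have hrot : ∀ u, f (rotate 1 u) * ω ^ cyclicAsc u = f u := fun u => by
    simp only [hf, mul_assoc, majWeight_rotate_one hω.pow_eq_one]
    congr 1
    exact Fintype.prod_equiv (Equiv.addRight 1) _ _ fun k => rfl
  have hS : ∀ c ∈ Finset.range d, c ≠ 0 →
      ∑ u ∈ Finset.univ.filter (fun u : Fin d → Fin (ℓ + 1) => cyclicAsc u = c), f u = 0 := by
    intro c hc hc0
    set S := ∑ u ∈ Finset.univ.filter (fun u : Fin d → Fin (ℓ + 1) => cyclicAsc u = c), f u with hSdef
    have h1 : S * ω ^ c = S := by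
      conv_rhs => rw [hSdef]
      rw [hSdef, Finset.sum_mul]
      symm
      refine Finset.sum_equiv (rotate 1) (fun u => by simp [cyclicAsc_rotate_one]) fun u hu => ?_
      rw [← hrot u, (Finset.mem_filter.1 hu).2]
    have h2 : ω ^ c ≠ 1 := hω.pow_ne_one_of_pos_of_lt hc0 (Finset.mem_range.1 hc)
    have h3 : S * (ω ^ c - 1) = 0 := by rw [mul_sub, h1, mul_one, sub_self]
    exact (mul_eq_zero.1 h3).resolve_right (sub_ne_zero.2 h2)
  rw [← Finset.sum_fiberwise_of_maps_to (s := Finset.univ) (t := Finset.range d) (g := cyclicAsc)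
    (fun u _ => Finset.mem_range.2 (cyclicAsc_lt u)),
    Finset.sum_eq_single_of_mem 0 (Finset.mem_range.2 (NeZero.pos d)) hS]
  symm
  refine Finset.sum_bij (fun i _ => fun _ => i) (fun i _ => ?_) (fun i _ j _ h => congrFun h 0)
    (fun u hu => ?_) (fun i _ => ?_)
  · simp [cyclicAsc]
  · obtain ⟨i, hi⟩ := (cyclicAsc_eq_zero_iff u).1 (Finset.mem_filter.1 hu).2
    exact ⟨i, Finset.mem_univ i, hi.symm⟩
  · simp [hf, majWeight]

/-- A word of length `g * d` as a sequence of `g` blocks of length `d`. -/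
def blockEquiv (α : Type*) (g d : ℕ) : (Fin g → Fin d → α) ≃ (Fin (g * d) → α) :=
  (Equiv.curry (Fin g) (Fin d) α).symm.trans (Equiv.arrowCongr finProdFinEquiv (Equiv.refl α))

theorem blockEquiv_apply {α : Type*} {g d : ℕ} (w : Fin g → Fin d → α) (a : Fin g) (o : Fin d) :
    blockEquiv α g d w (finProdFinEquiv (a, o)) = w a o := by
  simp [blockEquiv]

/-- For `ω` of order `d`, the weight of a word is the product of the weights of its blocks of
length `d`, because an ascent in a place divisible by `d` has weight one. -/
theorem majWeight_blockEquiv {g d : ℕ} [NeZero g] [NeZero d] [NeZero (g * d)] {ω : R}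
    (hω : ω ^ d = 1) (w : Fin g → Fin d → Fin (ℓ + 1)) :
    majWeight ω (blockEquiv _ g d w) = ∏ a, majWeight ω (w a) := by
  rw [majWeight, ← Fintype.prod_equiv finProdFinEquiv _ _ fun p => rfl, Fintype.prod_prod_type]
  refine Finset.prod_congr rfl fun a _ => Finset.prod_congr rfl fun o _ => ?_
  have hv : ((finProdFinEquiv (a, o) : Fin (g * d)) : ℕ) = o + d * a := rfl
  rw [hv, show (o : ℕ) + d * a + 1 = (o + 1) + d * a by ring, pow_add, pow_mul, hω, one_pow, mul_one]
  by_cases ho : (o : ℕ) + 1 = d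
  · rw [ho, hω]
    simp
  · have h1 : (finProdFinEquiv (a, o) + 1 : Fin (g * d)) = finProdFinEquiv (a, o + 1) := by
      have ho' : ((o + 1 : Fin d) : ℕ) = o + 1 := Fin.val_add_one_of_lt' (by omega)
      have hlt : ((finProdFinEquiv (a, o + 1) : Fin (g * d)) : ℕ) < g * d := Fin.is_lt _
      have hv' : ((finProdFinEquiv (a, o + 1) : Fin (g * d)) : ℕ) = (o + 1 : Fin d) + d * a := rfl
      apply Fin.ext
      rw [hv', ho'] at hlt
      rw [Fin.val_add_one_of_lt' (by rw [hv]; omega), hv', ho', hv]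
      ring
    rw [h1, blockEquiv_apply, blockEquiv_apply]

/-- The generating function of words by content and cyclic major index, at a root of unity of
order `d`. -/
theorem sum_majWeight [IsDomain R] {m g d : ℕ} [NeZero m] (hm : m = g * d) {ω : R}
    (hω : IsPrimitiveRoot ω d) (x : Fin (ℓ + 1) → R) :
    ∑ b : Fin m → Fin (ℓ + 1), (∏ j, x (b j)) * majWeight ω b = (∑ i, x i ^ d) ^ g := by
  subst hm
  have : NeZero g := ⟨left_ne_zero_of_mul (NeZero.ne (g * d))⟩
  have : NeZero d := ⟨right_ne_zero_of_mul (NeZero.ne (g * d))⟩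
  have hpow : ∀ y : R, y ^ g = ∏ _a : Fin g, y := fun y => by simp
  rw [← sum_majWeight_of_isPrimitiveRoot hω, hpow, Fintype.prod_sum]
  symm
  refine Fintype.sum_equiv (blockEquiv _ g d) _ _ fun w => ?_
  rw [Finset.prod_mul_distrib, majWeight_blockEquiv hω.pow_eq_one,
    ← Fintype.prod_equiv finProdFinEquiv _ _ fun p => rfl, Fintype.prod_prod_type]
  simp only [blockEquiv_apply]

/-- A word is fixed by the rotation by `t` exactly if its letters only depend on the place modulo
`gcd(t, m)`. -/
theorem rotate_eq_self_iff {m : ℕ} [NeZero m] (t : Fin m) (b : Fin m → Fin (ℓ + 1)) :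
    rotate t b = b ↔
      ∀ k l : Fin m, (k : ℕ) ≡ l [MOD Nat.gcd t m] → b k = b l := by
  constructor
  · intro h
    have h1 : ∀ n : ℕ, ∀ k, b (k + Fin.ofNat m (n * t)) = b k := by
      intro n
      induction n with
      | zero => intro k; simp
      | succ n ih =>
        intro k
        have : (Fin.ofNat m ((n + 1) * t) : Fin m) = t + Fin.ofNat m (n * t) := by
          apply Fin.ext
          simp [Fin.val_add, add_mul, add_comm]
        rw [this, ← add_assoc, ih]
        exact congrFun h k
    have hg : ∃ n : ℕ, n * t ≡ Nat.gcd t m [MOD m] := by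
      rcases (Nat.gcd_le_right (t : ℕ) (NeZero.pos m)).lt_or_eq with hlt | heq
      · obtain ⟨n, -, hn⟩ := Nat.exists_mul_mod_eq_gcd hlt
        exact ⟨n, by rw [Nat.ModEq, mul_comm, hn, Nat.mod_eq_of_lt hlt]⟩
      · exact ⟨0, by simp [Nat.ModEq, heq]⟩
    obtain ⟨n, hn⟩ := hg
    have h2 : ∀ q : ℕ, ∀ k l : Fin m, (l : ℕ) = k + q * Nat.gcd t m → b l = b k := by
      intro q k l hl
      rw [← h1 (q * n) k]
      congr 1
      apply Fin.ext
      rw [Fin.val_add, Fin.val_ofNat, Nat.add_mod_mod, ← Nat.mod_eq_of_lt l.2, hl]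
      refine (Nat.ModEq.add_left _ ?_).symm
      rw [mul_assoc]
      exact hn.mul_left q
    intro k l hkl
    rcases le_total (k : ℕ) l with hle | hle
    · obtain ⟨q, hq⟩ := (Nat.modEq_iff_dvd' hle).1 hkl
      exact (h2 q k l (by rw [mul_comm, ← hq]; omega)).symm
    · obtain ⟨q, hq⟩ := (Nat.modEq_iff_dvd' hle).1 hkl.symm
      exact h2 q l k (by rw [mul_comm, ← hq]; omega)
  · intro h
    funext k
    refine h _ _ ?_
    rw [Fin.val_add]
    refine ((Nat.mod_modEq _ m).of_dvd (Nat.gcd_dvd_right _ _)).trans ?_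
    exact (Nat.ModEq.add_left k ((Nat.modEq_zero_iff_dvd).2 (Nat.gcd_dvd_left _ _)))

/-- The generating function by content of the words fixed by a rotation of order `d`: such a word
is determined by its first `g` letters, each of which is repeated `d` times. -/
theorem sum_rotate_eq_self {m g d : ℕ} [NeZero m] (hm : m = d * g) (t : Fin m)
    (hg : Nat.gcd t m = g) (x : Fin (ℓ + 1) → R) :
    ∑ b : Fin m → Fin (ℓ + 1) with rotate t b = b, ∏ j, x (b j) = (∑ i, x i ^ d) ^ g := by
  have hg0 : 0 < g := hg ▸ Nat.gcd_pos_of_pos_right _ (NeZero.pos m)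
  have hgm : g ≤ m := hg ▸ Nat.gcd_le_right _ (NeZero.pos m)
  have hpow : ∀ y : R, y ^ g = ∏ _a : Fin g, y := fun y => by simp
  rw [hpow, Fintype.prod_sum]
  symm
  refine Finset.sum_bij (fun u _ => fun k => u ⟨(k : ℕ) % g, Nat.mod_lt _ hg0⟩) (fun u _ => ?_)
    (fun u _ v _ h => ?_) (fun b hb => ?_) (fun u _ => ?_)
  · rw [Finset.mem_filter, rotate_eq_self_iff]
    refine ⟨Finset.mem_univ _, fun k l hkl => ?_⟩
    rw [hg] at hkl
    exact congrArg u (Fin.ext hkl)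
  · funext o
    have := congrFun h ⟨o, o.2.trans_le hgm⟩
    simpa [Nat.mod_eq_of_lt o.2] using this
  · rw [Finset.mem_filter, rotate_eq_self_iff, hg] at hb
    exact ⟨fun o => b ⟨o, o.2.trans_le hgm⟩, Finset.mem_univ _,
      funext fun k => hb.2 _ _ (Nat.mod_modEq _ _)⟩
  · subst hm
    rw [← Fintype.prod_equiv finProdFinEquiv _ _ fun p => rfl, Fintype.prod_prod_type_right]
    refine Finset.prod_congr rfl fun o _ => ?_
    have : ∀ a : Fin d, (⟨((finProdFinEquiv (a, o) : Fin (d * g)) : ℕ) % g, Nat.mod_lt _ hg0⟩ : Fin g)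
        = o := fun a => Fin.ext (by
      change (o + g * a : ℕ) % g = o
      rw [Nat.add_mul_mod_self_left, Nat.mod_eq_of_lt o.2])
    simp only [this, Finset.prod_const, Finset.card_univ, Fintype.card_fin]

end GeneratingFunctions

/-! ### Words of a given content -/

section Content

open MvPolynomial

variable {ℓ m : ℕ}

/-- The content of a word: the number of occurrences of each letter. -/
noncomputable def content (b : Fin m → Fin (ℓ + 1)) : Fin (ℓ + 1) →₀ ℕ :=
  ∑ j, Finsupp.single (b j) 1

/-- The coefficient of `x^κ` in `(∑ x_i^d)^g`. -/
noncomputable def powerSumCoeff (κ : Fin (ℓ + 1) →₀ ℕ) (d g : ℕ) : ℂ :=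
  coeff κ ((∑ i, (X i : MvPolynomial (Fin (ℓ + 1)) ℂ) ^ d) ^ g)

theorem prod_X_eq_monomial_content (b : Fin m → Fin (ℓ + 1)) :
    ∏ j, (X (b j) : MvPolynomial (Fin (ℓ + 1)) ℂ) = monomial (content b) 1 := by
  simp only [X, content, monomial_sum_one]

theorem sum_majWeight_content [NeZero m] {g d : ℕ} (hm : m = g * d) {ω : ℂ}
    (hω : IsPrimitiveRoot ω d) (κ : Fin (ℓ + 1) →₀ ℕ) :
    ∑ b : Fin m → Fin (ℓ + 1) with content b = κ, majWeight ω b = powerSumCoeff κ d g := by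
  have h1 : IsPrimitiveRoot (C ω : MvPolynomial (Fin (ℓ + 1)) ℂ) d :=
    hω.map_of_injective (C_injective _ _)
  have h2 : ∀ b : Fin m → Fin (ℓ + 1),
      majWeight (C ω : MvPolynomial (Fin (ℓ + 1)) ℂ) b = C (majWeight ω b) := by
    intro b
    rw [majWeight, majWeight, map_prod]
    exact Finset.prod_congr rfl fun k _ => by split_ifs <;> simp
  rw [powerSumCoeff, ← sum_majWeight hm h1, coeff_sum, Finset.sum_filter]
  refine Finset.sum_congr rfl fun b _ => ?_
  rw [h2, prod_X_eq_monomial_content, mul_comm, coeff_C_mul, coeff_monomial]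
  simp

/-- A power sum coefficient counts the words of content `κ` fixed by a rotation of order `d`. -/
theorem card_rotate_content [NeZero m] {g d : ℕ} (hm : m = d * g) (t : Fin m)
    (hg : Nat.gcd t m = g) (κ : Fin (ℓ + 1) →₀ ℕ) :
    ((Finset.univ.filter fun b : Fin m → Fin (ℓ + 1) => rotate t b = b ∧ content b = κ).card : ℂ)
      = powerSumCoeff κ d g := by
  rw [powerSumCoeff, ← sum_rotate_eq_self hm t hg, coeff_sum, ← Finset.filter_filter,
    Finset.card_filter, Nat.cast_sum]
  refine Finset.sum_congr rfl fun b _ => ?_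
  rw [prod_X_eq_monomial_content, coeff_monomial]
  simp

theorem powerSumCoeff_eq {κ : Fin (ℓ + 1) →₀ ℕ} {d g : ℕ} (hd : d ≠ 0) (hκ : ∑ i, κ i = d * g) :
    powerSumCoeff κ d g = if ∀ i, d ∣ κ i then
      (Nat.multinomial Finset.univ fun i => κ i / d : ℂ) else 0 := by
  rw [powerSumCoeff, Finset.sum_pow_eq_sum_piAntidiag, coeff_sum]
  have h1 : ∀ k : Fin (ℓ + 1) → ℕ, coeff κ ((Nat.multinomial Finset.univ k : MvPolynomial _ ℂ) *
      ∏ i, ((X i : MvPolynomial (Fin (ℓ + 1)) ℂ) ^ d) ^ k i) =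
      if ∀ i, κ i = d * k i then (Nat.multinomial Finset.univ k : ℂ) else 0 := by
    intro k
    have h2 : ∏ i, ((X i : MvPolynomial (Fin (ℓ + 1)) ℂ) ^ d) ^ k i =
        monomial (Finsupp.equivFunOnFinite.symm fun i => d * k i) 1 := by
      rw [monomial_eq, Finsupp.prod_fintype _ _ (by simp)]
      simp [pow_mul]
    rw [h2, ← map_natCast (C : ℂ →+* MvPolynomial (Fin (ℓ + 1)) ℂ), coeff_C_mul, coeff_monomial]
    have h3 : (Finsupp.equivFunOnFinite.symm fun i => d * k i) = κ ↔ ∀ i, κ i = d * k i := by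
      rw [Finsupp.ext_iff]
      exact forall_congr' fun i => eq_comm
    simp only [h3, mul_ite, mul_one, mul_zero]
  simp only [h1]
  split_ifs with hdvd
  · have hk : ∀ i, κ i = d * (κ i / d) := fun i => (Nat.mul_div_cancel' (hdvd i)).symm
    rw [Finset.sum_eq_single_of_mem (fun i => κ i / d), if_pos hk]
    · rw [Finset.mem_piAntidiag]
      refine ⟨Nat.eq_of_mul_eq_mul_left (Nat.pos_of_ne_zero hd) ?_, by simp⟩
      rw [← hκ, Finset.mul_sum]
      exact Finset.sum_congr rfl fun i _ => (hk i).symm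
    · intro k _ hne
      refine if_neg fun h => hne (funext fun i => ?_)
      rw [h i, Nat.mul_div_cancel_left _ (Nat.pos_of_ne_zero hd)]
  · exact Finset.sum_eq_zero fun k _ => if_neg fun h => hdvd fun i => ⟨k i, h i⟩

end Content

/-! ### Ramanujan sums -/

section Ramanujan

open ArithmeticFunction

theorem sum_pow_eq_sum_nthRootsFinset {m : ℕ} [NeZero m] {ζ : ℂ} (hζ : IsPrimitiveRoot ζ m)
    (F : ℂ → ℂ) :
    ∑ t : Fin m, F (ζ ^ (t : ℕ)) = ∑ ω ∈ Polynomial.nthRootsFinset m (1 : ℂ), F ω := by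
  refine Finset.sum_bij (fun t _ => ζ ^ (t : ℕ)) (fun t _ => ?_) (fun s _ t _ h => ?_)
    (fun ω hω => ?_) (fun t _ => rfl)
  · rw [Polynomial.mem_nthRootsFinset (NeZero.pos m), ← pow_mul, mul_comm, pow_mul, hζ.pow_eq_one,
      one_pow]
  · exact Fin.ext (hζ.pow_inj s.2 t.2 h)
  · rw [Polynomial.mem_nthRootsFinset (NeZero.pos m)] at hω
    obtain ⟨i, hi, h⟩ := hζ.eq_pow_of_pow_eq_one hω
    exact ⟨⟨i, hi⟩, Finset.mem_univ _, h⟩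

theorem sum_nthRootsFinset {m : ℕ} (F : ℂ → ℂ) :
    ∑ ω ∈ Polynomial.nthRootsFinset m (1 : ℂ), F ω =
      ∑ d ∈ m.divisors, ∑ ω ∈ primitiveRoots d ℂ, F ω := by
  rw [IsPrimitiveRoot.nthRoots_one_eq_biUnion_primitiveRoots, Finset.sum_biUnion]
  exact fun i _ j _ h => IsPrimitiveRoot.disjoint h

/-- The sum of the primitive `d`-th roots of unity is `μ(d)`, by Möbius inversion from the vanishing
of the sum of all `d`-th roots of unity. -/
theorem sum_primitiveRoots_eq_moebius {d : ℕ} (hd : 0 < d) :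
    ∑ ω ∈ primitiveRoots d ℂ, ω = (moebius d : ℂ) := by
  have h : ∀ n > 0, ∑ i ∈ n.divisors, (∑ ω ∈ primitiveRoots i ℂ, ω) =
      (if n = 1 then 1 else 0 : ℂ) := by
    intro n hn
    have : NeZero n := ⟨hn.ne'⟩
    have hζ := Complex.isPrimitiveRoot_exp n hn.ne'
    rw [← sum_nthRootsFinset fun ω => ω, ← sum_pow_eq_sum_nthRootsFinset hζ]
    rw [Fin.sum_univ_eq_sum_range (fun t => Complex.exp (2 * Real.pi * Complex.I / n) ^ t) n]
    split_ifs with h1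
    · subst h1; simp
    · exact hζ.geom_sum_eq_zero (by omega)
  rw [← (sum_eq_iff_sum_mul_moebius_eq.1 h) d hd,
    Finset.sum_eq_single_of_mem (d, 1) (by simp [hd.ne'])]
  · simp
  · rintro ⟨a, b⟩ hab hne
    have hb : b ≠ 1 := by
      rintro rfl
      have := (Nat.mem_divisorsAntidiagonal.1 hab).1
      simp only [mul_one] at this
      exact hne (by rw [this])
    simp [hb]

theorem card_mul_sum_comp_of_surjective {G H : Type*} [Group G] [Group H] [Fintype G] [Fintype H]
    [DecidableEq H] (f : G →* H) (hf : Function.Surjective f) (F : H → ℂ) :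
    (Fintype.card H : ℂ) * ∑ g, F (f g) = Fintype.card G * ∑ h, F h := by
  have hfib : ∀ h, (Finset.univ.filter fun g => f g = h).card =
      (Finset.univ.filter fun g => f g = 1).card := fun h =>
    MonoidHom.card_fiber_eq_of_mem_range f (hf h) (hf 1)
  have hc : Fintype.card G = Fintype.card H * (Finset.univ.filter fun g => f g = 1).card := by
    rw [← Finset.card_univ, Finset.card_eq_sum_card_fiberwise (f := f) (t := Finset.univ)
      (fun _ _ => Finset.mem_coe.2 (Finset.mem_univ _)), Finset.sum_congr rfl fun h _ => hfib h]
    simp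
  have hs : ∑ g, F (f g) = (Finset.univ.filter fun g => f g = 1).card * ∑ h, F h := by
    rw [← Finset.sum_fiberwise Finset.univ f, Finset.mul_sum]
    refine Finset.sum_congr rfl fun h _ => ?_
    rw [← hfib h, ← nsmul_eq_mul, ← Finset.sum_const]
    exact Finset.sum_congr rfl fun g hg => by rw [(Finset.mem_filter.1 hg).2]
  rw [hs, hc]
  push_cast
  ring

theorem sum_primitiveRoots_eq_sum_units {d : ℕ} [NeZero d] {ω : ℂ} (hω : IsPrimitiveRoot ω d)
    (F : ℂ → ℂ) :
    ∑ u ∈ primitiveRoots d ℂ, F u = ∑ a : (ZMod d)ˣ, F (ω ^ (a : ZMod d).val) := by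
  symm
  refine Finset.sum_bij (fun a _ => ω ^ (a : ZMod d).val) (fun a _ => ?_) (fun a _ b _ h => ?_)
    (fun u hu => ?_) (fun a _ => rfl)
  · rw [mem_primitiveRoots (NeZero.pos d)]
    exact hω.pow_of_coprime _ (ZMod.val_coe_unit_coprime a)
  · exact Units.ext (ZMod.val_injective d (hω.pow_inj (ZMod.val_lt _) (ZMod.val_lt _) h))
  · rw [mem_primitiveRoots (NeZero.pos d), hω.isPrimitiveRoot_iff] at hu
    obtain ⟨i, hi, hc, rfl⟩ := hu
    refine ⟨ZMod.unitOfCoprime i hc, Finset.mem_univ _, ?_⟩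
    rw [ZMod.coe_unitOfCoprime, ZMod.val_natCast, Nat.mod_eq_of_lt hi]

/-- Hölder's formula: `u ↦ u ^ s` maps the primitive `d`-th roots of unity onto those of order
`d / gcd(d, s)`, with fibres of equal size. -/
theorem sum_primitiveRoots_zpow {d : ℕ} (hd : 0 < d) (s : ℤ) :
    ∑ u ∈ primitiveRoots d ℂ, u ^ s = (ramanujan s d : ℂ) := by
  have : NeZero d := ⟨hd.ne'⟩
  set d' := d / Int.gcd d s with hd'
  have hg : 0 < Int.gcd d s := Int.gcd_pos_of_ne_zero_left _ (by exact_mod_cast hd.ne')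
  have hgd : Int.gcd d s ∣ d := by exact_mod_cast Int.gcd_dvd_left (d : ℤ) s
  have hdd : d' ∣ d := Nat.div_dvd_of_dvd hgd
  have hd'0 : 0 < d' := Nat.div_pos (Nat.le_of_dvd hd hgd) hg
  have : NeZero d' := ⟨hd'0.ne'⟩
  obtain ⟨ω, hω⟩ : ∃ ω : ℂ, IsPrimitiveRoot ω d := ⟨_, Complex.isPrimitiveRoot_exp d hd.ne'⟩
  have hη : IsPrimitiveRoot (ω ^ s) d' := by
    have h1 : IsPrimitiveRoot (ω ^ (Int.gcd d s)) d' := hω.pow hd (Nat.mul_div_cancel' hgd).symm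
    obtain ⟨q, hq⟩ := Int.gcd_dvd_right (d : ℤ) s
    have h2 : ω ^ s = (ω ^ (Int.gcd d s)) ^ q := by
      rw [← zpow_natCast, ← zpow_mul, ← hq]
    rw [h2]
    refine h1.zpow_of_gcd_eq_one q ?_
    have h3 : (d : ℤ) = (Int.gcd d s : ℤ) * d' := by
      rw [hd']; exact_mod_cast (Nat.mul_div_cancel' hgd).symm
    have h4 : Int.gcd d s = Int.gcd d s * Int.gcd d' q := by
      have h6 := Int.gcd_mul_left (Int.gcd d s : ℤ) d' q
      rw [← h3, ← hq] at h6
      simpa using h6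
    rw [Int.gcd_comm]
    exact (Nat.eq_of_mul_eq_mul_left hg (by rw [mul_one]; exact h4)).symm
  have hphi : (Nat.totient d' : ℂ) ≠ 0 := by exact_mod_cast (Nat.totient_pos.2 hd'0).ne'
  have key := card_mul_sum_comp_of_surjective (ZMod.unitsMap hdd) (ZMod.unitsMap_surjective hdd)
    fun b => (ω ^ s) ^ (b : ZMod d').val
  rw [ZMod.card_units_eq_totient, ZMod.card_units_eq_totient,
    ← sum_primitiveRoots_eq_sum_units hη fun u => u, sum_primitiveRoots_eq_moebius hd'0] at key
  have h5 : ∑ u ∈ primitiveRoots d ℂ, u ^ s =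
      ∑ a : (ZMod d)ˣ, (ω ^ s) ^ ((ZMod.unitsMap hdd a : (ZMod d')ˣ) : ZMod d').val := by
    rw [sum_primitiveRoots_eq_sum_units hω fun u => u ^ s]
    refine Finset.sum_congr rfl fun a _ => ?_
    have h6 : ∀ n : ℕ, (ω ^ s) ^ (n % d') = (ω ^ s) ^ n := fun n => by
      rw [hη.eq_orderOf, pow_mod_orderOf]
    rw [ZMod.unitsMap_val, ZMod.cast_eq_val, ZMod.val_natCast, h6, ← zpow_natCast, ← zpow_natCast,
      ← zpow_mul, ← zpow_mul, mul_comm]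
  rw [h5, ramanujan, ← hd']
  push_cast
  rw [eq_div_iff hphi, mul_comm, key]

end Ramanujan

/-! ### The number of words with given content and cyclic major index -/

section Count

variable {ℓ m : ℕ} [NeZero m]

omit [NeZero m] in
theorem sum_zpow_pow {ζ : ℂ} (hζ : IsPrimitiveRoot ζ m) (a : ℤ) :
    ∑ t : Fin m, (ζ ^ (t : ℕ)) ^ a = if (m : ℤ) ∣ a then (m : ℂ) else 0 := by
  have h : ∀ t : Fin m, (ζ ^ (t : ℕ)) ^ a = (ζ ^ a) ^ (t : ℕ) := fun t => by
    rw [← zpow_natCast, ← zpow_natCast, ← zpow_mul, ← zpow_mul, mul_comm]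
  simp only [h]
  split_ifs with hd
  · simp [(hζ.zpow_eq_one_iff_dvd a).2 hd]
  · have h1 : ζ ^ a ≠ 1 := fun h => hd ((hζ.zpow_eq_one_iff_dvd a).1 h)
    rw [Fin.sum_univ_eq_sum_range fun t => (ζ ^ a) ^ t, geom_sum_eq h1, ← zpow_natCast, ← zpow_mul,
      mul_comm, zpow_mul, zpow_natCast, hζ.pow_eq_one, one_zpow, sub_self, zero_div]

theorem orderOf_pow_val {ζ : ℂ} (hζ : IsPrimitiveRoot ζ m) (t : Fin m) :
    m = orderOf (ζ ^ (t : ℕ)) * Nat.gcd t m := by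
  rw [IsOfFinOrder.orderOf_pow _ _ (hζ.isOfFinOrder (NeZero.ne m)), ← hζ.eq_orderOf, Nat.gcd_comm,
    Nat.div_mul_cancel (Nat.gcd_dvd_right t m)]

/-- The value of the cyclic major index is singled out by a Fourier transform over the `m`-th roots
of unity. -/
theorem natCast_card_content_cyclicMaj {ζ : ℂ} (hζ : IsPrimitiveRoot ζ m)
    (κ : Fin (ℓ + 1) →₀ ℕ) (s : ℤ) :
    ((Finset.univ.filter fun b : Fin m → Fin (ℓ + 1) =>
      content b = κ ∧ (s : ZMod m) + cyclicMaj b = 0).card : ℂ) =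
    1 / m * ∑ t : Fin m, (ζ ^ (t : ℕ)) ^ s *
      powerSumCoeff κ (orderOf (ζ ^ (t : ℕ))) (Nat.gcd t m) := by
  have hm : (m : ℂ) ≠ 0 := by exact_mod_cast NeZero.ne m
  have hζ0 : ζ ≠ 0 := hζ.ne_zero (NeZero.ne m)
  have h1 : ∀ t : Fin m, (ζ ^ (t : ℕ)) ^ s * powerSumCoeff κ (orderOf (ζ ^ (t : ℕ))) (Nat.gcd t m) =
      ∑ b : Fin m → Fin (ℓ + 1) with content b = κ, (ζ ^ (t : ℕ)) ^ (s + (cyclicMaj b).val) := by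
    intro t
    have ht : (ζ ^ (t : ℕ)) ^ m = 1 := by rw [← pow_mul, mul_comm, pow_mul, hζ.pow_eq_one, one_pow]
    rw [← sum_majWeight_content ((orderOf_pow_val hζ t).trans (mul_comm _ _))
      (IsPrimitiveRoot.orderOf _), Finset.mul_sum]
    refine Finset.sum_congr rfl fun b _ => ?_
    rw [majWeight_eq_pow_cyclicMaj ht, zpow_add₀ (pow_ne_zero _ hζ0), zpow_natCast]
  simp only [h1]
  rw [Finset.sum_comm, eq_comm, one_div, inv_mul_eq_iff_eq_mul₀ hm]
  simp only [sum_zpow_pow hζ]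
  rw [← Finset.filter_filter, Finset.card_filter, Nat.cast_sum, Finset.mul_sum]
  refine Finset.sum_congr rfl fun b _ => ?_
  have : (m : ℤ) ∣ s + (cyclicMaj b).val ↔ (s : ZMod m) + cyclicMaj b = 0 := by
    rw [← ZMod.intCast_zmod_eq_zero_iff_dvd]
    push_cast
    rw [ZMod.natCast_val, ZMod.cast_id]
  simp only [this]
  split_ifs <;> simp

/-- Sorting the `m`-th roots of unity by their order turns the Fourier sum into a sum over
divisors, in which the powers of the roots of a given order add up to a Ramanujan sum. -/
theorem sum_zpow_mul_powerSumCoeff {ζ : ℂ} (hζ : IsPrimitiveRoot ζ m)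
    (κ : Fin (ℓ + 1) →₀ ℕ) (hκ : ∑ i, κ i = m) (s : ℤ) :
    1 / m * ∑ t : Fin m, (ζ ^ (t : ℕ)) ^ s *
      powerSumCoeff κ (orderOf (ζ ^ (t : ℕ))) (Nat.gcd t m) = (weightMult κ s : ℂ) := by
  have h1 : ∀ t : Fin m, Nat.gcd t m = m / orderOf (ζ ^ (t : ℕ)) := fun t => by
    have h := orderOf_pow_val hζ t
    have h0 : 0 < orderOf (ζ ^ (t : ℕ)) :=
      Nat.pos_of_ne_zero fun h0 => NeZero.ne m (by rw [h, h0, zero_mul])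
    exact (Nat.div_eq_of_eq_mul_right h0 h).symm
  simp only [h1]
  rw [sum_pow_eq_sum_nthRootsFinset hζ fun ω => ω ^ s * powerSumCoeff κ (orderOf ω) (m / orderOf ω),
    sum_nthRootsFinset, weightMult, hκ]
  push_cast
  congr 1
  have h2 : ∀ d ∈ m.divisors, ∑ ω ∈ primitiveRoots d ℂ,
      ω ^ s * powerSumCoeff κ (orderOf ω) (m / orderOf ω) =
      if d ∈ (Finset.univ.gcd κ).divisors then
        (ramanujan s d : ℂ) * (Nat.multinomial Finset.univ fun i => κ i / d : ℂ) else 0 := by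
    intro d hd
    have hdm := Nat.dvd_of_mem_divisors hd
    have hd0 : 0 < d := Nat.pos_of_mem_divisors hd
    have h3 : ∀ ω ∈ primitiveRoots d ℂ, ω ^ s * powerSumCoeff κ (orderOf ω) (m / orderOf ω) =
        ω ^ s * powerSumCoeff κ d (m / d) := fun ω hω => by
      rw [← ((mem_primitiveRoots hd0).1 hω).eq_orderOf]
    rw [Finset.sum_congr rfl h3, ← Finset.sum_mul, sum_primitiveRoots_zpow hd0,
      powerSumCoeff_eq hd0.ne' (hκ.trans (Nat.mul_div_cancel' hdm).symm)]
    have h4 : (∀ i, d ∣ κ i) ↔ d ∈ (Finset.univ.gcd κ).divisors := by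
      have h5 : Finset.univ.gcd κ ≠ 0 := by
        rw [Ne, Finset.gcd_eq_zero_iff]
        intro h
        exact NeZero.ne m (hκ.symm.trans (Finset.sum_eq_zero h))
      rw [Nat.mem_divisors, Finset.dvd_gcd_iff]
      simp [h5]
    simp only [h4, mul_ite, mul_zero]
  rw [Finset.sum_congr rfl h2, ← Finset.sum_filter]
  refine Finset.sum_congr ?_ fun _ _ => rfl
  ext d
  rw [Finset.mem_filter, and_iff_right_iff_imp]
  intro hd
  rw [Nat.mem_divisors]
  refine ⟨?_, NeZero.ne m⟩
  rw [← hκ]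
  exact Finset.dvd_sum fun i hi => (Nat.dvd_of_mem_divisors hd).trans (Finset.gcd_dvd hi)

end Count

open LevelZero.LoopSpace (mono euler hom_ext euler_mono)

/-! ### The tensor power of the natural representation -/

section TensorPower

variable {ℓ m : ℕ}

/-- The vector `v_{w_1} ⊗ ⋯ ⊗ v_{w_m}` attached to a word. -/
noncomputable def wordVec (w : Fin m → Fin (ℓ + 1)) : TensorNat ℓ m :=
  PiTensorProduct.tprod ℂ fun j => Pi.single (w j) 1

variable (ℓ m) in
/-- The basis of `V^{⊗m}` indexed by words. -/
noncomputable def wordBasis : Module.Basis (Fin m → Fin (ℓ + 1)) ℂ (TensorNat ℓ m) :=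
  Basis.piTensorProduct fun _ => Pi.basisFun ℂ (Fin (ℓ + 1))

theorem wordBasis_apply (w : Fin m → Fin (ℓ + 1)) : wordBasis ℓ m w = wordVec w := by
  rw [wordBasis, Basis.piTensorProduct_apply, wordVec]
  simp

/-- The endomorphism of `V` given by the matrix unit `E_{ab}`. -/
noncomputable def unitEnd (a b : Fin (ℓ + 1)) : Module.End ℂ (Fin (ℓ + 1) → ℂ) :=
  Matrix.toLin' (Matrix.single a b 1)

theorem unitEnd_single (a b c : Fin (ℓ + 1)) :
    unitEnd a b (Pi.single c 1) = if c = b then Pi.single a 1 else 0 := by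
  rw [unitEnd, Matrix.toLin'_apply, Matrix.mulVec_single_one]
  ext d
  by_cases h : c = b
  · subst h
    by_cases h' : a = d
    · subst h'; simp
    · simp [h', Ne.symm h']
  · simp [h, Ne.symm h]

theorem unitEnd_mul (a b c : Fin (ℓ + 1)) : unitEnd a b * unitEnd b c = unitEnd a c := by
  rw [unitEnd, unitEnd, unitEnd, Module.End.mul_eq_comp, ← Matrix.toLin'_mul]
  simp

theorem map_unitEnd_wordVec (v u w : Fin m → Fin (ℓ + 1)) :
    PiTensorProduct.map (fun j => unitEnd (v j) (u j)) (wordVec w) =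
      if w = u then wordVec v else 0 := by
  rw [wordVec, PiTensorProduct.map_tprod]
  simp only [unitEnd_single]
  split_ifs with h
  · subst h
    simp [wordVec]
  · obtain ⟨j, hj⟩ := Function.ne_iff.1 h
    exact MultilinearMap.map_coord_zero _ j (if_neg hj)

theorem slotEnd_tprod (j : Fin m) (u : Module.End ℂ (Fin (ℓ + 1) → ℂ))
    (f : Fin m → Fin (ℓ + 1) → ℂ) :
    slotEnd ℓ m j u (PiTensorProduct.tprod ℂ f) =
      PiTensorProduct.tprod ℂ (Function.update f j (u (f j))) := by
  rw [slotEnd_apply, PiTensorProduct.map_tprod]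
  congr 1
  funext k
  by_cases hk : k = j
  · subst hk; simp
  · simp [hk]

theorem slotEnd_unitEnd_wordVec (j : Fin m) (a b : Fin (ℓ + 1)) (w : Fin m → Fin (ℓ + 1)) :
    slotEnd ℓ m j (unitEnd a b) (wordVec w) =
      if w j = b then wordVec (Function.update w j a) else 0 := by
  rw [wordVec, slotEnd_tprod, unitEnd_single]
  split_ifs with h
  · rw [wordVec]
    congr 1
    funext k
    by_cases hk : k = j
    · subst hk; simp
    · simp [hk]
  · exact MultilinearMap.map_coord_zero _ j (by simp)

theorem slot_matUnit (j : Fin m) (a b : Fin (ℓ + 1)) (h : a ≠ b) :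
    slot ℓ m j (matUnit ℓ a b h) = slotEnd ℓ m j (unitEnd a b) := rfl

theorem slot_singleSubSingle_wordVec (j : Fin m) (a b : Fin (ℓ + 1)) (w : Fin m → Fin (ℓ + 1)) :
    slot ℓ m j (LieAlgebra.SpecialLinear.singleSubSingle a b 1) (wordVec w) =
      ((if w j = a then 1 else 0) - (if w j = b then 1 else 0) : ℂ) • wordVec w := by
  have h : natRep ℓ (LieAlgebra.SpecialLinear.singleSubSingle a b 1) =
      unitEnd a a - unitEnd b b := by
    change Matrix.toLin' _ = _
    rw [LieAlgebra.SpecialLinear.val_singleSubSingle, map_sub]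
    rfl
  rw [slot, LinearMap.comp_apply, h, map_sub, LinearMap.sub_apply, slotEnd_unitEnd_wordVec,
    slotEnd_unitEnd_wordVec]
  have hc : ∀ c, (if w j = c then wordVec (Function.update w j c) else 0) =
      (if w j = c then (1 : ℂ) else 0) • wordVec w := fun c => by
    split_ifs with h
    · rw [← h, Function.update_eq_self, one_smul]
    · rw [zero_smul]
  rw [hc, hc]
  exact (sub_smul (M := TensorNat ℓ m) (R := ℂ) _ _ _).symm

/-- `V^{⊗m}` is irreducible under the action of `m` copies of `sl_{ℓ+1}`, one for each factor. -/
theorem eq_bot_or_eq_top_of_slot_mem [NeZero ℓ] (W : Submodule ℂ (TensorNat ℓ m))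
    (hW : ∀ j x, ∀ w ∈ W, slot ℓ m j x w ∈ W) : W = ⊥ ∨ W = ⊤ := by
  -- The diagonal matrix units are products of off-diagonal ones, so `W` is stable under all of
  -- `End V` in each factor.
  have h1 : ∀ j a b, ∀ w ∈ W, slotEnd ℓ m j (unitEnd a b) w ∈ W := by
    intro j a b w hw
    by_cases hab : a = b
    · subst hab
      rw [← unitEnd_mul a (a - 1) a, slotEnd_mul, Module.End.mul_apply]
      exact hW j (matUnit ℓ a (a - 1) (sub_one_ne ℓ a).symm) _
        (hW j (matUnit ℓ (a - 1) a (sub_one_ne ℓ a)) w hw)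
    · exact hW j (matUnit ℓ a b hab) w hw
  -- Hence `W` is stable under the matrix units of `End (V^{⊗m})`.
  have h2 : ∀ (v u : Fin m → Fin (ℓ + 1)) (s : Finset (Fin m)), ∀ w ∈ W,
      PiTensorProduct.map (fun j => if j ∈ s then unitEnd (v j) (u j) else LinearMap.id) w ∈ W := by
    intro v u s
    induction s using Finset.induction_on with
    | empty =>
      intro w hw
      simpa [PiTensorProduct.map_id] using hw
    | insert k s hk ih =>
      intro w hw
      have h3 : (fun j => if j ∈ insert k s then unitEnd (v j) (u j) else LinearMap.id) =
          fun j => Function.update (fun _ => (LinearMap.id : Module.End ℂ (Fin (ℓ + 1) → ℂ))) k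
            (unitEnd (v k) (u k)) j * (if j ∈ s then unitEnd (v j) (u j) else LinearMap.id) := by
        funext j
        by_cases hj : j = k
        · subst hj
          simp only [Finset.mem_insert_self, if_true, Function.update_self, if_neg hk]
          rfl
        · simp only [Finset.mem_insert, hj, false_or, Function.update_of_ne hj]
          rfl
      rw [h3, PiTensorProduct.map_mul, ← slotEnd_apply]
      exact h1 k _ _ _ (ih w hw)
  refine or_iff_not_imp_left.2 fun hne => ?_
  obtain ⟨w, hw, hw0⟩ := (Submodule.ne_bot_iff _).1 hne
  obtain ⟨u, hu⟩ : ∃ u, (wordBasis ℓ m).repr w u ≠ 0 := by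
    by_contra! h
    exact hw0 ((wordBasis ℓ m).repr.map_eq_zero_iff.1 (Finsupp.ext h))
  rw [eq_top_iff, ← (wordBasis ℓ m).span_eq, Submodule.span_le]
  rintro _ ⟨v, rfl⟩
  have h3 := h2 v u Finset.univ w hw
  simp only [Finset.mem_univ, if_true] at h3
  rw [← (wordBasis ℓ m).sum_repr w, map_sum] at h3
  simp only [map_smul, wordBasis_apply, map_unitEnd_wordVec, smul_ite, smul_zero,
    Finset.sum_ite_eq', Finset.mem_univ, if_true] at h3
  rw [wordBasis_apply]
  exact (W.smul_mem_iff hu).1 h3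

/-! ### Rotation of the tensor factors -/

variable [NeZero m]

/-- Rotation of the tensor factors: the `i`-th factor is moved to the place `i + t`. -/
noncomputable def rotT (t : Fin m) : Module.End ℂ (TensorNat ℓ m) :=
  (PiTensorProduct.reindex ℂ (fun _ => Fin (ℓ + 1) → ℂ) (Equiv.addRight t)).toLinearMap

theorem rotT_tprod (t : Fin m) (f : Fin m → Fin (ℓ + 1) → ℂ) :
    rotT t (PiTensorProduct.tprod ℂ f) = PiTensorProduct.tprod ℂ fun i => f (i - t) := by
  simp only [sub_eq_add_neg]
  exact PiTensorProduct.reindex_tprod _ f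

theorem rotT_wordVec (t : Fin m) (w : Fin m → Fin (ℓ + 1)) :
    rotT t (wordVec w) = wordVec ((rotate t).symm w) :=
  rotT_tprod t _

theorem rotT_rotT (s t : Fin m) (v : TensorNat ℓ m) : rotT s (rotT t v) = rotT (s + t) v := by
  have : rotT s * rotT t = (rotT (s + t) : Module.End ℂ (TensorNat ℓ m)) := by
    apply PiTensorProduct.ext
    apply MultilinearMap.ext
    intro (f : Fin m → Fin (ℓ + 1) → ℂ)
    simp only [LinearMap.compMultilinearMap_apply, Module.End.mul_apply, rotT_tprod, sub_sub]
  exact LinearMap.congr_fun this v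

theorem rotT_slotEnd (t j : Fin m) (u : Module.End ℂ (Fin (ℓ + 1) → ℂ)) (v : TensorNat ℓ m) :
    rotT t (slotEnd ℓ m j u v) = slotEnd ℓ m (j + t) u (rotT t v) := by
  have : rotT t * slotEnd ℓ m j u = slotEnd ℓ m (j + t) u * rotT t := by
    apply PiTensorProduct.ext
    apply MultilinearMap.ext
    intro (f : Fin m → Fin (ℓ + 1) → ℂ)
    simp only [LinearMap.compMultilinearMap_apply, Module.End.mul_apply, slotEnd_tprod, rotT_tprod,
      add_sub_cancel_right]
    congr 1
    funext i
    by_cases hi : i = j + t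
    · subst hi; simp
    · rw [Function.update_of_ne hi, Function.update_of_ne fun h => hi (sub_eq_iff_eq_add.1 h)]
  exact LinearMap.congr_fun this v

theorem rotT_slot (t j : Fin m) (x : SlAlg ℓ) (v : TensorNat ℓ m) :
    rotT t (slot ℓ m j x v) = slot ℓ m (j + t) x (rotT t v) :=
  rotT_slotEnd t j _ v

variable {ζ : ℂˣ}

omit [NeZero m] in
theorem evOp_rootParams (k : ℤ) (x : SlAlg ℓ) (v : TensorNat ℓ m) :
    evOp (rootParams m ζ) k x v = ∑ j : Fin m, ((ζ : ℂ) ^ ((j : ℕ) + 1)) ^ k • slot ℓ m j x v := by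
  simp only [evOp, LinearMap.sum_apply, LinearMap.smul_apply, rootParams,
    Units.val_zpow_eq_zpow_val, Units.val_pow_eq_pow_val]

/-- Rotation commutes with the loop algebra up to a twist, because the evaluation parameters form a
geometric progression. -/
theorem rotT_evOp (hζ : IsPrimitiveRoot (ζ : ℂ) m) (t : Fin m) (k : ℤ) (x : SlAlg ℓ)
    (v : TensorNat ℓ m) : ((ζ : ℂ) ^ (t : ℕ)) ^ k • rotT t (evOp (rootParams m ζ) k x v) =
      evOp (rootParams m ζ) k x (rotT t v) := by
  rw [evOp_rootParams, evOp_rootParams, map_sum, Finset.smul_sum]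
  refine Fintype.sum_equiv (Equiv.addRight t) _ _ fun j => ?_
  rw [map_smul, rotT_slot, smul_smul, ← mul_zpow, Equiv.coe_addRight,
    pow_succ _ ((j + t : Fin m) : ℕ), pow_val_add hζ.pow_eq_one, pow_succ]
  congr 2
  ring

omit [NeZero m] in
theorem evOp_add_mul (hζ : IsPrimitiveRoot (ζ : ℂ) m) (k q : ℤ) (x : SlAlg ℓ) (v : TensorNat ℓ m) :
    evOp (rootParams m ζ) (k + m * q) x v = evOp (rootParams m ζ) k x v := by
  rw [evOp_rootParams, evOp_rootParams]
  refine Finset.sum_congr rfl fun j _ => ?_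
  rw [zpow_add₀ (pow_ne_zero _ ζ.ne_zero), zpow_mul, zpow_natCast, ← pow_mul, mul_comm _ m, pow_mul,
    hζ.pow_eq_one, one_pow, one_zpow, mul_one]

/-- The evaluation parameters being distinct `m`-th roots of unity, the action on a single factor
is recovered by a discrete Fourier transform. -/
theorem slot_eq_sum_evOp (hζ : IsPrimitiveRoot (ζ : ℂ) m) (j : Fin m) (x : SlAlg ℓ)
    (v : TensorNat ℓ m) : slot ℓ m j x v = (1 / m : ℂ) • ∑ k : Fin m,
      ((ζ : ℂ) ^ ((j : ℕ) + 1)) ^ (-(k : ℤ)) • evOp (rootParams m ζ) k x v := by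
  have hm : (m : ℂ) ≠ 0 := by exact_mod_cast NeZero.ne m
  have hz : (ζ : ℂ) ≠ 0 := ζ.ne_zero
  simp only [evOp_rootParams, Finset.smul_sum, smul_smul]
  rw [Finset.sum_comm]
  have h1 : ∀ i : Fin m, ∑ k : Fin m, (1 / m * (((ζ : ℂ) ^ ((j : ℕ) + 1)) ^ (-(k : ℤ)) *
      ((ζ : ℂ) ^ ((i : ℕ) + 1)) ^ (k : ℤ))) = if i = j then 1 else 0 := by
    intro i
    rw [← Finset.mul_sum]
    have h2 : ∀ k : Fin m,
        ((ζ : ℂ) ^ ((j : ℕ) + 1)) ^ (-(k : ℤ)) * ((ζ : ℂ) ^ ((i : ℕ) + 1)) ^ (k : ℤ) = ((ζ : ℂ) ^ (k : ℕ)) ^ ((i : ℤ) - j) := by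
      intro k
      simp only [← zpow_natCast, ← zpow_mul, ← zpow_add₀ hz]
      congr 1
      push_cast
      ring
    simp only [h2, sum_zpow_pow hζ]
    have h3 : (m : ℤ) ∣ (i : ℤ) - j ↔ i = j := by
      constructor
      · intro h
        have h4 := Int.eq_zero_of_abs_lt_dvd h (by rw [abs_lt]; omega)
        exact Fin.ext (by omega)
      · rintro rfl; simp
    simp only [h3]
    split_ifs
    · rw [one_div, inv_mul_cancel₀ hm]
    · rw [mul_zero]
  simp only [← Finset.sum_smul, h1, ite_smul, one_smul, zero_smul, Finset.sum_ite_eq',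
    Finset.mem_univ, if_true]

/-! ### The isotypic projections of the rotation -/

variable (ζ) in
/-- The projection of `V^{⊗m}` onto the vectors that each rotation by `t` multiplies by
`ζ ^ (-q t)`. -/
noncomputable def rotProj (q : ℤ) : Module.End ℂ (TensorNat ℓ m) :=
  (1 / m : ℂ) • ∑ t : Fin m, ((ζ : ℂ) ^ (t : ℕ)) ^ q • rotT t

theorem rotProj_apply (q : ℤ) (v : TensorNat ℓ m) :
    rotProj ζ q v = (1 / m : ℂ) • ∑ t : Fin m, ((ζ : ℂ) ^ (t : ℕ)) ^ q • rotT t v := by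
  simp [rotProj]

theorem rotProj_rotProj (hζ : IsPrimitiveRoot (ζ : ℂ) m) (q q' : ℤ) (v : TensorNat ℓ m) :
    rotProj ζ q (rotProj ζ q' v) = if (m : ℤ) ∣ q' - q then rotProj ζ q v else 0 := by
  have hm : (m : ℂ) ≠ 0 := by exact_mod_cast NeZero.ne m
  have h1 : ∀ s : Fin m, rotT s (rotProj ζ q' v) = (1 / m : ℂ) •
      ∑ u : Fin m, ((ζ : ℂ) ^ ((u - s : Fin m) : ℕ)) ^ q' • rotT u v := by
    intro s
    rw [rotProj_apply, map_smul, map_sum]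
    congr 1
    refine Fintype.sum_equiv (Equiv.addLeft s) _ _ fun t => ?_
    rw [map_smul, rotT_rotT, Equiv.coe_addLeft, add_sub_cancel_left]
  have h2 : ∀ s u : Fin m,
      1 / m * (((ζ : ℂ) ^ (s : ℕ)) ^ q * (1 / m * ((ζ : ℂ) ^ ((u - s : Fin m) : ℕ)) ^ q')) =
      1 / m * (1 / m * (((ζ : ℂ) ^ (u : ℕ)) ^ q *
        ((ζ : ℂ) ^ ((u - s : Fin m) : ℕ)) ^ (q' - q))) := by
    intro s u
    have h3 : (ζ : ℂ) ^ (u : ℕ) = (ζ : ℂ) ^ ((u - s : Fin m) : ℕ) * (ζ : ℂ) ^ (s : ℕ) := by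
      rw [← pow_val_add hζ.pow_eq_one, sub_add_cancel]
    rw [h3, mul_zpow, zpow_sub₀ (pow_ne_zero _ ζ.ne_zero)]
    have h4 : ((ζ : ℂ) ^ ((u - s : Fin m) : ℕ)) ^ q ≠ 0 := zpow_ne_zero _ (pow_ne_zero _ ζ.ne_zero)
    field_simp
  rw [rotProj_apply]
  simp only [h1, Finset.smul_sum, smul_smul, h2]
  rw [Finset.sum_comm]
  have h5 : ∀ u : Fin m, ∑ s : Fin m, (1 / m * (1 / m * (((ζ : ℂ) ^ (u : ℕ)) ^ q *
      ((ζ : ℂ) ^ ((u - s : Fin m) : ℕ)) ^ (q' - q)))) =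
      if (m : ℤ) ∣ q' - q then 1 / m * ((ζ : ℂ) ^ (u : ℕ)) ^ q else 0 := by
    intro u
    have h6 : ∑ s : Fin m, ((ζ : ℂ) ^ ((u - s : Fin m) : ℕ)) ^ (q' - q) =
        ∑ s : Fin m, ((ζ : ℂ) ^ (s : ℕ)) ^ (q' - q) :=
      Fintype.sum_equiv (Equiv.subLeft u) _ _ fun s => rfl
    simp only [← Finset.mul_sum, h6, sum_zpow_pow hζ]
    split_ifs
    · field_simp
    · simp
  simp only [← Finset.sum_smul, h5]
  split_ifs
  · rw [rotProj_apply, Finset.smul_sum]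
    simp only [smul_smul]
  · simp

/-- The loop algebra permutes the isotypic parts of the rotation according to the degree. -/
theorem rotProj_evOp (hζ : IsPrimitiveRoot (ζ : ℂ) m) (q k : ℤ) (x : SlAlg ℓ) (v : TensorNat ℓ m) :
    rotProj ζ (k + q) (evOp (rootParams m ζ) k x v) =
      evOp (rootParams m ζ) k x (rotProj ζ q v) := by
  rw [rotProj_apply, rotProj_apply, map_smul, map_sum]
  congr 1
  refine Finset.sum_congr rfl fun t _ => ?_
  rw [map_smul, ← rotT_evOp hζ, smul_smul, zpow_add₀ (pow_ne_zero _ ζ.ne_zero), mul_comm]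

end TensorPower

/-! ### Graded subspaces of a loop space -/

section LoopSpace

variable {V : Type} [AddCommGroup V] [Module ℂ V]

/-- The coefficients of an element of `V ⊗ ℂ[z, z⁻¹]`. -/
noncomputable def LoopSpace.toFinsupp : LoopSpace V →ₗ[ℂ] (ℤ →₀ V) :=
  LoopSpace.lift fun k => Finsupp.lsingle k

theorem LoopSpace.toFinsupp_mono (k : ℤ) (v : V) :
    LoopSpace.toFinsupp (mono k v) = Finsupp.single k v := by
  rw [toFinsupp, lift_mono, Finsupp.lsingle_apply]

theorem LoopSpace.sum_toFinsupp (f : LoopSpace V) :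
    (LoopSpace.toFinsupp f).sum (fun k v => mono k v) = f := by
  have : (Finsupp.lsum ℂ fun k => (mono k : V →ₗ[ℂ] LoopSpace V)) ∘ₗ LoopSpace.toFinsupp =
      LinearMap.id := by
    apply hom_ext
    intro k v
    simp [toFinsupp_mono]
  exact LinearMap.congr_fun this f

theorem LoopSpace.mono_injective (k : ℤ) : Function.Injective (mono k : V →ₗ[ℂ] LoopSpace V) := by
  intro v w h
  have := congrArg (fun f => LoopSpace.toFinsupp f k) h
  simpa [toFinsupp_mono] using this

theorem LoopSpace.toFinsupp_euler (f : LoopSpace V) (k : ℤ) :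
    LoopSpace.toFinsupp (euler V f) k = (k : ℂ) • LoopSpace.toFinsupp f k := by
  have : Finsupp.lapply k ∘ₗ LoopSpace.toFinsupp ∘ₗ euler V =
      (k : ℂ) • (Finsupp.lapply k ∘ₗ (LoopSpace.toFinsupp : LoopSpace V →ₗ[ℂ] (ℤ →₀ V))) := by
    apply hom_ext
    intro l v
    by_cases h : l = k
    · subst h; simp [euler_mono, toFinsupp_mono]
    · simp [euler_mono, toFinsupp_mono, Finsupp.single_eq_of_ne' h]
  exact LinearMap.congr_fun this f

/-- A subspace stable under the Euler operator is graded. -/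
theorem LoopSpace.mono_toFinsupp_mem {N : Submodule ℂ (LoopSpace V)}
    (hN : ∀ f ∈ N, euler V f ∈ N) {f : LoopSpace V} (hf : f ∈ N) (k : ℤ) :
    mono k (LoopSpace.toFinsupp f k) ∈ N := by
  have key : ∀ (S : Finset ℤ) (v : ℤ → V), ∑ k ∈ S, mono k (v k) ∈ N →
      ∀ k ∈ S, mono k (v k) ∈ N := by
    intro S
    induction S using Finset.induction_on with
    | empty => simp
    | insert l S hl ih =>
      intro v hv
      have h1 : ∑ k ∈ S, mono k (((k : ℂ) - l) • v k) ∈ N := by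
        have h2 := N.sub_mem (hN _ hv) (N.smul_mem (l : ℂ) hv)
        rw [map_sum, Finset.smul_sum, ← Finset.sum_sub_distrib, Finset.sum_insert hl] at h2
        simpa [euler_mono, sub_smul] using h2
      have h3 : ∀ k ∈ S, mono k (v k) ∈ N := by
        intro k hk
        have h4 := ih _ h1 k hk
        rw [map_smul] at h4
        refine (N.smul_mem_iff (sub_ne_zero.2 ?_)).1 h4
        rintro h
        exact hl (by rwa [Int.cast_injective h] at hk)
      intro k hk
      rcases Finset.mem_insert.1 hk with rfl | hk
      · rw [Finset.sum_insert hl] at hv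
        exact (N.add_mem_iff_left (N.sum_mem h3)).1 hv
      · exact h3 k hk
  by_cases hk : k ∈ (LoopSpace.toFinsupp f).support
  · refine key _ _ ?_ k hk
    have := LoopSpace.sum_toFinsupp f
    rw [Finsupp.sum] at this
    rwa [this]
  · rw [Finsupp.notMem_support_iff.1 hk, map_zero]
    exact N.zero_mem

end LoopSpace

/-! ### The loop module and the projections commuting with the affine algebra -/

section LoopModule

variable {ℓ m : ℕ}

/-- The element `w ⊗ z^s` of the loop module. -/
noncomputable def lmono (a : Fin m → ℂˣ) (s : ℤ) : TensorNat ℓ m →ₗ[ℂ] LoopModule ℓ a :=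
  (LoopModule.toLoopSpace a).symm.toLinearMap ∘ₗ mono s

theorem toLoopSpace_lmono (a : Fin m → ℂˣ) (s : ℤ) (w : TensorNat ℓ m) :
    LoopModule.toLoopSpace a (lmono a s w) = mono s w := rfl

theorem lmono_hom_ext {a : Fin m → ℂˣ} {M : Type*} [AddCommMonoid M] [Module ℂ M]
    {f g : LoopModule ℓ a →ₗ[ℂ] M} (h : ∀ s w, f (lmono a s w) = g (lmono a s w)) : f = g :=
  LoopSpace.hom_ext (V := TensorNat ℓ m) h

theorem lmono_injective (a : Fin m → ℂˣ) (s : ℤ) :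
    Function.Injective (lmono a s : TensorNat ℓ m →ₗ[ℂ] LoopModule ℓ a) :=
  LoopSpace.mono_injective s

theorem ofLoop_lie_lmono (a : Fin m → ℂˣ) (k s : ℤ) (x : SlAlg ℓ) (w : TensorNat ℓ m) :
    ⁅ofLoop (mono k x), lmono a s w⁆ = lmono a (k + s) (evOp a k x w) := by
  rw [LoopModule.lie_def, toLoopSpace_lmono]
  simp only [ofLoop, loopAct_mono, zero_smul, add_zero]
  rfl

theorem elemD_lie (a : Fin m → ℂˣ) (f : LoopModule ℓ a) :
    ⁅elemD ℓ, f⁆ = (LoopModule.toLoopSpace a).symm (euler _ (LoopModule.toLoopSpace a f)) := by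
  rw [LoopModule.lie_def]
  simp [elemD]

theorem elemD_lie_lmono (a : Fin m → ℂˣ) (s : ℤ) (w : TensorNat ℓ m) :
    ⁅elemD ℓ, lmono a s w⁆ = (s : ℂ) • lmono a s w := by
  rw [elemD_lie, toLoopSpace_lmono, euler_mono]
  rfl

theorem elemK_lie (a : Fin m → ℂˣ) (f : LoopModule ℓ a) : ⁅elemK ℓ, f⁆ = 0 := by
  rw [LoopModule.lie_def]
  simp [elemK]

variable [NeZero m] {ζ : ℂˣ}

variable (ℓ m ζ) in
/-- The projection of the loop module that acts on `w ⊗ z^s` by the projection of `w` onto the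
vectors that each rotation by `t` multiplies by `ζ ^ ((n - s) t)`. -/
noncomputable def loopProj (n : ℤ) :
    LoopModule ℓ (rootParams m ζ) →ₗ[ℂ] LoopModule ℓ (rootParams m ζ) :=
  LoopSpace.lift (V := TensorNat ℓ m) fun s => lmono (rootParams m ζ) s ∘ₗ rotProj ζ (s - n)

theorem loopProj_lmono (n s : ℤ) (w : TensorNat ℓ m) :
    loopProj ℓ m ζ n (lmono _ s w) = lmono _ s (rotProj ζ (s - n) w) :=
  LoopSpace.lift_mono (V := TensorNat ℓ m)
    (fun s => lmono (rootParams m ζ) s ∘ₗ rotProj ζ (s - n)) s w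

theorem loopProj_loopProj (hζ : IsPrimitiveRoot (ζ : ℂ) m) (n : ℤ)
    (f : LoopModule ℓ (rootParams m ζ)) :
    loopProj ℓ m ζ n (loopProj ℓ m ζ n f) = loopProj ℓ m ζ n f := by
  have : loopProj ℓ m ζ n ∘ₗ loopProj ℓ m ζ n = loopProj ℓ m ζ n := by
    apply lmono_hom_ext
    intro s w
    rw [LinearMap.comp_apply, loopProj_lmono, loopProj_lmono, rotProj_rotProj hζ, if_pos (by simp)]
  exact LinearMap.congr_fun this f

theorem loopProj_lie (hζ : IsPrimitiveRoot (ζ : ℂ) m) (n : ℤ) (x : AffineSl ℓ)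
    (f : LoopModule ℓ (rootParams m ζ)) :
    loopProj ℓ m ζ n ⁅x, f⁆ = ⁅x, loopProj ℓ m ζ n f⁆ := by
  let P : Module.End ℂ (LoopModule ℓ (rootParams m ζ)) := loopProj ℓ m ζ n
  let F : LoopSl ℓ →ₗ[ℂ] Module.End ℂ (LoopModule ℓ (rootParams m ζ)) :=
    (LieModule.toEnd ℂ (AffineSl ℓ) (LoopModule ℓ (rootParams m ζ)) :
      AffineSl ℓ →ₗ[ℂ] Module.End ℂ (LoopModule ℓ (rootParams m ζ))) ∘ₗ
    { toFun := ofLoop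
      map_add' := fun x y => by ext1 <;> simp [ofLoop]
      map_smul' := fun c x => by ext1 <;> simp [ofLoop] }
  have h1 : ∀ g : LoopSl ℓ, loopProj ℓ m ζ n ⁅ofLoop g, f⁆ = ⁅ofLoop g, loopProj ℓ m ζ n f⁆ := by
    intro g
    have h2 : LinearMap.mulLeft ℂ P ∘ₗ F = LinearMap.mulRight ℂ P ∘ₗ F := by
      apply hom_ext
      intro k x
      apply lmono_hom_ext
      intro s w
      change loopProj ℓ m ζ n ⁅ofLoop (mono k x), lmono _ s w⁆ =
        ⁅ofLoop (mono k x), loopProj ℓ m ζ n (lmono _ s w)⁆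
      rw [loopProj_lmono, ofLoop_lie_lmono, ofLoop_lie_lmono, loopProj_lmono, ← rotProj_evOp hζ,
        add_sub_assoc]
    exact LinearMap.congr_fun (LinearMap.congr_fun h2 g) f
  have h3 : loopProj ℓ m ζ n ⁅elemD ℓ, f⁆ = ⁅elemD ℓ, loopProj ℓ m ζ n f⁆ := by
    have h4 : loopProj ℓ m ζ n ∘ₗ LieModule.toEnd ℂ (AffineSl ℓ) _ (elemD ℓ) =
        LieModule.toEnd ℂ (AffineSl ℓ) _ (elemD ℓ) ∘ₗ loopProj ℓ m ζ n := by
      apply lmono_hom_ext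
      intro s w
      simp only [LinearMap.comp_apply, LieModule.toEnd_apply_apply, elemD_lie_lmono, map_smul,
        loopProj_lmono]
    exact LinearMap.congr_fun h4 f
  have h5 : x = ofLoop x.loop + x.c • elemK ℓ + x.d • elemD ℓ := by
    ext1 <;> simp [ofLoop, elemK, elemD]
  rw [h5]
  simp only [add_lie, smul_lie, map_add, map_smul, h1, h3, elemK_lie, map_zero]

variable (ℓ) in
/-- The image of the projection, as a submodule over the affine Lie algebra. -/
noncomputable def rotIsotypic (hζ : IsPrimitiveRoot (ζ : ℂ) m) (n : ℤ) :
    LieSubmodule ℂ (AffineSl ℓ) (LoopModule ℓ (rootParams m ζ)) where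
  __ := LinearMap.eqLocus (loopProj ℓ m ζ n) LinearMap.id
  lie_mem := by
    intro x f hf
    change loopProj ℓ m ζ n f = f at hf
    change loopProj ℓ m ζ n ⁅x, f⁆ = ⁅x, f⁆
    rw [loopProj_lie hζ, hf]

theorem mem_rotIsotypic (hζ : IsPrimitiveRoot (ζ : ℂ) m) (n : ℤ)
    (f : LoopModule ℓ (rootParams m ζ)) :
    f ∈ rotIsotypic ℓ hζ n ↔ loopProj ℓ m ζ n f = f := Iff.rfl

theorem loopProj_mem (hζ : IsPrimitiveRoot (ζ : ℂ) m) (n : ℤ)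
    (f : LoopModule ℓ (rootParams m ζ)) : loopProj ℓ m ζ n f ∈ rotIsotypic ℓ hζ n :=
  loopProj_loopProj hζ n f

theorem lmono_mem_rotIsotypic (hζ : IsPrimitiveRoot (ζ : ℂ) m) (n s : ℤ) (w : TensorNat ℓ m) :
    lmono _ s w ∈ rotIsotypic ℓ hζ n ↔ rotProj ζ (s - n) w = w := by
  rw [mem_rotIsotypic, loopProj_lmono, (lmono_injective _ s).eq_iff]

/-! ### Simplicity -/

/-- The component of degree `t` of a submodule of the loop module, as a subspace of `V^{⊗m}`. -/
noncomputable def gradedPart {a : Fin m → ℂˣ} (N : LieSubmodule ℂ (AffineSl ℓ) (LoopModule ℓ a))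
    (t : ℤ) : Submodule ℂ (TensorNat ℓ m) :=
  N.toSubmodule.comap (lmono a t)

omit [NeZero m] in
theorem mem_gradedPart {a : Fin m → ℂˣ} {N : LieSubmodule ℂ (AffineSl ℓ) (LoopModule ℓ a)} {t : ℤ}
    {w : TensorNat ℓ m} : w ∈ gradedPart N t ↔ lmono a t w ∈ N := Iff.rfl

omit [NeZero m] in
theorem evOp_mem_gradedPart {a : Fin m → ℂˣ} {N : LieSubmodule ℂ (AffineSl ℓ) (LoopModule ℓ a)}
    {t : ℤ} {w : TensorNat ℓ m} (hw : w ∈ gradedPart N t) (k : ℤ) (x : SlAlg ℓ) :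
    evOp a k x w ∈ gradedPart N (k + t) := by
  rw [mem_gradedPart, ← ofLoop_lie_lmono]
  exact N.lie_mem hw

omit [NeZero m] in
theorem exists_gradedPart_ne_bot {a : Fin m → ℂˣ} {N : LieSubmodule ℂ (AffineSl ℓ) (LoopModule ℓ a)}
    (hN : N ≠ ⊥) : ∃ t, gradedPart N t ≠ ⊥ := by
  obtain ⟨f, hf, hf0⟩ := (Submodule.ne_bot_iff _).1 fun h =>
    hN ((LieSubmodule.toSubmodule_eq_bot N).1 h)
  by_contra! h
  have hD : ∀ g ∈ (N.toSubmodule : Submodule ℂ (LoopSpace (TensorNat ℓ m))),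
      euler _ g ∈ (N.toSubmodule : Submodule ℂ (LoopSpace (TensorNat ℓ m))) := by
    intro g hg
    have := N.lie_mem (x := elemD ℓ) hg
    rwa [elemD_lie] at this
  have h1 : ∀ k, LoopSpace.toFinsupp (LoopModule.toLoopSpace a f) k = 0 := by
    intro k
    have h2 : LoopSpace.toFinsupp (LoopModule.toLoopSpace a f) k ∈ gradedPart N k :=
      LoopSpace.mono_toFinsupp_mem hD hf k
    rwa [h k, Submodule.mem_bot] at h2
  apply hf0
  have h3 := LoopSpace.sum_toFinsupp (LoopModule.toLoopSpace a f)
  rw [Finsupp.ext (g := 0) h1, Finsupp.sum_zero_index] at h3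
  exact h3.symm

/-- The operators of degree `k` and `k + m` agreeing, the sum of `m` consecutive components of a
submodule is stable under all of them, hence under the action on each single factor. -/
theorem slot_mem_iSup_gradedPart (hζ : IsPrimitiveRoot (ζ : ℂ) m)
    (N : LieSubmodule ℂ (AffineSl ℓ) (LoopModule ℓ (rootParams m ζ))) (t : ℤ) (j : Fin m)
    (x : SlAlg ℓ) {w : TensorNat ℓ m} (hw : w ∈ ⨆ i : Fin m, gradedPart N (t + (i : ℕ))) :
    slot ℓ m j x w ∈ ⨆ i : Fin m, gradedPart N (t + (i : ℕ)) := by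
  rw [slot_eq_sum_evOp hζ]
  refine Submodule.smul_mem _ _ (Submodule.sum_mem _ fun k _ => Submodule.smul_mem _ _ ?_)
  induction hw using Submodule.iSup_induction' with
  | zero => rw [map_zero]; exact Submodule.zero_mem _
  | add u v _ _ hu hv => rw [map_add]; exact Submodule.add_mem _ hu hv
  | mem i w hw =>
    have h1 : evOp (rootParams m ζ) k x w =
        evOp (rootParams m ζ) ((k : ℤ) + m * (-(((i : ℕ) + k : ℕ) / m : ℕ))) x w :=
      (evOp_add_mul hζ _ _ _ _).symm
    have h2 : (k : ℤ) + m * (-(((i : ℕ) + k : ℕ) / m : ℕ)) + (t + (i : ℕ)) =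
        t + ((⟨((i : ℕ) + k) % m, Nat.mod_lt _ (NeZero.pos m)⟩ : Fin m) : ℕ) := by
      have := Nat.mod_add_div ((i : ℕ) + k) m
      have h3 : (((i : ℕ) + k : ℕ) : ℤ) =
          (((i : ℕ) + k) % m : ℕ) + m * (((i : ℕ) + k) / m : ℕ) := by
        exact_mod_cast this.symm
      push_cast at h3 ⊢
      linarith
    have h4 := evOp_mem_gradedPart hw ((k : ℤ) + m * (-(((i : ℕ) + k : ℕ) / m : ℕ))) x
    rw [h2, ← h1] at h4
    exact Submodule.mem_iSup_of_mem _ h4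

/-- No non-zero vector is killed by all copies of `sl_{ℓ+1}`. -/
theorem exists_slot_ne_zero [NeZero ℓ] {w : TensorNat ℓ m} (hw : w ≠ 0) :
    ∃ j x, slot ℓ m j x w ≠ 0 := by
  by_contra! h
  let W : Submodule ℂ (TensorNat ℓ m) := ⨅ j, ⨅ x, LinearMap.ker (slot ℓ m j x)
  have hW : ∀ v, v ∈ W ↔ ∀ j x, slot ℓ m j x v = 0 := fun v => by
    simp [W, Submodule.mem_iInf]
  have hwW : w ∈ W := (hW w).2 h
  rcases eq_bot_or_eq_top_of_slot_mem W fun j x v hv => by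
    rw [(hW v).1 hv]; exact W.zero_mem with h1 | h1
  · rw [h1] at hwW
    exact hw hwW
  · have h2 : wordVec (fun _ => 0) ∈ W := h1 ▸ Submodule.mem_top
    have h3 := (hW _).1 h2 0 (matUnit ℓ (0 - 1) 0 (sub_one_ne ℓ 0))
    rw [slot_matUnit, slotEnd_unitEnd_wordVec, if_pos rfl, ← wordBasis_apply] at h3
    exact (wordBasis ℓ m).ne_zero _ h3

theorem iSup_gradedPart_eq_top [NeZero ℓ] (hζ : IsPrimitiveRoot (ζ : ℂ) m)
    {N : LieSubmodule ℂ (AffineSl ℓ) (LoopModule ℓ (rootParams m ζ))} (hN : N ≠ ⊥) (t : ℤ) :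
    ⨆ i : Fin m, gradedPart N (t + (i : ℕ)) = ⊤ := by
  refine (eq_bot_or_eq_top_of_slot_mem _ fun j x w hw =>
    slot_mem_iSup_gradedPart hζ N t j x hw).resolve_left fun hbot => ?_
  obtain ⟨s, hs⟩ := exists_gradedPart_ne_bot hN
  obtain ⟨w, hw, hw0⟩ := (Submodule.ne_bot_iff _).1 hs
  obtain ⟨j, x, hjx⟩ := exists_slot_ne_zero hw0
  apply hjx
  rw [slot_eq_sum_evOp hζ]
  refine (congrArg _ (Finset.sum_eq_zero fun k _ => ?_)).trans (smul_zero _)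
  -- The degree is moved into the window `t, …, t + m - 1` by a multiple of `m`.
  have h1 : evOp (rootParams m ζ) k x w =
      evOp (rootParams m ζ) ((k : ℤ) + m * (-(((k : ℤ) + s - t) / m))) x w :=
    (evOp_add_mul hζ _ _ _ _).symm
  have hm : (m : ℤ) ≠ 0 := by exact_mod_cast NeZero.ne m
  have h2 := Int.emod_nonneg ((k : ℤ) + s - t) hm
  have h3 := Int.emod_lt_of_pos ((k : ℤ) + s - t) (by exact_mod_cast NeZero.pos m : (0 : ℤ) < m)
  have h4 : (k : ℤ) + m * (-(((k : ℤ) + s - t) / m)) + s =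
      t + ((⟨(((k : ℤ) + s - t) % m).toNat, by omega⟩ : Fin m) : ℕ) := by
    have h5 := Int.emod_add_mul_ediv ((k : ℤ) + s - t) m
    simp only [Int.toNat_of_nonneg h2]
    linarith
  have h6 := evOp_mem_gradedPart hw ((k : ℤ) + m * (-(((k : ℤ) + s - t) / m))) x
  rw [h4, ← h1] at h6
  have h7 := Submodule.mem_iSup_of_mem (p := fun i : Fin m => gradedPart N (t + (i : ℕ))) _ h6
  rw [hbot, Submodule.mem_bot] at h7
  rw [h7, smul_zero]

/-- A non-zero submodule of the isotypic part is the whole isotypic part: `m` consecutive components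
span `V^{⊗m}`, and they lie in distinct eigenspaces of the rotation. -/
theorem rotIsotypic_le [NeZero ℓ] (hζ : IsPrimitiveRoot (ζ : ℂ) m) (n : ℤ)
    {N : LieSubmodule ℂ (AffineSl ℓ) (LoopModule ℓ (rootParams m ζ))} (hN : N ≠ ⊥)
    (hle : N ≤ rotIsotypic ℓ hζ n) : rotIsotypic ℓ hζ n ≤ N := by
  -- Of the components of degrees `t, …, t + m - 1`, the projection keeps the one of degree `t`
  -- and kills the others.
  have h1 : ∀ (t : ℤ) (w : TensorNat ℓ m), rotProj ζ (t - n) w ∈ gradedPart N t := by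
    intro t w
    have hw : w ∈ ⨆ i : Fin m, gradedPart N (t + (i : ℕ)) :=
      iSup_gradedPart_eq_top hζ hN t ▸ Submodule.mem_top
    induction hw using Submodule.iSup_induction' with
    | zero => rw [map_zero]; exact Submodule.zero_mem _
    | add u v _ _ hu hv => rw [map_add]; exact Submodule.add_mem _ hu hv
    | mem i w hw =>
      have h2 := (lmono_mem_rotIsotypic hζ n _ w).1 (hle hw)
      have h3 : (m : ℤ) ∣ t + (i : ℕ) - n - (t - n) ↔ i = 0 := by
        constructor
        · intro h
          have h4 := Int.eq_zero_of_abs_lt_dvd h (by rw [abs_lt]; omega)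
          exact Fin.ext (by rw [Fin.val_zero]; omega)
        · rintro rfl; simp
      rw [← h2, rotProj_rotProj hζ]
      split_ifs with h
      · obtain rfl := h3.1 h
        rw [Fin.val_zero, Nat.cast_zero, add_zero] at hw h2
        rwa [h2]
      · exact Submodule.zero_mem _
  have h2 : N.toSubmodule.mkQ ∘ₗ loopProj ℓ m ζ n = 0 := by
    apply lmono_hom_ext
    intro s w
    rw [LinearMap.comp_apply, loopProj_lmono, LinearMap.zero_apply, Submodule.mkQ_apply,
      Submodule.Quotient.mk_eq_zero]
    exact h1 s w
  intro f hf
  have h3 := LinearMap.congr_fun h2 f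
  rw [LinearMap.comp_apply, (mem_rotIsotypic hζ n f).1 hf, LinearMap.zero_apply,
    Submodule.mkQ_apply, Submodule.Quotient.mk_eq_zero] at h3
  exact h3

omit [NeZero m] in
theorem moduleGen_eq (n : ℤ) :
    moduleGen ℓ m ζ n = lmono (rootParams m ζ) n (wordVec fun _ => 0) := rfl

theorem moduleGen_mem (hζ : IsPrimitiveRoot (ζ : ℂ) m) (n : ℤ) :
    moduleGen ℓ m ζ n ∈ rotIsotypic ℓ hζ n := by
  have hm : (m : ℂ) ≠ 0 := by exact_mod_cast NeZero.ne m
  have h : ∀ t : Fin m, (rotate t).symm (fun _ : Fin m => (0 : Fin (ℓ + 1))) = fun _ => 0 :=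
    fun t => rfl
  rw [moduleGen_eq, lmono_mem_rotIsotypic, rotProj_apply]
  simp only [rotT_wordVec, sub_self, zpow_zero, one_smul, h]
  rw [Finset.sum_const, Finset.card_univ, Fintype.card_fin, ← Nat.cast_smul_eq_nsmul ℂ, smul_smul,
    one_div, inv_mul_cancel₀ hm]
  exact one_smul _ _

omit [NeZero m] in
theorem levelZeroModule_ne_bot (n : ℤ) : levelZeroModule ℓ m ζ n ≠ ⊥ := by
  intro h
  have h1 : moduleGen ℓ m ζ n ∈ levelZeroModule ℓ m ζ n := LieSubmodule.subset_lieSpan rfl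
  rw [h, LieSubmodule.mem_bot, moduleGen_eq] at h1
  have h2 : wordVec (fun _ => 0) = (0 : TensorNat ℓ m) :=
    lmono_injective (rootParams m ζ) n (h1.trans (map_zero _).symm)
  rw [← wordBasis_apply] at h2
  exact (wordBasis ℓ m).ne_zero _ h2

theorem levelZeroModule_eq [NeZero ℓ] (hζ : IsPrimitiveRoot (ζ : ℂ) m) (n : ℤ) :
    levelZeroModule ℓ m ζ n = rotIsotypic ℓ hζ n := by
  have hle : levelZeroModule ℓ m ζ n ≤ rotIsotypic ℓ hζ n :=
    LieSubmodule.lieSpan_le.2 (Set.singleton_subset_iff.2 (moduleGen_mem hζ n))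
  exact le_antisymm hle (rotIsotypic_le hζ n (levelZeroModule_ne_bot n) hle)

theorem levelZeroModule_isIrreducible [NeZero ℓ] (hζ : IsPrimitiveRoot (ζ : ℂ) m) (n : ℤ) :
    LieModule.IsIrreducible ℂ (AffineSl ℓ) (levelZeroModule ℓ m ζ n) := by
  have hnt : Nontrivial (levelZeroModule ℓ m ζ n) :=
    (LieSubmodule.nontrivial_iff_ne_bot ..).2 (levelZeroModule_ne_bot n)
  refine LieModule.IsIrreducible.mk fun N hN => ?_
  -- A submodule of `L(ℓ, m; n)` is also a submodule of the loop module.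
  have h1 : N.map (levelZeroModule ℓ m ζ n).incl ≠ ⊥ := by
    rw [Ne, LieSubmodule.eq_bot_iff] at hN ⊢
    refine fun h => hN fun y hy => Subtype.ext ?_
    exact h _ (LieSubmodule.mem_map_of_mem hy)
  have h2 := rotIsotypic_le hζ n h1 (LieSubmodule.map_incl_le.trans (levelZeroModule_eq hζ n).le)
  rw [← levelZeroModule_eq hζ n] at h2
  rw [eq_top_iff]
  intro x _
  obtain ⟨y, hy, hyx⟩ := (LieSubmodule.mem_map _).1 (h2 x.2)
  obtain rfl : y = x := Subtype.ext hyx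
  exact hy

end LoopModule

/-! ### Weights of words -/

section Weights

variable {ℓ m : ℕ}

/-- The weight of a word, the sum of the weights `Λ_{i+1} - Λ_i` of its letters `i`. -/
def wordWeight (w : Fin m → Fin (ℓ + 1)) : FiniteWeight ℓ :=
  ∑ j, (fundWeight ℓ (w j + 1) - fundWeight ℓ (w j))

theorem wordWeight_eq_tupleWeight (w : Fin m → Fin (ℓ + 1)) :
    wordWeight w = tupleWeight (content w) := by
  simp only [tupleWeight, content, Finsupp.finsetSum_apply, Nat.cast_sum, Finset.sum_smul]
  rw [Finset.sum_comm]
  refine Finset.sum_congr rfl fun j _ => ?_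
  rw [Finset.sum_eq_single (w j)]
  · simp
  · intro i _ hi
    simp [Finsupp.single_eq_of_ne hi]
  · simp

theorem sum_content (w : Fin m → Fin (ℓ + 1)) : ∑ i, content w i = m := by
  simp only [content, Finsupp.finsetSum_apply]
  rw [Finset.sum_comm]
  simp [Finsupp.single_apply]

/-- Since `α_{i+1}^∨` takes the value `k_i - k_{i+1}`, the weight determines the tuple up to a
constant, which is determined by the sum. -/
theorem tupleWeight_injOn {k k' : Fin (ℓ + 1) → ℕ} (hk : ∑ i, k i = m) (hk' : ∑ i, k' i = m)
    (h : tupleWeight k = tupleWeight k') : k = k' := by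
  have h1 : ∀ (k : Fin (ℓ + 1) → ℕ) (i : Fin (ℓ + 1)),
      tupleWeight k (i + 1) = (k i : ℤ) - k (i + 1) := by
    intro k i
    simp only [tupleWeight, fundWeight, Finset.sum_apply, Pi.smul_apply, Pi.sub_apply,
      Pi.single_apply, smul_eq_mul, mul_sub, Finset.sum_sub_distrib, add_left_inj]
    simp
  have h2 : ∀ i, (k i : ℤ) - k' i = k 0 - k' 0 := by
    refine eq_const_of_forall_succ (b := fun i => (k i : ℤ) - k' i) fun i => ?_
    have h3 := congrFun h (i + 1)
    rw [h1, h1] at h3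
    linarith
  have h3 : ∑ i, ((k i : ℤ) - k' i) = 0 := by
    rw [Finset.sum_sub_distrib]
    exact sub_eq_zero.2 (by exact_mod_cast hk.trans hk'.symm)
  simp only [h2, Finset.sum_const, Finset.card_univ, Fintype.card_fin, nsmul_eq_mul] at h3
  have h4 := (mul_eq_zero.1 h3).resolve_left (by positivity)
  funext i
  have h5 := h2 i
  omega

theorem wordWeight_eq_iff {κ : Fin (ℓ + 1) →₀ ℕ} (hκ : ∑ i, κ i = m) (w : Fin m → Fin (ℓ + 1)) :
    wordWeight w = tupleWeight κ ↔ content w = κ := by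
  rw [wordWeight_eq_tupleWeight]
  refine ⟨fun h => DFunLike.coe_injective (tupleWeight_injOn (sum_content w) hκ h), ?_⟩
  rintro rfl
  rfl

theorem wordWeight_apply (w : Fin m → Fin (ℓ + 1)) (i : Fin (ℓ + 1)) :
    wordWeight w i = ∑ j, ((if w j = i - 1 then 1 else 0) - (if w j = i then 1 else 0)) := by
  simp only [wordWeight, fundWeight, Finset.sum_apply, Pi.sub_apply, Pi.single_apply]
  refine Finset.sum_congr rfl fun j _ => ?_
  simp only [eq_comm (a := i), eq_sub_iff_add_eq]

theorem wordWeight_rotate_symm [NeZero m] (t : Fin m) (w : Fin m → Fin (ℓ + 1)) :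
    wordWeight ((rotate t).symm w) = wordWeight w := by
  obtain ⟨b, rfl⟩ := (rotate t).surjective w
  rw [Equiv.symm_apply_apply]
  exact (Fintype.sum_equiv (Equiv.addRight t) _ _ fun j => rfl).symm

/-! ### Weight spaces of the loop module -/

theorem lmono_wordVec_hom_ext {a : Fin m → ℂˣ} {M : Type*} [AddCommMonoid M] [Module ℂ M]
    {f g : LoopModule ℓ a →ₗ[ℂ] M}
    (h : ∀ s w, f (lmono a s (wordVec w)) = g (lmono a s (wordVec w))) :
    f = g := by
  refine lmono_hom_ext fun s => ?_
  refine LinearMap.congr_fun (f := f ∘ₗ lmono a s) (g := g ∘ₗ lmono a s)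
    ((wordBasis ℓ m).ext fun w => ?_)
  rw [wordBasis_apply]
  exact h s w

/-- The projection of `V^{⊗m}` onto its weight space of weight `ν`. -/
noncomputable def wordProj (m : ℕ) (ν : FiniteWeight ℓ) : Module.End ℂ (TensorNat ℓ m) :=
  (wordBasis ℓ m).constr ℂ fun w => if wordWeight w = ν then wordVec w else 0

theorem wordProj_wordVec (ν : FiniteWeight ℓ) (w : Fin m → Fin (ℓ + 1)) :
    wordProj m ν (wordVec w) = if wordWeight w = ν then wordVec w else 0 := by
  rw [← wordBasis_apply, wordProj, Module.Basis.constr_basis, wordBasis_apply]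

theorem repr_wordProj (ν : FiniteWeight ℓ) (x : TensorNat ℓ m) (w : Fin m → Fin (ℓ + 1)) :
    (wordBasis ℓ m).repr (wordProj m ν x) w =
      if wordWeight w = ν then (wordBasis ℓ m).repr x w else 0 := by
  have : (wordBasis ℓ m).coord w ∘ₗ wordProj m ν =
      (if wordWeight w = ν then (1 : ℂ) else 0) • (wordBasis ℓ m).coord w := by
    refine (wordBasis ℓ m).ext fun u => ?_
    rw [wordBasis_apply, LinearMap.comp_apply, wordProj_wordVec, ← wordBasis_apply]
    by_cases h : u = w
    · subst h
      split_ifs <;> simp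
    · split_ifs <;> simp [Finsupp.single_eq_of_ne' h]
  refine (LinearMap.congr_fun this x).trans ?_
  split_ifs
  · exact one_mul _
  · exact zero_mul _

theorem wordProj_wordProj (ν ν' : FiniteWeight ℓ) (x : TensorNat ℓ m) :
    wordProj m ν (wordProj m ν' x) = if ν' = ν then wordProj m ν x else 0 := by
  refine (wordBasis ℓ m).ext_elem fun w => ?_
  by_cases h : ν' = ν
  · subst h
    simp only [repr_wordProj, if_true]
    split_ifs <;> rfl
  · simp only [repr_wordProj, if_neg h, map_zero, Finsupp.zero_apply]
    split_ifs with h1 h2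
    · exact absurd (h2.symm.trans h1) h
    · rfl
    · rfl

/-- The action of the coroot `α_i^∨` on `V^{⊗m}`; the central element contained in `α_0^∨` acts by
zero. -/
noncomputable def corootOp (m : ℕ) (i : Fin (ℓ + 1)) : Module.End ℂ (TensorNat ℓ m) :=
  ∑ j, slot ℓ m j (LieAlgebra.SpecialLinear.singleSubSingle (i - 1) i (1 : ℂ))

theorem corootOp_wordVec (i : Fin (ℓ + 1)) (w : Fin m → Fin (ℓ + 1)) :
    corootOp m i (wordVec w) = (wordWeight w i : ℂ) • wordVec w := by
  simp only [corootOp, LinearMap.sum_apply, slot_singleSubSingle_wordVec, wordWeight_apply]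
  rw [← Finset.sum_smul]
  congr 1
  push_cast
  rfl

theorem repr_corootOp (i : Fin (ℓ + 1)) (x : TensorNat ℓ m) (w : Fin m → Fin (ℓ + 1)) :
    (wordBasis ℓ m).repr (corootOp m i x) w = wordWeight w i * (wordBasis ℓ m).repr x w := by
  have : (wordBasis ℓ m).coord w ∘ₗ corootOp m i =
      (wordWeight w i : ℂ) • (wordBasis ℓ m).coord w := by
    refine (wordBasis ℓ m).ext fun u => ?_
    rw [wordBasis_apply, LinearMap.comp_apply, corootOp_wordVec, ← wordBasis_apply]
    by_cases h : u = w
    · subst h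
      simp
    · simp [Finsupp.single_eq_of_ne' h]
  exact LinearMap.congr_fun this x

theorem corootOp_eq_smul_iff (ν : FiniteWeight ℓ) (x : TensorNat ℓ m) :
    (∀ i, corootOp m i x = (ν i : ℂ) • x) ↔ wordProj m ν x = x := by
  constructor
  · intro h
    refine (wordBasis ℓ m).ext_elem fun w => ?_
    rw [repr_wordProj]
    split_ifs with hw
    · rfl
    · obtain ⟨i, hi⟩ := Function.ne_iff.1 hw
      have h1 := repr_corootOp i x w
      rw [h, map_smul, Finsupp.smul_apply, smul_eq_mul] at h1
      by_contra h2
      exact hi (Int.cast_injective (mul_right_cancel₀ (Ne.symm h2) h1)).symm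
  · intro h i
    refine (wordBasis ℓ m).ext_elem fun w => ?_
    rw [repr_corootOp, map_smul, Finsupp.smul_apply, smul_eq_mul, ← h, repr_wordProj]
    split_ifs with hw
    · rw [hw]
    · simp

theorem corootElem_lie_lmono (a : Fin m → ℂˣ) (i : Fin (ℓ + 1)) (s : ℤ) (x : TensorNat ℓ m) :
    ⁅corootElem ℓ i, lmono a s x⁆ = lmono a s (corootOp m i x) := by
  rw [corootElem, add_lie, smul_lie, elemK_lie, smul_zero, add_zero, ofLoop_lie_lmono, zero_add]
  congr 1
  simp [evOp, corootOp]

/-- The coefficient of `z^s` of an element of the loop module. -/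
noncomputable def lcoeff (a : Fin m → ℂˣ) (s : ℤ) : LoopModule ℓ a →ₗ[ℂ] TensorNat ℓ m :=
  Finsupp.lapply s ∘ₗ LoopSpace.toFinsupp ∘ₗ (LoopModule.toLoopSpace a).toLinearMap

theorem lcoeff_lmono (a : Fin m → ℂˣ) (s t : ℤ) (x : TensorNat ℓ m) :
    lcoeff a s (lmono a t x) = if t = s then x else 0 := by
  change LoopSpace.toFinsupp (mono t x) s = _
  rw [LoopSpace.toFinsupp_mono, Finsupp.single_apply]

theorem exists_eq_lmono {a : Fin m → ℂˣ} {f : LoopModule ℓ a} {r : ℤ}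
    (h : ⁅elemD ℓ, f⁆ = (r : ℂ) • f) : ∃ x, f = lmono a r x := by
  have h1 : ∀ s, s ≠ r → LoopSpace.toFinsupp (LoopModule.toLoopSpace a f) s = 0 := by
    intro s hs
    have h2 := LoopSpace.toFinsupp_euler (LoopModule.toLoopSpace a f) s
    have h3 : euler _ (LoopModule.toLoopSpace a f) = (r : ℂ) • LoopModule.toLoopSpace a f := by
      rw [elemD_lie] at h
      exact h
    rw [h3, map_smul, Finsupp.smul_apply, ← sub_eq_zero, ← sub_smul] at h2
    refine (smul_eq_zero.1 h2).resolve_left (sub_ne_zero.2 fun h4 => hs ?_)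
    exact (Int.cast_injective h4).symm
  refine ⟨LoopSpace.toFinsupp (LoopModule.toLoopSpace a f) r, ?_⟩
  have h4 := LoopSpace.sum_toFinsupp (LoopModule.toLoopSpace a f)
  rw [Finsupp.sum_of_support_subset (s := {r}) _ ?_ _ (by simp), Finset.sum_singleton] at h4
  · exact h4.symm
  · intro s hs
    rw [Finset.mem_singleton]
    by_contra hsr
    exact (Finsupp.mem_support_iff.1 hs) (h1 s hsr)

theorem lmono_mem_weightSpace_iff (a : Fin m → ℂˣ) (μ : AffineWeight ℓ) (x : TensorNat ℓ m) :
    lmono a μ.2 x ∈ weightSpace ℓ (LoopModule ℓ a) μ ↔ wordProj m μ.1 x = x := by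
  rw [← corootOp_eq_smul_iff]
  constructor
  · rintro ⟨h, -⟩ i
    apply lmono_injective a μ.2
    rw [← corootElem_lie_lmono, h, map_smul]
  · intro h
    exact ⟨fun i => by rw [corootElem_lie_lmono, h, map_smul], elemD_lie_lmono a _ x⟩

theorem mem_weightSpace_iff (a : Fin m → ℂˣ) (μ : AffineWeight ℓ) (f : LoopModule ℓ a) :
    f ∈ weightSpace ℓ (LoopModule ℓ a) μ ↔ ∃ x, wordProj m μ.1 x = x ∧ lmono a μ.2 x = f := by
  constructor
  · intro h
    obtain ⟨x, rfl⟩ := exists_eq_lmono h.2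
    exact ⟨x, (lmono_mem_weightSpace_iff a μ x).1 h, rfl⟩
  · rintro ⟨x, hx, rfl⟩
    exact (lmono_mem_weightSpace_iff a μ x).2 hx

/-- The projection of the loop module onto its weight space of weight `μ`. -/
noncomputable def weightProj (a : Fin m → ℂˣ) (μ : AffineWeight ℓ) :
    LoopModule ℓ a →ₗ[ℂ] LoopModule ℓ a :=
  lmono a μ.2 ∘ₗ wordProj m μ.1 ∘ₗ lcoeff a μ.2

theorem weightProj_of_mem {a : Fin m → ℂˣ} {μ μ' : AffineWeight ℓ} {f : LoopModule ℓ a}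
    (hf : f ∈ weightSpace ℓ (LoopModule ℓ a) μ') :
    weightProj a μ f = if μ' = μ then f else 0 := by
  obtain ⟨x, hx, rfl⟩ := (mem_weightSpace_iff a μ' f).1 hf
  rw [weightProj, LinearMap.comp_apply, LinearMap.comp_apply, lcoeff_lmono]
  split_ifs with h1 h2 h2
  · rw [← h2, hx]
  · rw [← hx, wordProj_wordProj, if_neg, map_zero]
    exact fun h3 => h2 (Prod.ext h3 h1)
  · exact absurd (congrArg Prod.snd h2) h1
  · rw [map_zero, map_zero]

theorem mem_weightSpace_subtype {a : Fin m → ℂˣ}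
    {N : LieSubmodule ℂ (AffineSl ℓ) (LoopModule ℓ a)} {μ : AffineWeight ℓ} {f : N} :
    f ∈ weightSpace ℓ N μ ↔ (f : LoopModule ℓ a) ∈ weightSpace ℓ (LoopModule ℓ a) μ := by
  refine and_congr (forall_congr' fun i => ?_) ?_ <;> exact Subtype.ext_iff

theorem iSupIndep_weightSpace {a : Fin m → ℂˣ}
    (N : LieSubmodule ℂ (AffineSl ℓ) (LoopModule ℓ a)) : iSupIndep (weightSpace ℓ N) := by
  intro μ
  rw [Submodule.disjoint_def]
  intro f hf hf'
  have h1 : ⨆ μ', ⨆ (_ : μ' ≠ μ), weightSpace ℓ N μ' ≤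
      LinearMap.ker (weightProj a μ ∘ₗ N.toSubmodule.subtype) := by
    refine iSup₂_le fun μ' hμ g hg => ?_
    rw [LinearMap.mem_ker, LinearMap.comp_apply, Submodule.subtype_apply,
      weightProj_of_mem (mem_weightSpace_subtype.1 hg), if_neg hμ]
  have h2 := h1 hf'
  rw [LinearMap.mem_ker, LinearMap.comp_apply, Submodule.subtype_apply,
      weightProj_of_mem (mem_weightSpace_subtype.1 hf), if_pos rfl] at h2
  exact Subtype.ext h2

/-! ### Integrability -/

/-- Each application of `E_{ab} ⊗ z^t`, `a ≠ b`, to a word replaces a letter `b` by `a`. -/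
theorem toEnd_matUnit_pow_lmono (a : Fin m → ℂˣ) (t : ℤ) {c d : Fin (ℓ + 1)} (h : c ≠ d) :
    ∀ (N : ℕ) (s : ℤ) (w : Fin m → Fin (ℓ + 1)), (Finset.univ.filter fun j => w j = d).card < N →
      (LieModule.toEnd ℂ (AffineSl ℓ) (LoopModule ℓ a) (ofLoop (mono t (matUnit ℓ c d h))) ^ N)
        (lmono a s (wordVec w)) = 0 := by
  intro N
  induction N with
  | zero => intro s w hw; exact absurd hw (Nat.not_lt_zero _)
  | succ N ih =>
    intro s w hw
    rw [pow_succ, Module.End.mul_apply, LieModule.toEnd_apply_apply, ofLoop_lie_lmono, evOp,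
      LinearMap.sum_apply, LinearMap.sum_apply, map_sum, map_sum]
    refine Finset.sum_eq_zero fun j _ => ?_
    rw [LinearMap.smul_apply, LinearMap.smul_apply, map_smul, map_smul, slot_matUnit,
      slotEnd_unitEnd_wordVec]
    split_ifs with hj
    · rw [ih, smul_zero]
      refine lt_of_lt_of_le (Finset.card_lt_card ?_) (Nat.lt_succ_iff.1 hw)
      refine (Finset.ssubset_iff_of_subset fun k hk => ?_).2
        ⟨j, by simpa using hj, by simpa using h⟩
      rw [Finset.mem_filter] at hk ⊢
      refine ⟨hk.1, ?_⟩
      by_cases hkj : k = j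
      · subst hkj; exact hj
      · rw [Function.update_of_ne hkj] at hk; exact hk.2
    · rw [map_zero, map_zero, smul_zero]

theorem exists_toEnd_matUnit_pow_eq_zero {a : Fin m → ℂˣ}
    (N : LieSubmodule ℂ (AffineSl ℓ) (LoopModule ℓ a)) (t : ℤ) {c d : Fin (ℓ + 1)} (h : c ≠ d)
    (f : N) : ∃ k : ℕ,
      (LieModule.toEnd ℂ (AffineSl ℓ) N (ofLoop (mono t (matUnit ℓ c d h))) ^ k) f = 0 := by
  have h1 : LieModule.toEnd ℂ (AffineSl ℓ) (LoopModule ℓ a) (ofLoop (mono t (matUnit ℓ c d h))) ^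
      (m + 1) = 0 := by
    refine lmono_wordVec_hom_ext fun s w => ?_
    refine toEnd_matUnit_pow_lmono a t h (m + 1) s w (Nat.lt_succ_iff.2 ?_)
    exact (Finset.card_le_univ _).trans (Fintype.card_fin m).le
  refine ⟨m + 1, Subtype.ext ?_⟩
  rw [LieSubmodule.coe_toEnd_pow, h1]
  rfl

variable [NeZero m] {ζ : ℂˣ}

theorem rotT_wordProj (t : Fin m) (ν : FiniteWeight ℓ) (x : TensorNat ℓ m) :
    rotT t (wordProj m ν x) = wordProj m ν (rotT t x) := by
  refine LinearMap.congr_fun (f := rotT t ∘ₗ wordProj m ν) (g := wordProj m ν ∘ₗ rotT t)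
    ((wordBasis ℓ m).ext fun w => ?_) x
  rw [wordBasis_apply, LinearMap.comp_apply, LinearMap.comp_apply, wordProj_wordVec, rotT_wordVec,
    wordProj_wordVec, wordWeight_rotate_symm]
  split_ifs
  · exact rotT_wordVec t w
  · exact map_zero _

theorem rotProj_wordProj (q : ℤ) (ν : FiniteWeight ℓ) (x : TensorNat ℓ m) :
    rotProj ζ q (wordProj m ν x) = wordProj m ν (rotProj ζ q x) := by
  simp only [rotProj_apply, map_smul, map_sum, rotT_wordProj]

theorem iSup_weightSpace_rotIsotypic (hζ : IsPrimitiveRoot (ζ : ℂ) m) (n : ℤ) :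
    ⨆ μ, weightSpace ℓ (rotIsotypic ℓ hζ n) μ = ⊤ := by
  rw [eq_top_iff]
  intro f _
  let S : Submodule ℂ (LoopModule ℓ (rootParams m ζ)) :=
    (⨆ μ, weightSpace ℓ (rotIsotypic ℓ hζ n) μ).map (rotIsotypic ℓ hζ n).toSubmodule.subtype
  have h1 : S.mkQ ∘ₗ loopProj ℓ m ζ n = 0 := by
    refine lmono_wordVec_hom_ext fun s w => ?_
    rw [LinearMap.comp_apply, LinearMap.zero_apply, Submodule.mkQ_apply,
      Submodule.Quotient.mk_eq_zero]
    refine ⟨⟨_, loopProj_mem hζ n (lmono _ s (wordVec w))⟩,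
      Submodule.mem_iSup_of_mem (wordWeight w, s) (mem_weightSpace_subtype.2 ?_), rfl⟩
    change loopProj ℓ m ζ n (lmono _ s (wordVec w)) ∈ _
    rw [loopProj_lmono]
    refine (lmono_mem_weightSpace_iff (rootParams m ζ) (wordWeight w, s) _).2 ?_
    rw [← rotProj_wordProj, wordProj_wordVec, if_pos rfl]
  have h2 := LinearMap.congr_fun h1 f.1
  rw [LinearMap.comp_apply, (mem_rotIsotypic hζ n _).1 f.2, LinearMap.zero_apply,
    Submodule.mkQ_apply, Submodule.Quotient.mk_eq_zero] at h2
  obtain ⟨g, hg, hgf⟩ := h2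
  rwa [← Subtype.ext (a1 := g) (a2 := f) hgf]

theorem isIntegrable_rotIsotypic [NeZero ℓ] (hζ : IsPrimitiveRoot (ζ : ℂ) m) (n : ℤ) :
    IsIntegrable ℓ (rotIsotypic ℓ hζ n) where
  isInternal := (DirectSum.isInternal_submodule_iff_iSupIndep_and_iSup_eq_top _).2
    ⟨iSupIndep_weightSpace _, iSup_weightSpace_rotIsotypic hζ n⟩
  locNilpotent_e _ f := exists_toEnd_matUnit_pow_eq_zero _ _ _ f
  locNilpotent_f _ f := exists_toEnd_matUnit_pow_eq_zero _ _ _ f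

omit [NeZero m] in
theorem isLevelZero_lieSubmodule {a : Fin m → ℂˣ}
    (N : LieSubmodule ℂ (AffineSl ℓ) (LoopModule ℓ a)) : IsLevelZero ℓ N := by
  intro f
  apply Subtype.ext
  rw [LieSubmodule.coe_bracket, elemK_lie]
  rfl

/-! ### Weight multiplicities of the module -/

/-- The vectors of weight `ν` in `V^{⊗m}` that each rotation by `t` multiplies by `ζ ^ (-q t)`. -/
noncomputable def rotWeightSpace (ζ : ℂˣ) (ν : FiniteWeight ℓ) (q : ℤ) :
    Submodule ℂ (TensorNat ℓ m) :=
  LinearMap.eqLocus (wordProj m ν) LinearMap.id ⊓ LinearMap.eqLocus (rotProj ζ q) LinearMap.id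

theorem mem_rotWeightSpace {ν : FiniteWeight ℓ} {q : ℤ} {x : TensorNat ℓ m} :
    x ∈ rotWeightSpace ζ ν q ↔ wordProj m ν x = x ∧ rotProj ζ q x = x := Iff.rfl

theorem map_weightSpace_rotIsotypic (hζ : IsPrimitiveRoot (ζ : ℂ) m) (n : ℤ) (μ : AffineWeight ℓ) :
    (weightSpace ℓ (rotIsotypic ℓ hζ n) μ).map (rotIsotypic ℓ hζ n).toSubmodule.subtype =
      (rotWeightSpace ζ μ.1 (μ.2 - n)).map (lmono (rootParams m ζ) μ.2) := by
  ext f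
  constructor
  · rintro ⟨g, hg, rfl⟩
    obtain ⟨x, hx, hxg⟩ := (mem_weightSpace_iff _ _ _).1 (mem_weightSpace_subtype.1 hg)
    refine ⟨x, mem_rotWeightSpace.2 ⟨hx, ?_⟩, hxg⟩
    rw [← lmono_mem_rotIsotypic hζ, hxg]
    exact g.2
  · rintro ⟨x, hx, rfl⟩
    obtain ⟨h1, h2⟩ := mem_rotWeightSpace.1 hx
    refine ⟨⟨lmono _ μ.2 x, (lmono_mem_rotIsotypic hζ n _ x).2 h2⟩, ?_, rfl⟩
    exact mem_weightSpace_subtype.2 ((lmono_mem_weightSpace_iff _ μ x).2 h1)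

omit [NeZero m] in
theorem finiteDimensional_tensorNat : FiniteDimensional ℂ (TensorNat ℓ m) :=
  Module.Basis.finiteDimensional_of_finite (wordBasis ℓ m)

theorem isAdmissible_rotIsotypic (hζ : IsPrimitiveRoot (ζ : ℂ) m) (n : ℤ) :
    IsAdmissible ℓ (rotIsotypic ℓ hζ n) := by
  intro μ
  have := finiteDimensional_tensorNat (ℓ := ℓ) (m := m)
  have h := map_weightSpace_rotIsotypic (ℓ := ℓ) hζ n μ
  have e := Submodule.equivMapOfInjective _ (Submodule.injective_subtype _)
    (weightSpace ℓ (rotIsotypic ℓ hζ n) μ)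
  rw [h] at e
  exact e.symm.finiteDimensional

theorem moduleCh_rotIsotypic (hζ : IsPrimitiveRoot (ζ : ℂ) m) (n : ℤ) (μ : AffineWeight ℓ) :
    moduleCh ℓ (rotIsotypic ℓ hζ n) μ =
      Module.finrank ℂ (rotWeightSpace (ℓ := ℓ) (m := m) ζ μ.1 (μ.2 - n)) := by
  have h := Submodule.finrank_map_subtype_eq (rotIsotypic ℓ hζ n).toSubmodule
    (weightSpace ℓ (rotIsotypic ℓ hζ n) μ)
  rw [map_weightSpace_rotIsotypic] at h
  refine h.symm.trans ?_
  exact (Submodule.equivMapOfInjective _ (lmono_injective _ _) _).symm.finrank_eq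

/-- The dimension is the trace of the projection, and a rotation permutes the basis of words, so
its trace counts the words it fixes. -/
theorem finrank_rotWeightSpace (hζ : IsPrimitiveRoot (ζ : ℂ) m) (ν : FiniteWeight ℓ) (q : ℤ) :
    (Module.finrank ℂ (rotWeightSpace (ℓ := ℓ) (m := m) ζ ν q) : ℂ) = 1 / m * ∑ t : Fin m,
      ((ζ : ℂ) ^ (t : ℕ)) ^ q * ((Finset.univ.filter fun w : Fin m → Fin (ℓ + 1) =>
        rotate t w = w ∧ wordWeight w = ν).card : ℂ) := by
  have := finiteDimensional_tensorNat (ℓ := ℓ) (m := m)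
  have h1 : LinearMap.IsProj (rotWeightSpace (ℓ := ℓ) (m := m) ζ ν q)
      (wordProj m ν ∘ₗ rotProj ζ q) := by
    constructor
    · intro x
      rw [mem_rotWeightSpace, LinearMap.comp_apply, wordProj_wordProj, if_pos rfl, rotProj_wordProj,
        rotProj_rotProj hζ, if_pos (by simp)]
      exact ⟨rfl, rfl⟩
    · intro x hx
      obtain ⟨h2, h3⟩ := mem_rotWeightSpace.1 hx
      rw [LinearMap.comp_apply, h3, h2]
  have := Module.Free.of_divisionRing ℂ (rotWeightSpace (ℓ := ℓ) (m := m) ζ ν q)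
  have := Module.Free.of_divisionRing ℂ (LinearMap.ker (wordProj m ν ∘ₗ rotProj (ℓ := ℓ) ζ q))
  rw [← h1.trace, LinearMap.trace_eq_matrix_trace ℂ (wordBasis ℓ m), Matrix.trace]
  have h2 : ∀ w : Fin m → Fin (ℓ + 1), (LinearMap.toMatrix (wordBasis ℓ m) (wordBasis ℓ m)
      (wordProj m ν ∘ₗ rotProj ζ q)).diag w = 1 / m * ∑ t : Fin m, ((ζ : ℂ) ^ (t : ℕ)) ^ q *
        (if rotate t w = w ∧ wordWeight w = ν then 1 else 0) := by
    intro w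
    have h3 : ∀ t : Fin m, (wordBasis ℓ m).repr (rotT t (wordVec w)) w =
        if rotate t w = w then 1 else 0 := by
      intro t
      rw [rotT_wordVec, ← wordBasis_apply, Module.Basis.repr_self, Finsupp.single_apply]
      simp only [Equiv.symm_apply_eq, eq_comm (a := w)]
    rw [Matrix.diag_apply, LinearMap.toMatrix_apply, LinearMap.comp_apply, repr_wordProj,
      wordBasis_apply, rotProj_apply]
    simp only [map_smul, map_sum, Finsupp.smul_apply, Finsupp.finsetSum_apply, h3, smul_eq_mul]
    split_ifs with h
    · simp [h]
    · simp [h]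
  simp only [h2]
  rw [← Finset.mul_sum, Finset.sum_comm]
  congr 1
  refine Finset.sum_congr rfl fun t _ => ?_
  rw [← Finset.mul_sum, Finset.card_filter]
  push_cast
  rfl

end Weights

/-! ### Comparison of the characters -/

section Characters

variable {ℓ m : ℕ} [NeZero ℓ] [NeZero m]

/-- The words that index the elements of weight `ν + r δ` of the crystal, where `s = r - n`. -/
noncomputable def componentWords (m : ℕ) [NeZero m] (ν : FiniteWeight ℓ) (s : ℤ) :
    Finset (Fin m → Fin (ℓ + 1)) :=
  Finset.univ.filter fun b => wordWeight b = ν ∧ (s : ZMod m) + cyclicMaj b = 0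

theorem image_weightSet (n : ℤ) (μ : AffineWeight ℓ) :
    Subtype.val '' (affineCrystalComponent ℓ m n).weightSet μ =
      (fun b => (b, μ.2)) '' (componentWords m μ.1 (μ.2 - n) : Set (Fin m → Fin (ℓ + 1))) := by
  have h1 : ∀ (b : Fin m → Fin (ℓ + 1)) (r : ℤ), (b, r) ∈ (affineCrystal ℓ m).generatedSet
      (crystalGen ℓ m n) ↔ ((r - n : ℤ) : ZMod m) + cyclicMaj b = 0 := by
    intro b r
    rw [mem_generatedSet_iff, ← sub_eq_zero, Int.cast_sub, sub_add_eq_add_sub]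
  obtain ⟨ν, r⟩ := μ
  ext ⟨b, s⟩
  constructor
  · rintro ⟨x, hw, hx⟩
    have hb := x.2
    change (wordWeight x.1.1, x.1.2) = (ν, r) at hw
    rw [hx] at hw hb
    obtain ⟨rfl, rfl⟩ := Prod.mk.inj hw
    exact ⟨b, by simpa [componentWords] using (h1 b s).1 hb, rfl⟩
  · rintro ⟨b, hb, hbs⟩
    obtain ⟨rfl, rfl⟩ := Prod.mk.inj hbs
    rw [Finset.mem_coe, componentWords, Finset.mem_filter] at hb
    refine ⟨⟨(b, r), (h1 b r).2 hb.2.2⟩, ?_, rfl⟩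
    change (wordWeight b, r) = (ν, r)
    rw [hb.2.1]

theorem isAdmissible_affineCrystalComponent (n : ℤ) :
    (affineCrystalComponent ℓ m n).IsAdmissible := by
  intro μ
  refine Set.Finite.of_finite_image (f := Subtype.val) ?_ Subtype.val_injective.injOn
  rw [image_weightSet]
  exact (Finset.finite_toSet _).image _

theorem ch_affineCrystalComponent (n : ℤ) (μ : AffineWeight ℓ) :
    (affineCrystalComponent ℓ m n).ch μ = (componentWords m μ.1 (μ.2 - n)).card := by
  rw [Crystal.ch, ← Set.ncard_image_of_injective _ Subtype.val_injective, image_weightSet,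
    Set.ncard_image_of_injective _ (fun _ _ h => (Prod.mk.inj h).1), Set.ncard_coe_finset]

omit [NeZero ℓ] in
/-- Cyclic sieving: the words of a given content and major index modulo `m` are counted by the
multiplicity of a character of the cyclic group in the permutation representation on the words of
that content. -/
theorem card_componentWords {ζ : ℂ} (hζ : IsPrimitiveRoot ζ m) (ν : FiniteWeight ℓ) (s : ℤ) :
    ((componentWords m ν s).card : ℂ) = 1 / m * ∑ t : Fin m, (ζ ^ (t : ℕ)) ^ s *
      ((Finset.univ.filter fun w : Fin m → Fin (ℓ + 1) =>
        rotate t w = w ∧ wordWeight w = ν).card : ℂ) := by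
  by_cases h : ∃ w : Fin m → Fin (ℓ + 1), wordWeight w = ν
  · obtain ⟨w, rfl⟩ := h
    have hw : ∀ b : Fin m → Fin (ℓ + 1), wordWeight b = wordWeight w ↔ content b = content w :=
      fun b => by rw [wordWeight_eq_tupleWeight w, wordWeight_eq_iff (sum_content w)]
    simp only [componentWords, hw, natCast_card_content_cyclicMaj hζ]
    congr 1
    refine Finset.sum_congr rfl fun t _ => ?_
    rw [card_rotate_content (orderOf_pow_val hζ t) t rfl]
  · push Not at h
    simp [componentWords, h]

theorem ch_eq_moduleCh {ζ : ℂˣ} (hζ : IsPrimitiveRoot (ζ : ℂ) m) (n : ℤ) :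
    (affineCrystalComponent ℓ m n).ch = moduleCh ℓ (rotIsotypic ℓ hζ n) := by
  funext μ
  rw [ch_affineCrystalComponent, moduleCh_rotIsotypic]
  have h : ((componentWords m μ.1 (μ.2 - n)).card : ℂ) = _ :=
    (card_componentWords hζ _ _).trans (finrank_rotWeightSpace hζ _ _).symm
  exact_mod_cast h

theorem ch_tupleWeight (n : ℤ) {k : Fin (ℓ + 1) → ℕ} (r : ℤ) (hk : ∑ i, k i = m) :
    ((affineCrystalComponent ℓ m n).ch (tupleWeight k, r) : ℚ) = weightMult k (r - n) := by
  obtain ⟨κ, rfl⟩ : ∃ κ : Fin (ℓ + 1) →₀ ℕ, ⇑κ = k :=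
    ⟨Finsupp.equivFunOnFinite.symm k, rfl⟩
  have hζ := Complex.isPrimitiveRoot_exp m (NeZero.ne m)
  have h := (natCast_card_content_cyclicMaj hζ κ (r - n)).trans
    (sum_zpow_mul_powerSumCoeff hζ κ hk (r - n))
  rw [ch_affineCrystalComponent]
  simp only [componentWords, wordWeight_eq_iff hk]
  exact_mod_cast h

theorem ch_eq_zero (n : ℤ) (ν : FiniteWeight ℓ) (r : ℤ)
    (h : ¬ ∃ k : Fin (ℓ + 1) → ℕ, ∑ i, k i = m ∧ ν = tupleWeight k) :
    (affineCrystalComponent ℓ m n).ch (ν, r) = 0 := by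
  rw [ch_affineCrystalComponent, Finset.card_eq_zero, componentWords, Finset.filter_eq_empty_iff]
  rintro b - ⟨rfl, -⟩
  exact h ⟨content b, sum_content b, wordWeight_eq_tupleWeight b⟩

end Characters

end LevelZero

theorem theoremC80 (ℓ m : ℕ) [NeZero ℓ] [NeZero m] (ζ : ℂˣ) (hζ : IsPrimitiveRoot ζ m)
    (n : ℕ) (hn : n < m) :
    -- the objects are as described: an indecomposable crystal and a simple integrable module
    -- of level zero, both with a well-defined formal character
    (LevelZero.affineCrystalComponent ℓ m n).IsIndecomposable ∧
    LieModule.IsIrreducible ℂ (LevelZero.AffineSl ℓ) (LevelZero.levelZeroModule ℓ m ζ n) ∧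
    LevelZero.IsIntegrable ℓ (LevelZero.levelZeroModule ℓ m ζ n) ∧
    LevelZero.IsLevelZero ℓ (LevelZero.levelZeroModule ℓ m ζ n) ∧
    (LevelZero.affineCrystalComponent ℓ m n).IsAdmissible ∧
    LevelZero.IsAdmissible ℓ (LevelZero.levelZeroModule ℓ m ζ n) ∧
    -- the formal characters agree
    (LevelZero.affineCrystalComponent ℓ m n).ch =
      LevelZero.moduleCh ℓ (LevelZero.levelZeroModule ℓ m ζ n) ∧
    -- the weight multiplicities
    (∀ (k : Fin (ℓ + 1) → ℕ) (r : ℤ), ∑ i, k i = m →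
      ((LevelZero.affineCrystalComponent ℓ m n).ch (LevelZero.tupleWeight k, r) : ℚ) =
        LevelZero.weightMult k (r - n)) ∧
    (∀ (ν : LevelZero.FiniteWeight ℓ) (r : ℤ),
      (¬ ∃ k : Fin (ℓ + 1) → ℕ, ∑ i, k i = m ∧ ν = LevelZero.tupleWeight k) →
      (LevelZero.affineCrystalComponent ℓ m n).ch (ν, r) = 0) := by
  have hζ' : IsPrimitiveRoot (ζ : ℂ) m := IsPrimitiveRoot.coe_units_iff.2 hζ
  have h := LevelZero.levelZeroModule_isIrreducible (ℓ := ℓ) hζ' n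
  rw [LevelZero.levelZeroModule_eq hζ'] at h ⊢
  exact ⟨LevelZero.Crystal.generated_isIndecomposable _ _, h,
    LevelZero.isIntegrable_rotIsotypic hζ' n, LevelZero.isLevelZero_lieSubmodule _,
    LevelZero.isAdmissible_affineCrystalComponent _, LevelZero.isAdmissible_rotIsotypic hζ' n,
    LevelZero.ch_eq_moduleCh hζ' n, fun _ r hk => LevelZero.ch_tupleWeight n r hk,
    fun ν r hν => LevelZero.ch_eq_zero n ν r hν⟩
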